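/- \textbf{Theorem (KEM Separation Theorem).} Let $(M,g)$ be a $C^\infty$ pseudo-Riemannian manifold of dimension $n$, of arbitrary signature and of constant curvature, with Levi-Civita connection $\nabla$. \emph{(1) Coordinate form.} Let $(x_1,\dots,x_n)$ be orthogonal local coordinates that are separable, i.e. near each point the geodesic Hamilton--Jacobi equation $\tfrac12 g^{ij}\,\partial_iW\,\partial_jW=E$ has a complete integral of the form $W=\sum_i W_i(x_i,c)$, $c\in\mathbb R^n$, $\det(\partial^2W/\partial x_i\partial c_j)\neq 0$. Then on every product of open intervals $\prod_i J_i$ contained in the coordinate domain there are a subset $S\subseteq\{1,\dots,n\}$, a partition $P$ of its complement, smooth functions $\Phi_a(x_a)$ and smooth non-constant functions $\sigma_a(x_a)$ for $a\in S$, pairwise distinct constants $e_I$ for $I\in P$, and smooth symmetric tensors $g^I=\sum_{i,j\in I} f^I_{ij}(x_I)\,dx_i\,dx_j$ whose coefficients depend only on the coordinates $x_I=(x_k)_{k\in I}$, such that $$g=\sum_{a\in S}\Phi_a\prod_{b\in S,\,b\ne a}(\sigma_a-\sigma_b)\,dx_a^2+\sum_{I\in P}\Big(\prod_{a\in S}(e_I-\sigma_a)\Big)g^I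 .$$ If $n>1$, this can be done non-trivially: $S\neq\emptyset$ or $P$ has at least two elements. \emph{(2) Tensor form.} A Killing tensor is a smooth symmetric $2$-tensor $K$ with $\nabla_{(i}K_{jk)}=0$; it is characteristic if at each point (as a $(1,1)$-tensor) it has $n$ distinct real eigenvalues and near each point it is diagonal in some local coordinates. A concircular tensor is a smooth symmetric $2$-tensor $L$ with $\nabla_kL_{ij}=\alpha_{(i}g_{j)k}$ for some covector field $\alpha$. Let $K$ be a characteristic Killing tensor on $M$ and let $U\subseteq M$ be open and simply connected ($U=M$ if $M$ is simply connected; in general, $U$ may be a small neighbourhood of any given point). Then there is a concircular tensor $L$ on $U$ which, if $n>1$, is at no point of $U$ a multiple of the metric, such that each eigenspace of $K$ at each point of $U$ is $L$-invariant. Moreover, $L$ can be chosen so that its eigenspaces are uniquely determined by the web of eigenspaces of $K$: they are the finest possible, i.e. for every concircular tensor $L'$ on an open set $V\subseteq U$ that leaves the eigenspaces of $K$ invariant, and every $p\in V$, each eigenspace of $L$ at $p$ is contained in an eigenspace of $L'$ at $p$. -/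

import Mathlib

open Set Manifold
open scoped ContDiff

noncomputable section

namespace KEM

/-! ### Coordinate formulas

A symmetric 2-tensor in coordinates is a matrix-valued function on `ℝⁿ`. -/

/-- The partial derivative `∂ᵢ f` at `x`. -/
def pd {n : ℕ} (i : Fin n) (f : (Fin n → ℝ) → ℝ) (x : Fin n → ℝ) : ℝ :=
  fderiv ℝ f x (Pi.single i 1)

/-- Christoffel symbols of the Levi-Civita connection,
`Γᵏᵢⱼ = ½ ∑ₗ gᵏˡ (∂ᵢ gⱼₗ + ∂ⱼ gᵢₗ - ∂ₗ gᵢⱼ)`. -/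
def christoffel {n : ℕ} (g : (Fin n → ℝ) → Matrix (Fin n) (Fin n) ℝ) (k i j : Fin n)
    (x : Fin n → ℝ) : ℝ :=
  (1 / 2) * ∑ l, (g x)⁻¹ k l *
    (pd i (fun y => g y j l) x + pd j (fun y => g y i l) x - pd l (fun y => g y i j) x)

/-- Components of the Riemann tensor: `R(∂ᵢ, ∂ⱼ) ∂ₖ = ∑ₗ (riemann g l k i j) ∂ₗ`, where
`R(X, Y) Z = ∇_X ∇_Y Z - ∇_Y ∇_X Z - ∇_[X,Y] Z`. -/
def riemann {n : ℕ} (g : (Fin n → ℝ) → Matrix (Fin n) (Fin n) ℝ) (l k i j : Fin n)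
    (x : Fin n → ℝ) : ℝ :=
  pd i (christoffel g l j k) x - pd j (christoffel g l i k) x
    + ∑ m, (christoffel g l i m x * christoffel g m j k x
      - christoffel g l j m x * christoffel g m i k x)

/-- `∇ₖ Tᵢⱼ` for a covariant 2-tensor `T` and the Levi-Civita connection of `g`. -/
def covDeriv {n : ℕ} (g T : (Fin n → ℝ) → Matrix (Fin n) (Fin n) ℝ) (k i j : Fin n)
    (x : Fin n → ℝ) : ℝ :=
  pd k (fun y => T y i j) x
    - ∑ l, christoffel g l k i x * T x l j - ∑ l, christoffel g l k j x * T x i l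

/-! ### Tensors on manifolds -/

section Manifold

variable {n : ℕ} {M : Type*} [TopologicalSpace M] [ChartedSpace (Fin n → ℝ) M]

/-- `φ` is a (smooth) local coordinate system of `M`. -/
def IsCoord (φ : OpenPartialHomeomorph M (Fin n → ℝ)) : Prop :=
  φ ∈ IsManifold.maximalAtlas 𝓘(ℝ, Fin n → ℝ) ∞ M

variable (n M) in
/-- Fields of bilinear forms on the tangent spaces of `M` (covariant 2-tensors, no regularity). -/
abbrev Tensor2 : Type _ :=
  (p : M) → LinearMap.BilinForm ℝ (TangentSpace 𝓘(ℝ, Fin n → ℝ) p)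

/-- The coordinate vector `∂ᵢ` of `φ` at the point with coordinates `x`. -/
def coordVec (φ : OpenPartialHomeomorph M (Fin n → ℝ)) (x : Fin n → ℝ) (i : Fin n) :
    TangentSpace 𝓘(ℝ, Fin n → ℝ) (φ.symm x) :=
  mfderiv 𝓘(ℝ, Fin n → ℝ) 𝓘(ℝ, Fin n → ℝ) φ.symm x (Pi.single i 1 : Fin n → ℝ)

/-- The components `Tᵢⱼ = T(∂ᵢ, ∂ⱼ)` of `T` in the coordinates `φ`. -/
def comp (T : Tensor2 n M) (φ : OpenPartialHomeomorph M (Fin n → ℝ)) (x : Fin n → ℝ) :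
    Matrix (Fin n) (Fin n) ℝ :=
  Matrix.of fun i j => T (φ.symm x) (coordVec φ x i) (coordVec φ x j)

/-- `T` is a smooth symmetric 2-tensor on the open set `U`. -/
def IsSmoothSymmOn (T : Tensor2 n M) (U : Set M) : Prop :=
  (∀ p ∈ U, ∀ v w, T p v w = T p w v) ∧
  ∀ φ : OpenPartialHomeomorph M (Fin n → ℝ), IsCoord φ → ∀ i j,
    ContDiffOn ℝ ∞ (fun x => comp T φ x i j) (φ.target ∩ φ.symm ⁻¹' U)

/-- `g` is a pseudo-Riemannian metric on `M` (of any signature). -/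
def IsPseudoRiemannian (g : Tensor2 n M) : Prop :=
  IsSmoothSymmOn g univ ∧ ∀ p, (g p).Nondegenerate

/-- `R(X, Y) Z = κ (g(Y, Z) X - g(X, Z) Y)`, i.e. all sectional curvatures equal `κ`. -/
def HasConstantCurvature (g : Tensor2 n M) (κ : ℝ) : Prop :=
  ∀ φ : OpenPartialHomeomorph M (Fin n → ℝ), IsCoord φ → ∀ x ∈ φ.target, ∀ l k i j,
    riemann (comp g φ) l k i j x =
      κ * (comp g φ x j k * (1 : Matrix (Fin n) (Fin n) ℝ) l i
        - comp g φ x i k * (1 : Matrix (Fin n) (Fin n) ℝ) l j)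

/-- The eigenspace at `p`, for the eigenvalue `μ`, of the `(1,1)`-tensor obtained from `T` by
raising an index with `g`: all `v` with `T(v, ·) = μ g(v, ·)`. -/
def eigSpace (g T : Tensor2 n M) (p : M) (μ : ℝ) :
    Submodule ℝ (TangentSpace 𝓘(ℝ, Fin n → ℝ) p) :=
  LinearMap.ker (T p - μ • g p)

/-- `K` is a Killing tensor on `M`: `∇₍ᵢ Kⱼₖ₎ = 0`. -/
def IsKilling (g K : Tensor2 n M) : Prop :=
  IsSmoothSymmOn K univ ∧
  ∀ φ : OpenPartialHomeomorph M (Fin n → ℝ), IsCoord φ → ∀ x ∈ φ.target, ∀ i j k,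
    covDeriv (comp g φ) (comp K φ) i j k x + covDeriv (comp g φ) (comp K φ) j k i x
      + covDeriv (comp g φ) (comp K φ) k i j x = 0

/-- `K` is a characteristic Killing tensor: at every point it has `n` distinct real eigenvalues,
and near every point there are coordinates in which it is diagonal (as a `(1,1)`-tensor). -/
def IsCharacteristicKilling (g K : Tensor2 n M) : Prop :=
  IsKilling g K ∧
  (∀ p, ∃ μ : Fin n → ℝ, Function.Injective μ ∧ ∀ i, eigSpace g K p (μ i) ≠ ⊥) ∧
  ∀ p, ∃ φ : OpenPartialHomeomorph M (Fin n → ℝ), IsCoord φ ∧ p ∈ φ.source ∧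
    ∀ x ∈ φ.target, ∀ i, ∃ μ : ℝ, coordVec φ x i ∈ eigSpace g K (φ.symm x) μ

/-- `L` is a concircular tensor on the open set `U`: `∇ₖ Lᵢⱼ = α₍ᵢ gⱼ₎ₖ` for some covector `α`. -/
def IsConcircularOn (g L : Tensor2 n M) (U : Set M) : Prop :=
  IsSmoothSymmOn L U ∧
  ∀ φ : OpenPartialHomeomorph M (Fin n → ℝ), IsCoord φ → ∀ x ∈ φ.target, φ.symm x ∈ U →
    ∃ α : Fin n → ℝ, ∀ i j k, covDeriv (comp g φ) (comp L φ) k i j x =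
      (1 / 2) * (α i * comp g φ x j k + α j * comp g φ x i k)

/-- On `U` each eigenspace of `K` is `L`-invariant. The vector `u` below is the image of `v` under
the `(1,1)`-tensor of `L`. -/
def LeavesEigenspacesInvariantOn (g K L : Tensor2 n M) (U : Set M) : Prop :=
  ∀ p ∈ U, ∀ μ : ℝ, ∀ v ∈ eigSpace g K p μ, ∃ u ∈ eigSpace g K p μ, ∀ w, L p v w = g p u w

/-- `L` is non-trivial on `U`: if `n > 1`, it is (at no point of `U`) a multiple of the metric. -/
def IsNontrivialOn (g L : Tensor2 n M) (U : Set M) : Prop :=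
  1 < n → ∀ p ∈ U, ∀ c : ℝ, L p ≠ c • g p

/-- The coordinates `φ` are orthogonal. -/
def IsOrthogonal (g : Tensor2 n M) (φ : OpenPartialHomeomorph M (Fin n → ℝ)) : Prop :=
  ∀ x ∈ φ.target, ∀ i j, i ≠ j → comp g φ x i j = 0

/-- The coordinates `φ` are separable: near each point the geodesic Hamilton–Jacobi equation
`½ ∑ᵢⱼ gⁱʲ ∂ᵢW ∂ⱼW = E` has a complete integral `W = ∑ᵢ Wᵢ(xᵢ, c)` that depends on parameters
`c = (c₁, …, cₙ)` with `det (∂²W / ∂xᵢ ∂cⱼ) ≠ 0`. -/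
def IsSeparable (g : Tensor2 n M) (φ : OpenPartialHomeomorph M (Fin n → ℝ)) : Prop :=
  ∀ x₀ ∈ φ.target, ∃ (V C : Set (Fin n → ℝ)) (W : Fin n → ℝ → (Fin n → ℝ) → ℝ)
      (E : (Fin n → ℝ) → ℝ),
    IsOpen V ∧ x₀ ∈ V ∧ V ⊆ φ.target ∧ IsOpen C ∧ C.Nonempty ∧
    (∀ i, ContDiffOn ℝ ∞ (fun q : ℝ × (Fin n → ℝ) => W i q.1 q.2)
      (((fun x : Fin n → ℝ => x i) '' V) ×ˢ C)) ∧
    ∀ x ∈ V, ∀ c ∈ C,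
      (1 / 2) * ∑ i, ∑ j, (comp g φ x)⁻¹ i j *
        deriv (fun t => W i t c) (x i) * deriv (fun t => W j t c) (x j) = E c ∧
      (Matrix.of fun i j => pd j (fun c' => deriv (fun t => W i t c') (x i)) c).det ≠ 0

end Manifold

/-- On the box `∏ᵢ J i` the metric components `g` have the concircular form
`g = ∑_{a ∈ S} Φₐ ∏_{b ∈ S, b ≠ a} (σₐ - σ_b) dxₐ² + ∑_I (∏_{a ∈ S} (e_I - σₐ)) gᴵ`,
where `Φₐ`, `σₐ` are functions of `xₐ`, no `σₐ` is constant, and `gᴵ` is a metric in the coordinates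
of the block `I`. The blocks `I` form the partition of the complement of `S` into the level sets
of `e`, so the constants `e_I` are distinct. The last condition says that the associated tensor
`∑_{a ∈ S} σₐ ∂ₐ ⊗ dxₐ + ∑_I e_I ∑_{i ∈ I} ∂ᵢ ⊗ dxᵢ` is not a multiple of the identity if
`n > 1`. -/
def HasConcircularForm {n : ℕ} (g : (Fin n → ℝ) → Matrix (Fin n) (Fin n) ℝ)
    (J : Fin n → Set ℝ) : Prop :=
  ∃ (S : Finset (Fin n)) (e : Fin n → ℝ) (Φ σ : Fin n → ℝ → ℝ)
    (f : Fin n → Fin n → (Fin n → ℝ) → ℝ),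
    (∀ a ∈ S, ContDiffOn ℝ ∞ (Φ a) (J a) ∧ ContDiffOn ℝ ∞ (σ a) (J a) ∧
      ∃ s ∈ J a, ∃ t ∈ J a, σ a s ≠ σ a t) ∧
    (∀ i j, i ∉ S → j ∉ S → e i = e j → ContDiffOn ℝ ∞ (f i j) (univ.pi J) ∧
      ∀ x ∈ univ.pi J, ∀ y ∈ univ.pi J, (∀ k, k ∉ S → e k = e i → x k = y k) →
        f i j x = f i j y) ∧
    (∀ x ∈ univ.pi J,
      (∀ a ∈ S, g x a a = Φ a (x a) * ∏ b ∈ S.erase a, (σ a (x a) - σ b (x b))) ∧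
      (∀ i j, i ∉ S → j ∉ S → e i = e j →
        g x i j = (∏ a ∈ S, (e i - σ a (x a))) * f i j x) ∧
      (∀ i j, i ≠ j → (i ∈ S ∨ j ∈ S ∨ e i ≠ e j) → g x i j = 0)) ∧
    (1 < n → S.Nonempty ∨ ∃ i j, e i ≠ e j)

end KEM

end

noncomputable section

namespace KEM

/-! ### Partial derivatives -/

section PartialDerivatives

variable {n : ℕ} {f f₁ f₂ : (Fin n → ℝ) → ℝ} {x : Fin n → ℝ} {Ω : Set (Fin n → ℝ)}

/-! Write hᵢ for the diagonal components of the metric in orthogonal coordinates and aᵢⱼ = ∂ⱼ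
log|hᵢ| (`logPd h i j`). Both parts of the theorem reduce to one system of equations.
Differentiating the Hamilton–Jacobi equation (`OrthMetric.levi_civita_of_separable`), or using the
integrability of the Killing equation for distinct eigenvalues
(`OrthMetric.levi_civita_of_killing`), gives the Levi-Civita conditions. Combined with constant
curvature they become `SepSystem`: ∂ₖaᵢⱼ = 0 for distinct indices, a quadratic relation among the
aᵢⱼ, ∂ᵢaᵢⱼ = −aᵢⱼaⱼᵢ, and the Gauss equations.

A concircular tensor that leaves the coordinate lines invariant is diagonal, with eigenvalues λⱼ(xⱼ)
satisfying λⱼ' = (λⱼ − λᵢ)aᵢⱼ for all i ≠ j (`IsSol`). This linear system is overdetermined; the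
core of the proof is that it has a solution with at least two different eigenvalues.

Locally (`SepSystem.exists_sol_local`), restrict to a box where each aᵢⱼ vanishes identically or
nowhere. By the quadratic relation, "aᵢⱼ ≠ 0" is a forest-like order on the indices. If the forest
splits into two unrelated parts, the indicator of one part is a solution: the metric is locally a
product. Otherwise some p is a root, every hᵢ with i ≠ p depends on xₚ, and the function ∂ₚ
log|∂ₚhᵢ| is common to all such i and depends on xₚ alone; integrating it produces a solution.

To pass to a prescribed box (`IsSol.extend`), integrate the equation for one index along a
coordinate line. The equations for the other indices hold near one point of the line, and must be
propagated. Along the line the relevant functions generate a finitely generated algebra closed under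
a multiple of d/dt; it is Noetherian, so an element that vanishes near a point solves a linear
homogeneous system and vanishes identically (`eq_zero_of_mem_adjoin`). This replaces analyticity of
the metric.

Given a solution, dividing hᵢ by the product of the differences λᵢ − λ_b over nonconstant λ_b
removes the dependence on all coordinates outside the block of i, which is the coordinate form
(`SepSystem.hasConcircularForm`).

For the tensor form, solutions on a box are determined by their values at a point and every local
solution extends to the box. Hence germs of invariant concircular tensors form a covering space, and
germs continue over simply connected sets. The coincidences λᵢ = λⱼ of a solution do not depend on
the point of the box, so a germ that is generic at one point (`exists_generic`) continues to a
tensor with the finest eigenspaces everywhere, and a nontrivial one because nontrivial solutions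
exist (`exists_finest_concircular`). -/

lemma pd_congr (h : f₁ =ᶠ[nhds x] f₂) (i : Fin n) : pd i f₁ x = pd i f₂ x := by
  unfold pd; rw [h.fderiv_eq]

lemma pd_congr_on (hΩ : IsOpen Ω) (hx : x ∈ Ω) (h : ∀ y ∈ Ω, f₁ y = f₂ y) (i : Fin n) :
    pd i f₁ x = pd i f₂ x :=
  pd_congr (Filter.eventuallyEq_of_mem (hΩ.mem_nhds hx) h) i

lemma pd_const (c : ℝ) (i : Fin n) : pd i (fun _ => c) x = 0 := by
  simp [pd]

lemma pd_eq_zero_of_eqOn (hΩ : IsOpen Ω) (hx : x ∈ Ω) (h : ∀ y ∈ Ω, f y = 0) (i : Fin n) :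
    pd i f x = 0 := by
  rw [pd_congr_on hΩ hx h, pd_const]

lemma pd_add (h₁ : DifferentiableAt ℝ f₁ x) (h₂ : DifferentiableAt ℝ f₂ x) (i : Fin n) :
    pd i (fun y => f₁ y + f₂ y) x = pd i f₁ x + pd i f₂ x := by
  simp [pd, fderiv_fun_add h₁ h₂]

lemma pd_sub (h₁ : DifferentiableAt ℝ f₁ x) (h₂ : DifferentiableAt ℝ f₂ x) (i : Fin n) :
    pd i (fun y => f₁ y - f₂ y) x = pd i f₁ x - pd i f₂ x := by
  simp [pd, fderiv_fun_sub h₁ h₂]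

lemma pd_mul (h₁ : DifferentiableAt ℝ f₁ x) (h₂ : DifferentiableAt ℝ f₂ x) (i : Fin n) :
    pd i (fun y => f₁ y * f₂ y) x = pd i f₁ x * f₂ x + f₁ x * pd i f₂ x := by
  simp [pd, fderiv_fun_mul h₁ h₂]; ring

lemma pd_const_mul (c : ℝ) (h₁ : DifferentiableAt ℝ f x) (i : Fin n) :
    pd i (fun y => c * f y) x = c * pd i f x := by
  rw [pd_mul (differentiableAt_const c) h₁, pd_const]; ring

lemma pd_sum {ι : Type*} {s : Finset ι} {F : ι → (Fin n → ℝ) → ℝ}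
    (h : ∀ a ∈ s, DifferentiableAt ℝ (F a) x) (i : Fin n) :
    pd i (fun y => ∑ a ∈ s, F a y) x = ∑ a ∈ s, pd i (F a) x := by
  simp [pd, fderiv_fun_sum h]

lemma pd_log (h : DifferentiableAt ℝ f x) (h0 : f x ≠ 0) (i : Fin n) :
    pd i (fun y => Real.log (f y)) x = pd i f x / f x := by
  simp only [pd]
  rw [fderiv.log h h0]
  simp [div_eq_inv_mul]

lemma pd_inv (h : DifferentiableAt ℝ f x) (h0 : f x ≠ 0) (i : Fin n) :
    pd i (fun y => (f y)⁻¹) x = -pd i f x / (f x) ^ 2 := by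
  have := ((hasDerivAt_inv h0).comp_hasFDerivAt x h.hasFDerivAt).fderiv
  simp only [pd]
  rw [show (fun y => (f y)⁻¹) = (fun t : ℝ => t⁻¹) ∘ f from rfl, this]
  simp; ring

lemma differentiableAt_of_contDiffOn (hf : ContDiffOn ℝ ∞ f Ω) (hΩ : IsOpen Ω) (hx : x ∈ Ω) :
    DifferentiableAt ℝ f x :=
  (hf.contDiffAt (hΩ.mem_nhds hx)).differentiableAt (by simp)

lemma contDiffOn_pd (hf : ContDiffOn ℝ ∞ f Ω) (hΩ : IsOpen Ω) (i : Fin n) :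
    ContDiffOn ℝ ∞ (pd i f) Ω := by
  have h1 : ContDiffOn ℝ ∞ (fderiv ℝ f) Ω := hf.fderiv_of_isOpen hΩ (by simp)
  exact h1.clm_apply contDiffOn_const

lemma pd_comm (hf : ContDiffOn ℝ ∞ f Ω) (hΩ : IsOpen Ω) (hx : x ∈ Ω) (i j : Fin n) :
    pd i (pd j f) x = pd j (pd i f) x := by
  have hfa : ContDiffAt ℝ ∞ f x := hf.contDiffAt (hΩ.mem_nhds hx)
  have hs : IsSymmSndFDerivAt ℝ f x := hfa.isSymmSndFDerivAt (by
    rw [minSmoothness_of_isRCLikeNormedField]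
    exact WithTop.coe_le_coe.2 (le_top (a := (2 : ℕ∞))))
  have h1 : DifferentiableAt ℝ (fderiv ℝ f) x :=
    (hfa.fderiv_right (m := 1) (by norm_cast)).differentiableAt (by simp)
  have key : ∀ v w : Fin n → ℝ, fderiv ℝ (fun y => fderiv ℝ f y v) x w
      = fderiv ℝ (fderiv ℝ f) x w v := by
    intro v w
    rw [fderiv_clm_apply h1 (differentiableAt_const v)]
    simp
  show fderiv ℝ (fun y => fderiv ℝ f y _) x _ = fderiv ℝ (fun y => fderiv ℝ f y _) x _
  rw [key, key]
  exact hs _ _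

lemma hasDerivAt_update_line {i : Fin n} {t : ℝ}
    (h : DifferentiableAt ℝ f (Function.update x i t)) :
    HasDerivAt (fun s => f (Function.update x i s)) (pd i f (Function.update x i t)) t := by
  have h1 : HasDerivAt (fun s => Function.update x i s) (Pi.single i (1 : ℝ)) t :=
    hasDerivAt_update x i t
  exact h.hasFDerivAt.comp_hasDerivAt t h1

lemma hasDerivAt_line (h : DifferentiableAt ℝ f x) (i : Fin n) :
    HasDerivAt (fun s => f (Function.update x i s)) (pd i f x) (x i) := by
  have := hasDerivAt_update_line (f := f) (x := x) (i := i) (t := x i)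
    (by rwa [Function.update_eq_self])
  rwa [Function.update_eq_self] at this

lemma contDiff_update (x : Fin n → ℝ) (i : Fin n) :
    ContDiff ℝ ∞ (fun t : ℝ => Function.update x i t) := by
  rw [contDiff_pi]
  intro j
  by_cases h : j = i
  · subst h; simpa using contDiff_fun_id
  · simpa [Function.update_of_ne h] using contDiff_const

end PartialDerivatives

/-! ### Boxes -/

section Boxes

variable {n : ℕ}

/-- A family of nonempty open intervals. -/
def IsBox (J : Fin n → Set ℝ) : Prop := ∀ i, IsOpen (J i) ∧ (J i).OrdConnected ∧ (J i).Nonempty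

variable {J : Fin n → Set ℝ} {x y : Fin n → ℝ}

lemma IsBox.isOpen (hJ : IsBox J) : IsOpen (univ.pi J) :=
  isOpen_set_pi finite_univ fun i _ => (hJ i).1

lemma IsBox.nonempty (hJ : IsBox J) : (univ.pi J).Nonempty :=
  univ_pi_nonempty_iff.2 fun i => (hJ i).2.2

lemma update_mem_box (hx : x ∈ univ.pi J) {i : Fin n} {t : ℝ} (ht : t ∈ J i) :
    Function.update x i t ∈ univ.pi J := by
  intro j _
  by_cases h : j = i
  · subst h; simpa
  · simpa [Function.update_of_ne h] using hx j (mem_univ _)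

lemma exists_box_subset {Ω : Set (Fin n → ℝ)} (hΩ : IsOpen Ω) (hx : x ∈ Ω) :
    ∃ J, IsBox J ∧ x ∈ univ.pi J ∧ univ.pi J ⊆ Ω := by
  obtain ⟨r, hr, hb⟩ := Metric.isOpen_iff.1 hΩ x hx
  refine ⟨fun i => Metric.ball (x i) r, fun i => ⟨Metric.isOpen_ball, ?_, ?_⟩, ?_, ?_⟩
  · simp only [Real.ball_eq_Ioo]; exact ordConnected_Ioo
  · exact ⟨x i, Metric.mem_ball_self hr⟩
  · intro i _; exact Metric.mem_ball_self hr
  · rw [← ball_pi x hr]; exact hb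

/-- A function on a box whose derivatives in the directions of `s` vanish does not depend on the
coordinates in `s`. -/
lemma eq_of_pd_eq_zero (hJ : IsBox J) {f : (Fin n → ℝ) → ℝ}
    (hf : ∀ x ∈ univ.pi J, DifferentiableAt ℝ f x) (s : Finset (Fin n))
    (h : ∀ i ∈ s, ∀ x ∈ univ.pi J, pd i f x = 0) (hx : x ∈ univ.pi J) (hy : y ∈ univ.pi J)
    (hxy : ∀ i ∉ s, x i = y i) : f x = f y := by
  classical
  induction s using Finset.induction_on generalizing x with
  | empty => congr 1; ext i; exact hxy i (by simp)
  | insert a s ha ih =>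
    have h1 : f (Function.update x a (y a)) = f y := by
      refine ih (fun i hi => h i (Finset.mem_insert_of_mem hi))
        (update_mem_box hx (hy a (mem_univ a))) ?_
      intro i hi
      by_cases hia : i = a
      · subst hia; simp
      · rw [Function.update_of_ne hia]; exact hxy i (by simp [hia, hi])
    have h2 : ∀ t ∈ J a, HasDerivAt (fun s => f (Function.update x a s)) 0 t := by
      intro t ht
      have := hasDerivAt_update_line (hf _ (update_mem_box hx ht))
      rwa [h a (by simp) _ (update_mem_box hx ht)] at this
    have h3 := (hJ a).1.is_const_of_deriv_eq_zero (hJ a).2.1.isPreconnected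
      (fun t ht => (h2 t ht).differentiableAt.differentiableWithinAt)
      (fun t ht => (h2 t ht).deriv) (hx a (mem_univ a)) (hy a (mem_univ a))
    rw [← h1, ← h3, Function.update_eq_self]

/-- A function on an open interval with zero derivative is constant. -/
lemma eq_of_hasDerivAt_zero {I : Set ℝ} (hI : IsOpen I) (hc : I.OrdConnected) {f : ℝ → ℝ}
    (h : ∀ t ∈ I, HasDerivAt f 0 t) {s t : ℝ} (hs : s ∈ I) (ht : t ∈ I) : f s = f t :=
  hI.is_const_of_deriv_eq_zero hc.isPreconnected
    (fun t ht => (h t ht).differentiableAt.differentiableWithinAt)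
    (fun t ht => (h t ht).deriv) hs ht

end Boxes

end KEM

end

noncomputable section

namespace KEM

/-! ### A unique continuation principle for solutions of polynomial differential systems -/

section UniqueContinuation

/-- A solution of a linear homogeneous system that vanishes at one point is zero. -/
lemma eq_zero_of_linear_ode {m : ℕ} {J : Set ℝ} (hc : J.OrdConnected)
    {v : ℝ → Fin m → ℝ} {N : ℝ → Fin m → Fin m → ℝ}
    (hN : ∀ k l, ContinuousOn (fun t => N t k l) J)
    (hv : ∀ t ∈ J, HasDerivAt v (fun k => ∑ l, N t k l * v t l) t)
    {t₀ : ℝ} (ht₀ : t₀ ∈ J) (h0 : v t₀ = 0) {t : ℝ} (ht : t ∈ J) : v t = 0 := by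
  have hsub : uIcc t₀ t ⊆ J := hc.uIcc_subset ht₀ ht
  have hb : ∃ C : ℝ, 0 ≤ C ∧ ∀ s ∈ uIcc t₀ t, ∀ k l, |N s k l| ≤ C := by
    have h1 : ContinuousOn (fun s => ∑ k, ∑ l, |N s k l|) (uIcc t₀ t) :=
      continuousOn_finsetSum _ fun k _ => continuousOn_finsetSum _ fun l _ =>
        ((hN k l).mono hsub).abs
    obtain ⟨C, hC⟩ := isCompact_uIcc.exists_bound_of_continuousOn h1
    refine ⟨max C 0, le_max_right _ _, fun s hs k l => le_trans ?_ (le_max_left _ _)⟩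
    refine le_trans ?_ (le_trans (le_abs_self _) (hC s hs))
    refine le_trans ?_ (Finset.single_le_sum (f := fun k => ∑ l, |N s k l|)
      (fun k _ => Finset.sum_nonneg fun l _ => abs_nonneg _) (Finset.mem_univ k))
    exact Finset.single_le_sum (f := fun l => |N s k l|) (fun l _ => abs_nonneg _)
      (Finset.mem_univ l)
  obtain ⟨C, hC0, hC⟩ := hb
  let V : ℝ → (Fin m → ℝ) → Fin m → ℝ := fun t w k => ∑ l, N t k l * w l
  -- For the sup norm, an m × m matrix with entries bounded by C has Lipschitz constant m * C.
  let K : NNReal := ⟨m * C, by positivity⟩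
  have hL : ∀ s ∈ uIcc t₀ t, LipschitzOnWith K (V s) univ := by
    intro s hs
    rw [lipschitzOnWith_univ]
    refine LipschitzWith.of_dist_le_mul fun w w' => ?_
    rw [dist_pi_le_iff (by positivity)]
    intro k
    rw [Real.dist_eq, ← Finset.sum_sub_distrib]
    calc |∑ l, (N s k l * w l - N s k l * w' l)|
        ≤ ∑ l, |N s k l * w l - N s k l * w' l| := Finset.abs_sum_le_sum_abs _ _
      _ ≤ ∑ _l : Fin m, C * dist w w' := by
          refine Finset.sum_le_sum fun l _ => ?_
          rw [← mul_sub, abs_mul]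
          exact mul_le_mul (hC s hs k l) (by rw [← Real.dist_eq]; exact dist_le_pi_dist w w' l)
            (abs_nonneg _) hC0
      _ = K * dist w w' := by
          have : (K : ℝ) = m * C := rfl
          rw [this]; simp; ring
  have hz : ∀ s, HasDerivAt (fun _ : ℝ => (0 : Fin m → ℝ)) (V s 0) s := by
    intro s
    have : V s 0 = 0 := by ext k; simp [V]
    rw [this]; exact hasDerivAt_const _ _
  have hcont : ContinuousOn v (uIcc t₀ t) :=
    fun s hs => (hv s (hsub hs)).continuousAt.continuousWithinAt
  rcases le_total t₀ t with h | h
  · rw [uIcc_of_le h] at *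
    exact ODE_solution_unique_of_mem_Icc_right (v := V) (K := K) (s := fun _ => univ)
      (fun s hs => hL s (Ico_subset_Icc_self hs)) hcont
      (fun s hs => (hv s (hsub (Ico_subset_Icc_self hs))).hasDerivWithinAt) (fun _ _ => mem_univ _)
      continuousOn_const (fun s _ => (hz s).hasDerivWithinAt) (fun _ _ => mem_univ _) h0
      ⟨h, le_rfl⟩
  · rw [uIcc_of_ge h] at *
    exact ODE_solution_unique_of_mem_Icc_left (v := V) (K := K) (s := fun _ => univ)
      (fun s hs => hL s (Ioc_subset_Icc_self hs)) hcont
      (fun s hs => (hv s (hsub (Ioc_subset_Icc_self hs))).hasDerivWithinAt) (fun _ _ => mem_univ _)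
      continuousOn_const (fun s _ => (hz s).hasDerivWithinAt) (fun _ _ => mem_univ _) h0
      ⟨le_rfl, h⟩

variable {ι : Type*} {G : ι → ℝ → ℝ} {ρ : ℝ → ℝ} {J : Set ℝ}

/-- The operator ρ⁻¹ d/dt is a derivation, so closure need only be checked on generators. -/
lemma exists_deriv_mem_adjoin
    (hD : ∀ i, ∃ X ∈ Algebra.adjoin ℝ (range G), ∀ t ∈ J, HasDerivAt (G i) (ρ t * X t) t)
    {f : ℝ → ℝ} (hf : f ∈ Algebra.adjoin ℝ (range G)) :
    ∃ f' ∈ Algebra.adjoin ℝ (range G), ∀ t ∈ J, HasDerivAt f (ρ t * f' t) t := by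
  induction hf using Algebra.adjoin_induction with
  | mem f hf => obtain ⟨i, rfl⟩ := hf; exact hD i
  | algebraMap r =>
    refine ⟨0, zero_mem _, fun t _ => ?_⟩
    simpa using! hasDerivAt_const t r
  | add f₁ f₂ _ _ h₁ h₂ =>
    obtain ⟨f₁', m₁, h₁⟩ := h₁
    obtain ⟨f₂', m₂, h₂⟩ := h₂
    refine ⟨f₁' + f₂', add_mem m₁ m₂, fun t ht => ?_⟩
    convert! (h₁ t ht).add (h₂ t ht) using 1
    simp; ring
  | mul f₁ f₂ hf₁ hf₂ h₁ h₂ =>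
    obtain ⟨f₁', m₁, h₁⟩ := h₁
    obtain ⟨f₂', m₂, h₂⟩ := h₂
    refine ⟨f₁' * f₂ + f₁ * f₂', add_mem (mul_mem m₁ hf₂) (mul_mem hf₁ m₂), fun t ht => ?_⟩
    convert! (h₁ t ht).mul (h₂ t ht) using 1
    simp; ring

/-- Let a finitely generated algebra of functions on an interval be closed under `ρ⁻¹ d/dt`. If an
element of it vanishes near one point, it vanishes identically. Since the algebra is Noetherian,
finitely many iterated derivatives of the function satisfy a linear homogeneous system. -/
theorem eq_zero_of_mem_adjoin [Finite ι] (hc : J.OrdConnected) (hJ : IsOpen J)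
    (hρ : ContinuousOn ρ J) (hρ0 : ∀ t ∈ J, ρ t ≠ 0)
    (hD : ∀ i, ∃ X ∈ Algebra.adjoin ℝ (range G), ∀ t ∈ J, HasDerivAt (G i) (ρ t * X t) t)
    {f : ℝ → ℝ} (hf : f ∈ Algebra.adjoin ℝ (range G)) {t₀ : ℝ} (ht₀ : t₀ ∈ J)
    (h0 : f =ᶠ[nhds t₀] 0) {t : ℝ} (ht : t ∈ J) : f t = 0 := by
  set A := Algebra.adjoin ℝ (range G) with hA
  have : IsNoetherianRing A :=
    isNoetherianRing_of_fg (Subalgebra.fg_def.2 ⟨range G, finite_range G, rfl⟩)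
  have hD' : ∀ a : A, ∃ a' : A, ∀ t ∈ J, HasDerivAt (a : ℝ → ℝ) (ρ t * (a' : ℝ → ℝ) t) t := by
    intro a
    obtain ⟨a', m, h⟩ := exists_deriv_mem_adjoin hD a.2
    exact ⟨⟨a', m⟩, h⟩
  choose D hD using hD'
  let s : ℕ → A := fun k => D^[k] ⟨f, hf⟩
  have hs : ∀ k, s (k + 1) = D (s k) := fun k => Function.iterate_succ_apply' _ _ _
  -- The ideals generated by the first m iterated derivatives stabilise, so the m-th derivative is a
  -- combination of its predecessors with coefficients in the algebra.
  let I : ℕ →o Ideal A :=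
    { toFun := fun m => Ideal.span (range fun k : Fin m => s k)
      monotone' := fun m m' h => Ideal.span_mono (by
        rintro _ ⟨k, rfl⟩
        exact ⟨⟨k, k.2.trans_le h⟩, rfl⟩) }
  obtain ⟨m, hm⟩ := monotone_stabilizes_iff_noetherian.2 this I
  have hsm : s m ∈ I m := by
    rw [hm (m + 1) (Nat.le_succ m)]
    exact Ideal.subset_span ⟨⟨m, Nat.lt_succ_self m⟩, rfl⟩
  obtain ⟨c, hcs⟩ := Ideal.mem_span_range_iff_exists_fun.1 hsm
  have hcont : ∀ a : A, ContinuousOn (a : ℝ → ℝ) J :=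
    fun a t ht => (hD a t ht).continuousAt.continuousWithinAt
  have hev : ∀ k, (s k : ℝ → ℝ) =ᶠ[nhds t₀] 0 := by
    intro k
    induction k with
    | zero => exact h0
    | succ k ih =>
      filter_upwards [ih.eventuallyEq_nhds, hJ.mem_nhds ht₀] with r hr hrJ
      have h1 := hD (s k) r hrJ
      have h2 : HasDerivAt (s k : ℝ → ℝ) 0 r :=
        (hasDerivAt_const r (0 : ℝ)).congr_of_eventuallyEq hr
      rw [hs]
      exact (mul_eq_zero.1 (h1.unique h2)).resolve_left (hρ0 r hrJ)
  let v : ℝ → Fin m → ℝ := fun t k => (s k : ℝ → ℝ) t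
  -- A companion matrix: each row shifts to the next derivative, and the last one uses the relation
  -- just found. The factor ρ turns ρ⁻¹ d/dt back into d/dt.
  let N : ℝ → Fin m → Fin m → ℝ := fun t k l =>
    ρ t * (if (k : ℕ) + 1 < m then (if (l : ℕ) = k + 1 then 1 else 0) else (c l : ℝ → ℝ) t)
  have hv : ∀ t ∈ J, v t = 0 := by
    intro t ht
    refine eq_zero_of_linear_ode hc (N := N) (v := v) ?_ ?_ ht₀ ?_ ht
    · intro k l
      refine hρ.mul ?_
      split_ifs
      · exact continuousOn_const
      · exact continuousOn_const
      · exact hcont _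
    · intro t ht
      rw [hasDerivAt_pi]
      intro k
      have h1 := hD (s k) t ht
      rw [← hs] at h1
      convert! h1 using 1
      simp only [N]
      by_cases hk : (k : ℕ) + 1 < m
      · rw [Finset.sum_eq_single (⟨k + 1, hk⟩ : Fin m)]
        · simp [hk, v]
        · intro l _ hl
          have : (l : ℕ) ≠ k + 1 := fun h => hl (Fin.ext h)
          simp [hk, this]
        · simp
      · have hkm : (k : ℕ) + 1 = m := by omega
        simp only [hkm]
        rw [← hcs]
        simp [Finset.mul_sum, mul_assoc, v]
    · ext k; exact (hev k).eq_of_nhds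
  -- For m = 0 the vector v has no component carrying f, but then f lies in the zero ideal.
  rcases Nat.eq_zero_or_pos m with rfl | hm0
  · have : s 0 = 0 := by rw [← hcs]; simp
    have := congrArg (fun a : A => (a : ℝ → ℝ) t) this
    simpa [s] using! this
  · exact congrFun (hv t ht) ⟨0, hm0⟩

end UniqueContinuation

end KEM

end

noncomputable section

namespace KEM

/-! ### Separable orthogonal metrics of constant curvature -/

section SepSystem

variable {n : ℕ}

/-- The logarithmic derivative `∂ⱼ log |hᵢ|`. -/
def logPd (h : Fin n → (Fin n → ℝ) → ℝ) (i j : Fin n) : (Fin n → ℝ) → ℝ :=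
  pd j (fun y => Real.log (h i y))

/-- The differential equations satisfied by the diagonal components `hᵢ` of a metric of constant
curvature `κ` in separable orthogonal coordinates. -/
structure SepSystem (κ : ℝ) (h : Fin n → (Fin n → ℝ) → ℝ) (Ω : Set (Fin n → ℝ)) : Prop where
  isOpen : IsOpen Ω
  smooth : ∀ i, ContDiffOn ℝ ∞ (h i) Ω
  ne_zero : ∀ i, ∀ x ∈ Ω, h i x ≠ 0
  pd_mixed : ∀ i j k, i ≠ j → i ≠ k → j ≠ k → ∀ x ∈ Ω, pd k (logPd h i j) x = 0
  quad : ∀ i j k, i ≠ j → i ≠ k → j ≠ k → ∀ x ∈ Ω, logPd h k i x * logPd h k j x =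
    logPd h k i x * logPd h i j x + logPd h k j x * logPd h j i x
  pd_self : ∀ i j, i ≠ j → ∀ x ∈ Ω, pd i (logPd h i j) x = -(logPd h i j x * logPd h j i x)
  gauss : ∀ i j, i ≠ j → ∀ x ∈ Ω,
    (h j x)⁻¹ * (2 * pd j (logPd h i j) x + logPd h i j x ^ 2 - logPd h i j x * logPd h j j x)
    + (h i x)⁻¹ * (2 * pd i (logPd h j i) x + logPd h j i x ^ 2 - logPd h j i x * logPd h i i x)
    + ∑ k ∈ {k | k ≠ i ∧ k ≠ j}, (h k x)⁻¹ * (logPd h i k x * logPd h j k x) = -4 * κ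

namespace SepSystem

variable {κ : ℝ} {h : Fin n → (Fin n → ℝ) → ℝ} {Ω Ω' : Set (Fin n → ℝ)} {x : Fin n → ℝ}

lemma mono (H : SepSystem κ h Ω) (hΩ' : IsOpen Ω') (hs : Ω' ⊆ Ω) : SepSystem κ h Ω' where
  isOpen := hΩ'
  smooth i := (H.smooth i).mono hs
  ne_zero i x hx := H.ne_zero i x (hs hx)
  pd_mixed i j k h1 h2 h3 x hx := H.pd_mixed i j k h1 h2 h3 x (hs hx)
  quad i j k h1 h2 h3 x hx := H.quad i j k h1 h2 h3 x (hs hx)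
  pd_self i j h1 x hx := H.pd_self i j h1 x (hs hx)
  gauss i j h1 x hx := H.gauss i j h1 x (hs hx)

variable (H : SepSystem κ h Ω)
include H

lemma smooth_log (i : Fin n) : ContDiffOn ℝ ∞ (fun y => Real.log (h i y)) Ω :=
  (H.smooth i).log fun x hx => H.ne_zero i x hx

lemma smooth_logPd (i j : Fin n) : ContDiffOn ℝ ∞ (logPd h i j) Ω :=
  contDiffOn_pd (H.smooth_log i) H.isOpen j

lemma smooth_pd_logPd (i j k : Fin n) : ContDiffOn ℝ ∞ (pd k (logPd h i j)) Ω :=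
  contDiffOn_pd (H.smooth_logPd i j) H.isOpen k

lemma diff_log (i : Fin n) (hx : x ∈ Ω) : DifferentiableAt ℝ (fun y => Real.log (h i y)) x :=
  differentiableAt_of_contDiffOn (H.smooth_log i) H.isOpen hx

lemma diff_logPd (i j : Fin n) (hx : x ∈ Ω) : DifferentiableAt ℝ (logPd h i j) x :=
  differentiableAt_of_contDiffOn (H.smooth_logPd i j) H.isOpen hx

lemma diff_pd_logPd (i j k : Fin n) (hx : x ∈ Ω) :
    DifferentiableAt ℝ (pd k (logPd h i j)) x :=
  differentiableAt_of_contDiffOn (H.smooth_pd_logPd i j k) H.isOpen hx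

lemma pd_logPd_comm (i j k : Fin n) (hx : x ∈ Ω) :
    pd k (logPd h i j) x = pd j (logPd h i k) x :=
  pd_comm (H.smooth_log i) H.isOpen hx k j

lemma pd_logPd_diag {i j : Fin n} (hij : i ≠ j) (hx : x ∈ Ω) :
    pd j (logPd h i i) x = -(logPd h i j x * logPd h j i x) := by
  rw [H.pd_logPd_comm i i j hx, H.pd_self i j hij x hx]

end SepSystem

/-- The functions `lam j` of the single variables `xⱼ` are the eigenvalues of a concircular tensor
which is diagonal in the coordinates. -/
def IsSol (h : Fin n → (Fin n → ℝ) → ℝ) (J : Fin n → Set ℝ) (lam : Fin n → ℝ → ℝ) : Prop :=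
  ∀ x ∈ univ.pi J, ∀ i j, i ≠ j →
    HasDerivAt (lam j) ((lam j (x j) - lam i (x i)) * logPd h i j x) (x j)

/-! ### Elementary properties of the linear system for the eigenvalues -/

section Solutions

variable {κ : ℝ} {h : Fin n → (Fin n → ℝ) → ℝ} {J : Fin n → Set ℝ} {x y : Fin n → ℝ}
  {lam mu : Fin n → ℝ → ℝ}

lemma IsSol.const (c : ℝ) : IsSol h J fun _ _ => c := by
  intro x _ i j _
  simpa using hasDerivAt_const (x j) c

lemma IsSol.sub (h₁ : IsSol h J lam) (h₂ : IsSol h J mu) :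
    IsSol h J fun i t => lam i t - mu i t := by
  intro x hx i j hij
  convert! (h₁ x hx i j hij).sub (h₂ x hx i j hij) using 1
  ring

lemma IsSol.add (h₁ : IsSol h J lam) (h₂ : IsSol h J mu) :
    IsSol h J fun i t => lam i t + mu i t := by
  intro x hx i j hij
  convert! (h₁ x hx i j hij).add (h₂ x hx i j hij) using 1
  ring

lemma IsSol.smul (c : ℝ) (h₁ : IsSol h J lam) : IsSol h J fun i t => c * lam i t := by
  intro x hx i j hij
  convert! (h₁ x hx i j hij).const_mul c using 1
  ring

/-- Along the xⱼ-line λᵢ is fixed and (λⱼ − λᵢ)/|hᵢ| has derivative zero. Since `Real.log` ignores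
signs, the exponential is the quotient of the values of |hᵢ|, whatever the signature. -/
lemma IsSol.eq_exp (hJ : IsBox J) (H : SepSystem κ h (univ.pi J)) (hl : IsSol h J lam)
    (hx : x ∈ univ.pi J) {i j : Fin n} (hij : i ≠ j) {t : ℝ} (ht : t ∈ J j) :
    lam j t = lam i (x i) + (lam j (x j) - lam i (x i)) *
      Real.exp (Real.log (h i (Function.update x j t)) - Real.log (h i x)) := by
  have key : ∀ s ∈ J j, HasDerivAt (fun s => (lam j s - lam i (x i)) *
      Real.exp (-Real.log (h i (Function.update x j s)))) 0 s := by
    intro s hs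
    have hm := update_mem_box hx hs
    have h1 := hl _ hm i j hij
    rw [Function.update_self, Function.update_of_ne hij] at h1
    have h2 := (hasDerivAt_update_line (H.diff_log i hm)).neg.exp
    convert! (h1.sub_const (lam i (x i))).mul h2 using 1
    simp only [logPd, Pi.neg_apply]
    ring
  have h1 := eq_of_hasDerivAt_zero (hJ j).1 (hJ j).2.1 key ht (hx j (mem_univ j))
  simp only [Function.update_eq_self] at h1
  have h2 : ∀ a b : ℝ, Real.exp (a - b) = Real.exp (-b) * (Real.exp (-a))⁻¹ := by
    intro a b; rw [← Real.exp_neg, ← Real.exp_add]; congr 1; ring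
  rw [h2, ← mul_assoc, ← h1]
  field_simp
  ring

/-- `IsSol` only asks for differentiability; smoothness is read off from the closed formula of
`IsSol.eq_exp`, for any auxiliary index i ≠ j. -/
lemma IsSol.contDiffOn (hJ : IsBox J) (H : SepSystem κ h (univ.pi J)) (hl : IsSol h J lam)
    (hn : 1 < n) (j : Fin n) : ContDiffOn ℝ ∞ (lam j) (J j) := by
  have : Nontrivial (Fin n) := Fin.nontrivial_iff_two_le.2 hn
  obtain ⟨i, hij⟩ := exists_ne j
  obtain ⟨x, hx⟩ := hJ.nonempty
  have h1 : ContDiffOn ℝ ∞ (fun t => Real.log (h i (Function.update x j t))) (J j) :=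
    (H.smooth_log i).comp (contDiff_update x j).contDiffOn fun t ht => update_mem_box hx ht
  refine ContDiffOn.congr (f := fun t => lam i (x i) + (lam j (x j) - lam i (x i)) *
      Real.exp (Real.log (h i (Function.update x j t)) - Real.log (h i x))) ?_
    fun t ht => hl.eq_exp hJ H hx hij ht
  exact contDiffOn_const.add (contDiffOn_const.mul (h1.sub contDiffOn_const).exp)

/-- If two eigenvalues agree at one point of a box, both are constant on the box. -/
lemma IsSol.const_of_eq (hJ : IsBox J) (H : SepSystem κ h (univ.pi J)) (hl : IsSol h J lam)
    (hx : x ∈ univ.pi J) {i j : Fin n} (hij : i ≠ j) (he : lam i (x i) = lam j (x j)) :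
    (∀ t ∈ J i, lam i t = lam i (x i)) ∧ ∀ t ∈ J j, lam j t = lam j (x j) := by
  constructor
  · intro t ht
    rw [hl.eq_exp hJ H hx hij.symm ht, he]; ring
  · intro t ht
    rw [hl.eq_exp hJ H hx hij ht, he]; ring

/-- Coinciding eigenvalues are constant, so the pattern of coincidences is the same all over the
box. Nontriviality and fineness are transported in this way. -/
lemma IsSol.eq_of_eq (hJ : IsBox J) (H : SepSystem κ h (univ.pi J)) (hl : IsSol h J lam)
    (hx : x ∈ univ.pi J) {i j : Fin n} (he : lam i (x i) = lam j (x j)) (hy : y ∈ univ.pi J) :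
    lam i (y i) = lam j (y j) := by
  by_cases hij : i = j
  · rw [hij]
  · obtain ⟨h1, h2⟩ := hl.const_of_eq hJ H hx hij he
    rw [h1 _ (hy i (mem_univ i)), h2 _ (hy j (mem_univ j)), he]

/-- A solution on a box is determined by its values at one point. -/
lemma IsSol.eq_zero (hJ : IsBox J) (H : SepSystem κ h (univ.pi J)) (hl : IsSol h J lam)
    (hn : 1 < n) (hx : x ∈ univ.pi J) (h0 : ∀ i, lam i (x i) = 0) (i : Fin n) {t : ℝ}
    (ht : t ∈ J i) : lam i t = 0 := by
  have : Nontrivial (Fin n) := Fin.nontrivial_iff_two_le.2 hn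
  obtain ⟨j, hij⟩ := exists_ne i
  rw [(hl.const_of_eq hJ H hx hij (by rw [h0, h0])).2 t ht, h0]

end Solutions

/-! ### Local existence -/

section LocalExistence

variable {κ : ℝ} {h : Fin n → (Fin n → ℝ) → ℝ} {Ω : Set (Fin n → ℝ)}

/-- Some box in `Ω` is such that each `∂ⱼ log |hᵢ|` vanishes nowhere or everywhere on it. -/
lemma SepSystem.exists_box_pattern (H : SepSystem κ h Ω) (hne : Ω.Nonempty) :
    ∃ J, IsBox J ∧ univ.pi J ⊆ Ω ∧ ∀ i j, (∀ x ∈ univ.pi J, logPd h i j x = 0) ∨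
      ∀ x ∈ univ.pi J, logPd h i j x ≠ 0 := by
  classical
  let Z : (Fin n → ℝ) → Finset (Fin n × Fin n) := fun x =>
    Finset.univ.filter fun p => logPd h p.1 p.2 x = 0
  -- At a point with the fewest vanishing aᵢⱼ, nonvanishing persists nearby, and by minimality no
  -- further aᵢⱼ can become nonzero; so the set of zeros is locally constant.
  obtain ⟨x, hx, hmin⟩ := (InvImage.wf (fun x => (Z x).card) Nat.lt_wfRel.wf).has_min Ω hne
  have hopen : ∃ Ω' ⊆ Ω, IsOpen Ω' ∧ x ∈ Ω' ∧ ∀ y ∈ Ω', Z y ⊆ Z x := by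
    have h1 : ∀ᶠ y in nhds x, ∀ p : Fin n × Fin n,
        logPd h p.1 p.2 x ≠ 0 → logPd h p.1 p.2 y ≠ 0 := by
      rw [Filter.eventually_all]
      intro p
      by_cases hp : logPd h p.1 p.2 x = 0
      · simp [hp]
      · filter_upwards [(H.diff_logPd p.1 p.2 hx).continuousAt.eventually_ne hp] with y hy _
        exact hy
    obtain ⟨Ω', hs, ho, hx'⟩ := eventually_nhds_iff.1 (h1.and (H.isOpen.mem_nhds hx))
    refine ⟨Ω', fun y hy => (hs y hy).2, ho, hx', fun y hy p hp => ?_⟩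
    simp only [Z, Finset.mem_filter, Finset.mem_univ, true_and] at hp ⊢
    by_contra hne
    exact (hs y hy).1 p hne hp
  obtain ⟨Ω', hs, ho, hx', hZ⟩ := hopen
  obtain ⟨J, hJ, -, hJs⟩ := exists_box_subset ho hx'
  have hZ' : ∀ y ∈ Ω', Z y = Z x := fun y hy =>
    Finset.eq_of_subset_of_card_le (hZ y hy) (not_lt.1 (hmin y (hs hy)))
  refine ⟨J, hJ, hJs.trans hs, fun i j => ?_⟩
  have hiff : ∀ y ∈ univ.pi J, (logPd h i j y = 0 ↔ logPd h i j x = 0) := by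
    intro y hy
    have := congrArg (fun s : Finset _ => (i, j) ∈ s) (hZ' y (hJs hy))
    simpa [Z] using this
  by_cases h0 : logPd h i j x = 0
  · exact Or.inl fun y hy => (hiff y hy).2 h0
  · exact Or.inr fun y hy => mt (hiff y hy).1 h0

/-- Let `r` be a transitive relation such that the elements to which a given one is related are
comparable. Either all elements are related to one of them, or the set is a disjoint union of two
nonempty subsets whose elements are unrelated. -/
lemma exists_root_or_split {α : Type*} [Fintype α] [Nonempty α] (r : α → α → Prop)
    (htrans : ∀ i j k, i ≠ j → i ≠ k → j ≠ k → r i j → r j k → r i k)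
    (hcomp : ∀ i j k, i ≠ j → i ≠ k → j ≠ k → r k i → r k j → r i j ∨ r j i) :
    (∃ p, ∀ i, i ≠ p → r i p) ∨
      ∃ T : Set α, T.Nonempty ∧ Tᶜ.Nonempty ∧ ∀ i ∈ T, ∀ j ∉ T, ¬ r i j ∧ ¬ r j i := by
  classical
  let desc : α → Finset α := fun p => Finset.univ.filter fun i => i ≠ p ∧ r i p
  obtain ⟨p, -, hp⟩ := Finset.exists_max_image Finset.univ (fun p => (desc p).card)
    Finset.univ_nonempty
  by_cases hall : ∀ i, i ≠ p → r i p
  · exact Or.inl ⟨p, hall⟩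
  right
  push Not at hall
  obtain ⟨o, hop, hor⟩ := hall
  -- If p were related to j, transitivity would put p and all elements below p under j,
  -- contradicting the choice of p with the largest number of elements below it.
  have hpj : ∀ j, j ≠ p → ¬ r j p → ¬ r p j := by
    intro j hj hjp hpj
    have hsub : insert p (desc p) ⊆ desc j := by
      intro i hi
      simp only [desc, Finset.mem_insert, Finset.mem_filter, Finset.mem_univ, true_and] at hi ⊢
      rcases hi with rfl | ⟨hip, hri⟩
      · exact ⟨hj.symm, hpj⟩
      · have hij : i ≠ j := by rintro rfl; exact hjp hri
        exact ⟨hij, htrans i p j hip hij hj.symm hri hpj⟩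
    have := Finset.card_le_card hsub
    rw [Finset.card_insert_of_notMem (by simp [desc])] at this
    have := hp j (Finset.mem_univ j)
    omega
  refine ⟨{i | i = p ∨ r i p}, ⟨p, Or.inl rfl⟩, ⟨o, by simp [hop, hor]⟩, ?_⟩
  intro i hi j hj
  simp only [mem_ofPred_eq, not_or] at hi hj
  obtain ⟨hjp, hrj⟩ := hj
  by_cases hip : i = p
  · subst hip
    exact ⟨hpj j hjp hrj, hrj⟩
  have hri : r i p := hi.resolve_left hip
  have hij : i ≠ j := by rintro rfl; exact hrj hri
  constructor
  · intro hr
    rcases hcomp j p i hjp hij.symm (Ne.symm hip) hr hri with h1 | h1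
    · exact hrj h1
    · exact hpj j hjp hrj h1
  · intro hr
    exact hrj (htrans j i p hij.symm hjp hip hr hri)

/-! ### A solution when one coordinate enters all other components -/

section Root

variable {J : Fin n → Set ℝ} {x y : Fin n → ℝ} {p : Fin n}

/-- `∂ₚ log |∂ₚ hᵢ|`. -/
def rootPot (h : Fin n → (Fin n → ℝ) → ℝ) (p i : Fin n) (x : Fin n → ℝ) : ℝ :=
  logPd h i p x + pd p (logPd h i p) x / logPd h i p x

/-- Differentiate aᵢⱼaᵢₚ = aᵢⱼaⱼₚ + aᵢₚaₚⱼ in xₚ. Here ∂ₚaᵢⱼ = 0 and ∂ₚaₚⱼ = −aₚⱼaⱼₚ; eliminating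
aₚⱼ with the undifferentiated relation leaves the claim times aᵢⱼ, which can be cancelled. -/
lemma SepSystem.rootPot_eq_of_ne (H : SepSystem κ h Ω)
    (hp : ∀ i, i ≠ p → ∀ x ∈ Ω, logPd h i p x ≠ 0) {i j : Fin n} (hi : i ≠ p)
    (hj : j ≠ p) (hij : i ≠ j) (ha : ∀ x ∈ Ω, logPd h i j x ≠ 0) (hx : x ∈ Ω) :
    rootPot h p i x = rootPot h p j x := by
  have hq := H.quad j p i hj hij.symm (Ne.symm hi)
  have hd := pd_congr_on H.isOpen hx hq p
  rw [pd_mul (H.diff_logPd _ _ hx) (H.diff_logPd _ _ hx),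
    pd_add ((H.diff_logPd _ _ hx).fun_mul (H.diff_logPd _ _ hx))
      ((H.diff_logPd _ _ hx).fun_mul (H.diff_logPd _ _ hx)),
    pd_mul (H.diff_logPd _ _ hx) (H.diff_logPd _ _ hx),
    pd_mul (H.diff_logPd _ _ hx) (H.diff_logPd _ _ hx),
    H.pd_mixed i j p hij hi hj x hx, H.pd_self p j hj.symm x hx] at hd
  have h1 := hq x hx
  have n1 := hp i hi x hx
  have n2 := hp j hj x hx
  have n3 := ha x hx
  unfold rootPot
  generalize logPd h i p x = aip at *
  generalize logPd h j p x = ajp at *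
  generalize logPd h i j x = aij at *
  generalize logPd h p j x = apj at *
  generalize pd p (logPd h i p) x = Di at *
  generalize pd p (logPd h j p) x = Dj at *
  have : aij * (aip ^ 2 * ajp + Di * ajp) = aij * (ajp ^ 2 * aip + Dj * aip) := by
    linear_combination aip * hd + (aip * ajp - Di) * h1
  have h2 := mul_left_cancel₀ n3 this
  field_simp
  linear_combination h2

/-- If i and j are related, or both are related to a third index k ≠ p, the previous lemma applies,
once or twice. Otherwise the quadratic relations kill so many terms that the Gauss equations give
the comparison; only here does the curvature constant enter. -/
lemma SepSystem.rootPot_eq (H : SepSystem κ h Ω)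
    (hpat : ∀ i j, (∀ x ∈ Ω, logPd h i j x = 0) ∨ ∀ x ∈ Ω, logPd h i j x ≠ 0)
    (hp : ∀ i, i ≠ p → ∀ x ∈ Ω, logPd h i p x ≠ 0) {i j : Fin n} (hi : i ≠ p)
    (hj : j ≠ p) (hx : x ∈ Ω) : rootPot h p i x = rootPot h p j x := by
  by_cases hij : i = j
  · rw [hij]
  rcases hpat i j with h1 | h1
  swap
  · exact H.rootPot_eq_of_ne hp hi hj hij h1 hx
  rcases hpat j i with h2 | h2
  swap
  · exact (H.rootPot_eq_of_ne hp hj hi (Ne.symm hij) h2 hx).symm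
  by_cases hk : ∃ k, k ≠ i ∧ k ≠ j ∧ k ≠ p ∧ (∀ x ∈ Ω, logPd h i k x ≠ 0) ∧
      ∀ x ∈ Ω, logPd h j k x ≠ 0
  · obtain ⟨k, hki, hkj, hkp, h3, h4⟩ := hk
    rw [H.rootPot_eq_of_ne hp hi hkp hki.symm h3 hx, H.rootPot_eq_of_ne hp hj hkp hkj.symm h4 hx]
  -- In the remaining case all aₚₖ vanish: a nonzero aₚₖ would force both aᵢₖ and aⱼₖ to be nonzero,
  -- making k a common index, which has been excluded.
  have hpj : ∀ y ∈ Ω, logPd h p j y = 0 := by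
    intro y hy
    have := H.quad j p i hj (Ne.symm hij) (Ne.symm hi) y hy
    simpa [h1 y hy, hp i hi y hy] using this
  have hpi : ∀ y ∈ Ω, logPd h p i y = 0 := by
    intro y hy
    have := H.quad i p j hi hij (Ne.symm hj) y hy
    simpa [h2 y hy, hp j hj y hy] using this
  have htr : ∀ k l, k ≠ l → k ≠ p → l ≠ p → (∀ x ∈ Ω, logPd h p k x ≠ 0) →
      ∀ y ∈ Ω, logPd h l k y ≠ 0 := by
    intro k l hkl hkp hlp hpk y hy h0
    have := H.quad k p l hkp hkl (Ne.symm hlp) y hy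
    simp [h0, hp l hlp y hy, hpk y hy] at this
  have hcom : ∀ k, k ≠ i → k ≠ j → k ≠ p → logPd h i k x * logPd h j k x = 0 := by
    intro k hki hkj hkp
    rcases hpat i k with h3 | h3
    · simp [h3 x hx]
    rcases hpat j k with h4 | h4
    · simp [h4 x hx]
    exact absurd ⟨k, hki, hkj, hkp, h3, h4⟩ hk
  have hpk : ∀ k, k ≠ p → logPd h p k x = 0 := by
    intro k hkp
    by_cases hki : k = i
    · rw [hki]; exact hpi x hx
    by_cases hkj : k = j
    · rw [hkj]; exact hpj x hx
    rcases hpat p k with h3 | h3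
    · exact h3 x hx
    exact absurd ⟨k, hki, hkj, hkp, htr k i hki hkp hi h3, htr k j hkj hkp hj h3⟩ hk
  -- For the pair i, j only the summand k = p survives: aᵢₚaⱼₚ/hₚ = −4κ. The Gauss equation of the
  -- pair l, p (for l = i, j) has the same right side, so 2∂ₚaₗₚ + aₗₚ² − aₗₚaₚₚ = aᵢₚaⱼₚ for both
  -- l, and aₚₚ can be eliminated.
  have hG := H.gauss i j hij x hx
  rw [pd_eq_zero_of_eqOn H.isOpen hx h1, pd_eq_zero_of_eqOn H.isOpen hx h2, h1 x hx, h2 x hx,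
    Finset.sum_eq_single p (by
      intro k hk hkp
      simp only [Finset.mem_filter, Finset.mem_univ, true_and] at hk
      rw [hcom k hk.1 hk.2 hkp, mul_zero])
      (by simp [Ne.symm hi, Ne.symm hj])] at hG
  have hroot : ∀ l, l ≠ p → (∀ y ∈ Ω, logPd h p l y = 0) → (h p x)⁻¹ * (2 * pd p (logPd h l p) x
      + logPd h l p x ^ 2 - logPd h l p x * logPd h p p x) = -4 * κ := by
    intro l hl hpl
    have hG := H.gauss l p hl x hx
    rw [pd_eq_zero_of_eqOn H.isOpen hx hpl, hpl x hx, Finset.sum_eq_zero (by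
      intro k hk
      simp only [Finset.mem_filter, Finset.mem_univ, true_and] at hk
      rw [hpk k hk.2]; ring)] at hG
    linear_combination hG
  have gi := hroot i hi hpi
  have gj := hroot j hj hpj
  have n0 := inv_ne_zero (H.ne_zero p x hx)
  have n1 := hp i hi x hx
  have n2 := hp j hj x hx
  unfold rootPot
  generalize logPd h i p x = aip at *
  generalize logPd h j p x = ajp at *
  generalize pd p (logPd h i p) x = Di at *
  generalize pd p (logPd h j p) x = Dj at *
  generalize logPd h p p x = app at *
  have e1 : 2 * Di + aip ^ 2 - aip * app = aip * ajp := by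
    apply mul_left_cancel₀ n0; linear_combination gi - hG
  have e2 : 2 * Dj + ajp ^ 2 - ajp * app = aip * ajp := by
    apply mul_left_cancel₀ n0; linear_combination gj - hG
  field_simp
  linear_combination (ajp / 2) * e1 - (aip / 2) * e2

/-- For k ≠ i, p the function aᵢₚ does not involve xₖ at all. In the direction of xᵢ, the derivative
−aᵢₚaₚᵢ of aᵢₚ cancels against that of the quotient. -/
lemma SepSystem.rootPot_indep (H : SepSystem κ h (univ.pi J)) (hJ : IsBox J)
    (hp : ∀ i, i ≠ p → ∀ x ∈ univ.pi J, logPd h i p x ≠ 0) {i : Fin n} (hi : i ≠ p)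
    (hx : x ∈ univ.pi J) (hy : y ∈ univ.pi J) (hxy : x p = y p) :
    rootPot h p i x = rootPot h p i y := by
  have hfun : rootPot h p i = fun x => logPd h i p x
      + pd p (logPd h i p) x * (logPd h i p x)⁻¹ := by
    ext x; simp [rootPot, div_eq_mul_inv]
  have hdiff : ∀ x ∈ univ.pi J, DifferentiableAt ℝ (rootPot h p i) x := fun x hx => by
    rw [hfun]
    exact (H.diff_logPd i p hx).fun_add
      ((H.diff_pd_logPd i p p hx).fun_mul ((H.diff_logPd i p hx).fun_inv (hp i hi x hx)))
  refine eq_of_pd_eq_zero hJ hdiff (Finset.univ.erase p) ?_ hx hy ?_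
  swap
  · intro k hk
    have : k = p := by simpa using hk
    rw [this]; exact hxy
  intro k hk x hx
  have hkp : k ≠ p := by simpa using hk
  have n1 := hp i hi x hx
  have dinv : DifferentiableAt ℝ (fun x => (logPd h i p x)⁻¹) x := (H.diff_logPd i p hx).inv n1
  rw [hfun, pd_add (H.diff_logPd i p hx) ((H.diff_pd_logPd i p p hx).fun_mul dinv),
    pd_mul (H.diff_pd_logPd i p p hx) dinv, pd_inv (H.diff_logPd i p hx) n1,
    pd_comm (H.smooth_logPd i p) H.isOpen hx k p]
  by_cases hki : k = i
  · subst hki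
    have hd := pd_congr_on H.isOpen hx (H.pd_self k p hkp) p
    have hneg : (fun y => -(logPd h k p y * logPd h p k y))
        = fun y => (-1) * (logPd h k p y * logPd h p k y) := by ext y; ring
    rw [hneg, pd_const_mul _ ((H.diff_logPd _ _ hx).fun_mul (H.diff_logPd _ _ hx)),
      pd_mul (H.diff_logPd _ _ hx) (H.diff_logPd _ _ hx), H.pd_self p k hkp.symm x hx] at hd
    rw [hd, H.pd_self k p hkp x hx]
    field_simp
    ring
  · have h0 := H.pd_mixed i p k hi (Ne.symm hki) (Ne.symm hkp)
    rw [pd_eq_zero_of_eqOn H.isOpen hx h0, h0 x hx]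
    simp

/-- If all `hᵢ`, `i ≠ p`, depend on `xₚ`, there is a solution with `lam p` nonconstant. -/
lemma SepSystem.exists_sol_of_root (H : SepSystem κ h (univ.pi J)) (hJ : IsBox J) (hn : 1 < n)
    (hpat : ∀ i j, (∀ x ∈ univ.pi J, logPd h i j x = 0) ∨ ∀ x ∈ univ.pi J, logPd h i j x ≠ 0)
    (hp : ∀ i, i ≠ p → ∀ x ∈ univ.pi J, logPd h i p x ≠ 0) :
    ∃ lam, IsSol h J lam ∧ ∃ x ∈ univ.pi J, ∃ i j, lam i (x i) ≠ lam j (x j) := by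
  have : Nontrivial (Fin n) := Fin.nontrivial_iff_two_le.2 hn
  obtain ⟨q, hq⟩ := exists_ne p
  obtain ⟨y, hy⟩ := hJ.nonempty
  -- The equation relating λₚ to a fixed value of λ_q makes λₚ affine in |h_q| along the xₚ-line, so
  -- λₚ = |h_q| is a possible normalisation. With θ = λₚ', the equations for j = p then force λᵢ =
  -- λₚ − θ/aᵢₚ; it is evaluated on a line through y, where only xᵢ varies.
  let lp : ℝ → ℝ := fun t => Real.exp (Real.log (h q (Function.update y p t)))
  let th : ℝ → ℝ := fun t => lp t * logPd h q p (Function.update y p t)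
  let lam : Fin n → ℝ → ℝ := fun i t =>
    if i = p then lp t else lp (y p) - th (y p) / logPd h i p (Function.update y i t)
  have hlp : ∀ t ∈ J p, HasDerivAt lp (th t) t := by
    intro t ht
    exact (hasDerivAt_update_line (H.diff_log q (update_mem_box hy ht))).exp
  have hth : ∀ t ∈ J p, HasDerivAt th (th t * rootPot h p q (Function.update y p t)) t := by
    intro t ht
    have hm := update_mem_box hy ht
    convert! (hlp t ht).mul (hasDerivAt_update_line (H.diff_logPd q p hm)) using 1
    have := hp q hq _ hm
    simp only [th, rootPot]
    field_simp
  have hth0 : ∀ t ∈ J p, th t ≠ 0 := fun t ht =>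
    mul_ne_zero (Real.exp_ne_zero _) (hp q hq _ (update_mem_box hy ht))
  have hlamp : lam p = lp := by ext t; simp [lam]
  have hlam : ∀ i, i ≠ p → ∀ x ∈ univ.pi J,
      lam i (x i) = lp (x p) - th (x p) / logPd h i p x := by
    intro i hi x hx
    set z := Function.update y i (x i) with hz
    have hzm : z ∈ univ.pi J := update_mem_box hy (hx i (mem_univ i))
    have hzp : z p = y p := by simp [hz, Function.update_of_ne (Ne.symm hi)]
    -- The forced expression for λᵢ does not involve xₚ exactly because θ'/θ is ∂ₚ log|∂ₚhᵢ|; for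
    -- this the potential has to be common to q and i and independent of the other coordinates.
    have hconst : ∀ t ∈ J p, HasDerivAt
        (fun t => lp t - th t / logPd h i p (Function.update z p t)) 0 t := by
      intro t ht
      have hm := update_mem_box hzm ht
      have n1 := hp i hi _ hm
      convert! (hlp t ht).sub ((hth t ht).div (hasDerivAt_update_line (H.diff_logPd i p hm)) n1)
        using 1
      have hR : rootPot h p q (Function.update y p t) = rootPot h p i (Function.update z p t) := by
        rw [H.rootPot_eq hpat hp hi hq hm]
        exact H.rootPot_indep hJ hp hq (update_mem_box hy ht) hm (by simp)
      rw [hR, rootPot]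
      field_simp
      ring
    have h1 := eq_of_hasDerivAt_zero (hJ p).1 (hJ p).2.1 hconst (hy p (mem_univ p))
      (hx p (mem_univ p))
    have h2 : logPd h i p (Function.update z p (x p)) = logPd h i p x := by
      refine eq_of_pd_eq_zero hJ (fun x hx => H.diff_logPd i p hx)
        ((Finset.univ.erase p).erase i) ?_ (update_mem_box hzm (hx p (mem_univ p))) hx ?_
      · intro k hk x hx
        simp only [Finset.mem_erase, Finset.mem_univ, and_true] at hk
        exact H.pd_mixed i p k hi (Ne.symm hk.1) (Ne.symm hk.2) x hx
      · intro k hk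
        simp only [Finset.mem_erase, Finset.mem_univ, and_true, not_and_or, not_not] at hk
        by_cases hkp : k = p
        · subst hkp; simp
        · have : k = i := by tauto
          subst this
          simp [Function.update_of_ne hkp, hz]
    have h3 : Function.update z p (y p) = z := by rw [← hzp, Function.update_eq_self]
    simp only [h2, h3] at h1
    rw [← h1]
    simp [lam, hi, hz]
  refine ⟨lam, ?_, y, hy, p, q, ?_⟩
  swap
  · rw [hlam q hq y hy, hlamp]
    intro he
    have h1 : th (y p) / logPd h q p y = 0 := by linarith
    exact div_ne_zero (hth0 _ (hy p (mem_univ p))) (hp q hq y hy) h1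
  intro x hx i j hij
  by_cases hjp : j = p
  · subst hjp
    rw [hlam i hij x hx, hlamp]
    convert! hlp (x j) (hx j (mem_univ j)) using 1
    have := hp i hij x hx
    field_simp
    ring
  have hder : HasDerivAt (lam j) (th (x p) * pd j (logPd h j p) x / logPd h j p x ^ 2) (x j) := by
    have n1 := hp j hjp x hx
    have h1 := (hasDerivAt_line (H.diff_logPd j p hx) j).inv (by simpa using n1)
    have h2 := (h1.const_mul (th (x p))).const_sub (lp (x p))
    have h3 : HasDerivAt (lam j) _ (x j) := h2.congr_of_eventuallyEq (by
      filter_upwards [(hJ j).1.mem_nhds (hx j (mem_univ j))] with t ht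
      have := hlam j hjp _ (update_mem_box hx ht)
      simpa [Function.update_of_ne (Ne.symm hjp), div_eq_mul_inv] using this)
    convert! h3 using 1
    simp
    ring
  convert! hder using 1
  rw [H.pd_self j p hjp x hx, hlam j hjp x hx]
  have n1 := hp j hjp x hx
  by_cases hip : i = p
  · subst hip
    rw [hlamp]
    field_simp
    ring
  · rw [hlam i hip x hx]
    have n2 := hp i hip x hx
    -- For two indices other than p, the solution equation is θ times the quadratic relation divided
    -- by aⱼₚaᵢₚ.
    have hquad := H.quad j p i hjp (Ne.symm hij) (Ne.symm hip) x hx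
    field_simp
    linear_combination -th (x p) * hquad

end Root

/-- Near some point there is a solution which is not a multiple of the trivial one. -/
theorem SepSystem.exists_sol_local (H : SepSystem κ h Ω) (hne : Ω.Nonempty) (hn : 1 < n) :
    ∃ J, IsBox J ∧ univ.pi J ⊆ Ω ∧ ∃ lam, IsSol h J lam ∧
      ∃ x ∈ univ.pi J, ∃ i j, lam i (x i) ≠ lam j (x j) := by
  classical
  obtain ⟨J, hJ, hJs, hpat⟩ := H.exists_box_pattern hne
  have HJ := H.mono hJ.isOpen hJs
  refine ⟨J, hJ, hJs, ?_⟩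
  obtain ⟨y, hy⟩ := hJ.nonempty
  have hpat' : ∀ i j, logPd h i j y ≠ 0 → ∀ x ∈ univ.pi J, logPd h i j x ≠ 0 := by
    intro i j hne
    exact (hpat i j).resolve_left fun h0 => hne (h0 y hy)
  have : Nonempty (Fin n) := ⟨⟨0, by omega⟩⟩
  -- Transitivity and comparability are two readings of the quadratic relation: when one factor
  -- vanishes, a product of two nonzero factors would have to vanish.
  have htrans : ∀ i j k, i ≠ j → i ≠ k → j ≠ k → logPd h i j y ≠ 0 → logPd h j k y ≠ 0 →
      logPd h i k y ≠ 0 := by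
    intro i j k hij hik hjk h1 h2 h0
    have := HJ.quad j k i hjk hij.symm hik.symm y hy
    simp [h0, h1, h2] at this
  have hcomp : ∀ i j k, i ≠ j → i ≠ k → j ≠ k → logPd h k i y ≠ 0 → logPd h k j y ≠ 0 →
      logPd h i j y ≠ 0 ∨ logPd h j i y ≠ 0 := by
    intro i j k hij hik hjk h1 h2
    by_contra hcon
    push Not at hcon
    have := HJ.quad i j k hij hik hjk y hy
    simp [hcon.1, hcon.2, h1, h2] at this
  rcases exists_root_or_split (fun i j => logPd h i j y ≠ 0) htrans hcomp with ⟨p, hp⟩ | ⟨T, hT, hT', hc⟩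
  · exact HJ.exists_sol_of_root hJ hn hpat fun i hi => hpat' i p (hp i hi)
  -- The factor λⱼ − λᵢ is nonzero only for indices on opposite sides of the split, and there aᵢⱼ
  -- vanishes on the box.
  · refine ⟨fun i _ => if i ∈ T then 1 else 0, ?_, ?_⟩
    · intro x hx i j hij
      convert! hasDerivAt_const (x j) (if j ∈ T then (1 : ℝ) else 0) using 1
      have h0 : ∀ a b, logPd h a b y = 0 → logPd h a b x = 0 := fun a b h0 =>
        (hpat a b).resolve_right (fun hne => hne y hy h0) x hx
      by_cases hi : i ∈ T <;> by_cases hj : j ∈ T <;> simp only [hi, hj, if_true, if_false]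
      · simp
      · rw [h0 i j (not_not.1 (hc i hi j hj).1)]; simp
      · rw [h0 i j (not_not.1 (hc j hj i hi).2)]; simp
      · simp
    · obtain ⟨i, hi⟩ := hT
      obtain ⟨j, hj⟩ := hT'
      refine ⟨y, hy, i, j, ?_⟩
      have hj' : j ∉ T := hj
      simp [hi, hj']

end LocalExistence

end SepSystem

end KEM

end

noncomputable section

namespace KEM

/-! ### Extension of solutions -/

section Extension

variable {n : ℕ} {κ : ℝ} {h : Fin n → (Fin n → ℝ) → ℝ} {J : Fin n → Set ℝ} {x y z : Fin n → ℝ}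
  {lam : Fin n → ℝ → ℝ}

lemma eq_of_update_eq {β : Type*} {f : (Fin n → ℝ) → β} (s : Finset (Fin n))
    (h : ∀ i ∈ s, ∀ x ∈ univ.pi J, ∀ t ∈ J i, f (Function.update x i t) = f x)
    (hx : x ∈ univ.pi J) (hy : y ∈ univ.pi J) (hxy : ∀ i ∉ s, x i = y i) : f x = f y := by
  classical
  induction s using Finset.induction_on generalizing x with
  | empty => congr 1; ext i; exact hxy i (by simp)
  | insert a s ha ih =>
    rw [← h a (by simp) x hx (y a) (hy a (mem_univ a))]
    refine ih (fun i hi => h i (Finset.mem_insert_of_mem hi))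
      (update_mem_box hx (hy a (mem_univ a))) ?_
    intro i hi
    by_cases hia : i = a
    · subst hia; simp
    · rw [Function.update_of_ne hia]; exact hxy i (by simp [hia, hi])

namespace SepSystem

lemma pd_eq_logPd_mul {Ω : Set (Fin n → ℝ)} (H : SepSystem κ h Ω) (hx : x ∈ Ω) (i j : Fin n) :
    pd j (h i) x = logPd h i j x * h i x := by
  have h0 := H.ne_zero i x hx
  rw [logPd, pd_log (differentiableAt_of_contDiffOn (H.smooth i) H.isOpen hx) h0]
  field_simp

lemma logPd_update (H : SepSystem κ h (univ.pi J)) (hJ : IsBox J) (hx : x ∈ univ.pi J)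
    {i j k : Fin n} (hij : i ≠ j) (hik : i ≠ k) (hjk : j ≠ k) {t : ℝ} (ht : t ∈ J k) :
    logPd h i j (Function.update x k t) = logPd h i j x := by
  refine eq_of_pd_eq_zero hJ (fun x hx => H.diff_logPd i j hx) {k} ?_ (update_mem_box hx ht) hx ?_
  · intro l hl x hx
    obtain rfl : l = k := by simpa using hl
    exact H.pd_mixed i j l hij hik hjk x hx
  · intro l hl
    rw [Function.update_of_ne (by simpa using hl)]

/-- `∂ₖ log |hᵢ| · |hₖ|` does not depend on `xᵢ`. -/
lemma logPd_mul_exp_update (H : SepSystem κ h (univ.pi J)) (hJ : IsBox J) (hx : x ∈ univ.pi J)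
    {i k : Fin n} (hik : i ≠ k) {s t : ℝ} (hs : s ∈ J i) (ht : t ∈ J i) :
    logPd h i k (Function.update x i s) * Real.exp (Real.log (h k (Function.update x i s))) =
      logPd h i k (Function.update x i t) * Real.exp (Real.log (h k (Function.update x i t))) := by
  refine eq_of_hasDerivAt_zero (f := fun t => logPd h i k (Function.update x i t) *
    Real.exp (Real.log (h k (Function.update x i t)))) (hJ i).1 (hJ i).2.1 (fun t ht => ?_) hs ht
  have hm := update_mem_box hx ht
  convert! (hasDerivAt_update_line (H.diff_logPd i k hm)).mul
    (hasDerivAt_update_line (H.diff_log k hm)).exp using 1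
  rw [H.pd_self i k hik _ hm]
  simp only [logPd]
  ring

/-- `∂ₖ log |hₖ / hᵢ|` does not depend on `xᵢ`. -/
lemma logPd_sub_update (H : SepSystem κ h (univ.pi J)) (hJ : IsBox J) (hx : x ∈ univ.pi J)
    {i k : Fin n} (hik : i ≠ k) {s t : ℝ} (hs : s ∈ J i) (ht : t ∈ J i) :
    logPd h k k (Function.update x i s) - logPd h i k (Function.update x i s) =
      logPd h k k (Function.update x i t) - logPd h i k (Function.update x i t) := by
  refine eq_of_hasDerivAt_zero (f := fun t => logPd h k k (Function.update x i t) -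
    logPd h i k (Function.update x i t)) (hJ i).1 (hJ i).2.1 (fun t ht => ?_) hs ht
  have hm := update_mem_box hx ht
  convert! (hasDerivAt_update_line (H.diff_logPd k k hm)).sub
    (hasDerivAt_update_line (H.diff_logPd i k hm)) using 1
  rw [H.pd_self i k hik _ hm, H.pd_logPd_diag hik.symm hm]
  ring

/-- Unique continuation along coordinate lines of the compatibility conditions. -/
lemma compat_of_compat_near (H : SepSystem κ h (univ.pi J)) (hJ : IsBox J) (hz : z ∈ univ.pi J)
    {i j k : Fin n} (hj : j ≠ i) (hk : k ≠ i) {cj ck : ℝ} {F : ℝ → ℝ}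
    (hF : ∀ t ∈ J i, HasDerivAt F ((F t - ck) * logPd h k i (Function.update z i t)) t)
    (h0 : ∀ᶠ t in nhds (z i), (F t - cj) * logPd h j i (Function.update z i t) =
      (F t - ck) * logPd h k i (Function.update z i t)) {t : ℝ} (ht : t ∈ J i) :
    (F t - cj) * logPd h j i (Function.update z i t) =
      (F t - ck) * logPd h k i (Function.update z i t) := by
  classical
  let X : ℝ → Fin n → ℝ := fun t => Function.update z i t
  have hX : ∀ t ∈ J i, X t ∈ univ.pi J := fun t ht => update_mem_box hz ht
  -- Here ρ = |hᵢ|^{1/2}, so ρ⁻¹ d/dt is the derivative by arc length. The Gauss equation expresses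
  -- ∂ᵢaⱼᵢ − ½aᵢᵢaⱼᵢ; dividing aⱼᵢ by ρ absorbs the term with aᵢᵢ, which no equation of the system
  -- controls along this line.
  let ρ : ℝ → ℝ := fun t => Real.exp (Real.log (h i (X t)) / 2)
  have hρ0 : ∀ t, ρ t ≠ 0 := fun t => Real.exp_ne_zero _
  have hρd : ∀ t ∈ J i, HasDerivAt ρ (ρ t * (logPd h i i (X t) / 2)) t := fun t ht =>
    ((hasDerivAt_update_line (H.diff_log i (hX t ht))).div_const 2).exp
  let A0 : Fin n → ℝ → ℝ := fun j t => logPd h j i (X t) * (ρ t)⁻¹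
  let A1 : Fin n → ℝ → ℝ := fun j t => logPd h i j (X t)
  let A2 : Fin n → ℝ → ℝ := fun j t => pd j (logPd h i j) (X t)
  let A3 : Fin n → ℝ → ℝ := fun j t => logPd h j j (X t)
  let A4 : Fin n → ℝ → ℝ := fun j t => (h j (X t))⁻¹
  -- The sign of hᵢ, kept as a generator with derivative zero so that all signatures are treated at
  -- once.
  let e : ℝ → ℝ := fun t => h i (X t) * (ρ t * ρ t)⁻¹
  have he : ∀ t, h i (X t) = e t * ρ t ^ 2 := by
    intro t
    have := hρ0 t
    simp only [e]; field_simp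
  have ha : ∀ j t, logPd h j i (X t) = A0 j t * ρ t := by
    intro j t
    have := hρ0 t
    simp only [A0]; field_simp
  let G : (Fin 5 × {j : Fin n // j ≠ i}) ⊕ Bool → ℝ → ℝ := fun p => match p with
    | Sum.inl (c, j) => ![A0, A1, A2, A3, A4] c j.1
    | Sum.inr true => F
    | Sum.inr false => e
  set A := Algebra.adjoin ℝ (range G) with hA
  have m0 : ∀ j, j ≠ i → A0 j ∈ A := fun j hj =>
    Algebra.subset_adjoin ⟨Sum.inl (0, ⟨j, hj⟩), rfl⟩
  have m1 : ∀ j, j ≠ i → A1 j ∈ A := fun j hj =>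
    Algebra.subset_adjoin ⟨Sum.inl (1, ⟨j, hj⟩), rfl⟩
  have m2 : ∀ j, j ≠ i → A2 j ∈ A := fun j hj =>
    Algebra.subset_adjoin ⟨Sum.inl (2, ⟨j, hj⟩), rfl⟩
  have m3 : ∀ j, j ≠ i → A3 j ∈ A := fun j hj =>
    Algebra.subset_adjoin ⟨Sum.inl (3, ⟨j, hj⟩), rfl⟩
  have m4 : ∀ j, j ≠ i → A4 j ∈ A := fun j hj =>
    Algebra.subset_adjoin ⟨Sum.inl (4, ⟨j, hj⟩), rfl⟩
  have mF : F ∈ A := Algebra.subset_adjoin ⟨Sum.inr true, rfl⟩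
  have me : e ∈ A := Algebra.subset_adjoin ⟨Sum.inr false, rfl⟩
  have mc : ∀ c : ℝ, algebraMap ℝ (ℝ → ℝ) c ∈ A := fun c => A.algebraMap_mem c
  have hD : ∀ p, ∃ Y ∈ A, ∀ t ∈ J i, HasDerivAt (G p) (ρ t * Y t) t := by
    rintro (⟨c, j, hj⟩ | b)
    · have hline : ∀ {f : (Fin n → ℝ) → ℝ} {t : ℝ}, DifferentiableAt ℝ f (X t) →
          HasDerivAt (fun t => f (X t)) (pd i f (X t)) t := fun hf => hasDerivAt_update_line hf
      have key : ∀ c : Fin 5, ∃ Y ∈ A, ∀ t ∈ J i,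
          HasDerivAt (![A0, A1, A2, A3, A4] c j) (ρ t * Y t) t := by
        intro c
        fin_cases c
        -- The Gauss equation of i, j solved for the derivative of A0. The aⱼₗ with l ≠ i, j are
        -- constant along the line, so their values at z enter as scalars.
        · refine ⟨algebraMap ℝ (ℝ → ℝ) (-1 / 2) * (A0 j * A0 j + e * (algebraMap ℝ (ℝ → ℝ) (4 * κ)
            + A4 j * (algebraMap ℝ (ℝ → ℝ) 2 * A2 j + A1 j * A1 j - A1 j * A3 j)
            + ∑ l ∈ {l | l ≠ i ∧ l ≠ j},
              A4 l * (A1 l * algebraMap ℝ (ℝ → ℝ) (logPd h j l z)))), ?_, ?_⟩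
          · refine mul_mem (mc _) (add_mem (mul_mem (m0 j hj) (m0 j hj)) (mul_mem me
              (add_mem (add_mem (mc _) (mul_mem (m4 j hj) (sub_mem (add_mem (mul_mem (mc _)
              (m2 j hj)) (mul_mem (m1 j hj) (m1 j hj))) (mul_mem (m1 j hj) (m3 j hj)))))
              (sum_mem fun l hl => ?_))))
            simp only [Finset.mem_filter, Finset.mem_univ, true_and] at hl
            exact mul_mem (m4 l hl.1) (mul_mem (m1 l hl.1) (mc _))
          · intro t ht
            have hm := hX t ht
            have hg := H.gauss i j hj.symm (X t) hm
            have hsum : ∑ l ∈ {l | l ≠ i ∧ l ≠ j}, (h l (X t))⁻¹ *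
                (logPd h i l (X t) * logPd h j l (X t)) = ∑ l ∈ {l | l ≠ i ∧ l ≠ j},
                A4 l t * (A1 l t * logPd h j l z) := by
              refine Finset.sum_congr rfl fun l hl => ?_
              simp only [Finset.mem_filter, Finset.mem_univ, true_and] at hl
              rw [← H.logPd_update hJ hz (Ne.symm hl.2) hj hl.1 ht]
            rw [hsum, he t] at hg
            convert! (hline (H.diff_logPd j i hm)).mul ((hρd t ht).fun_inv (hρ0 t)) using 1
            have n1 := hρ0 t
            have n2 : e t ≠ 0 := by
              intro h0; apply H.ne_zero i (X t) hm; rw [he t, h0, zero_mul]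
            simp only [Pi.mul_apply, Pi.add_apply, Pi.sub_apply, Finset.sum_apply,
              Pi.algebraMap_apply, Algebra.algebraMap_self, RingHom.id_apply]
            rw [ha j t] at hg ⊢
            change A4 j t * (2 * A2 j t + A1 j t ^ 2 - A1 j t * A3 j t) + _ + _ = _ at hg
            generalize (∑ l ∈ {l | l ≠ i ∧ l ≠ j}, A4 l t * (A1 l t * logPd h j l z)) = Sl at *
            generalize pd i (logPd h j i) (X t) = D at *
            field_simp at hg ⊢
            linear_combination -hg
        · refine ⟨-(A1 j * A0 j), neg_mem (mul_mem (m1 j hj) (m0 j hj)), fun t ht => ?_⟩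
          convert! hline (H.diff_logPd i j (hX t ht)) using 1
          rw [H.pd_self i j hj.symm _ (hX t ht), ha]
          simp [A1]; ring
        · refine ⟨A1 j * A1 j * A0 j - A2 j * A0 j, sub_mem (mul_mem (mul_mem (m1 j hj) (m1 j hj))
            (m0 j hj)) (mul_mem (m2 j hj) (m0 j hj)), fun t ht => ?_⟩
          have hm := hX t ht
          convert! hline (H.diff_pd_logPd i j j hm) using 1
          have hneg : (fun y => -(logPd h i j y * logPd h j i y))
              = fun y => (-1) * (logPd h i j y * logPd h j i y) := by ext y; ring
          rw [pd_comm (H.smooth_logPd i j) H.isOpen hm i j,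
            pd_congr_on H.isOpen hm (H.pd_self i j hj.symm) j, hneg,
            pd_const_mul _ ((H.diff_logPd _ _ hm).fun_mul (H.diff_logPd _ _ hm)),
            pd_mul (H.diff_logPd _ _ hm) (H.diff_logPd _ _ hm), H.pd_self j i hj _ hm, ha]
          simp [A1, A2]; ring
        · refine ⟨-(A1 j * A0 j), neg_mem (mul_mem (m1 j hj) (m0 j hj)), fun t ht => ?_⟩
          convert! hline (H.diff_logPd j j (hX t ht)) using 1
          rw [H.pd_logPd_diag hj (hX t ht), ha]
          simp [A1]; ring
        · refine ⟨-(A4 j * A0 j), neg_mem (mul_mem (m4 j hj) (m0 j hj)), fun t ht => ?_⟩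
          have hm := hX t ht
          have n0 := H.ne_zero j _ hm
          convert! (hline (differentiableAt_of_contDiffOn (H.smooth j) H.isOpen hm)).fun_inv n0
            using 1
          rw [H.pd_eq_logPd_mul hm, ha]
          simp only [Pi.neg_apply, Pi.mul_apply, A4]
          field_simp
      exact key c
    · cases b
      · refine ⟨0, zero_mem _, fun t ht => ?_⟩
        have hm := hX t ht
        have n1 := hρ0 t
        have hi' : HasDerivAt (fun t => h i (X t)) (pd i (h i) (X t)) t :=
          hasDerivAt_update_line (differentiableAt_of_contDiffOn (H.smooth i) H.isOpen hm)
        convert! hi'.mul (((hρd t ht).fun_mul (hρd t ht)).fun_inv (mul_ne_zero n1 n1)) using 1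
        rw [H.pd_eq_logPd_mul hm]
        simp only [Pi.zero_apply]
        field_simp
        ring
      · refine ⟨(F - algebraMap ℝ (ℝ → ℝ) ck) * A0 k, mul_mem (sub_mem mF (mc _)) (m0 k hk),
          fun t ht => ?_⟩
        convert! hF t ht using 1
        show _ = (F t - ck) * logPd h k i (X t)
        rw [ha]
        simp; ring
  -- The compatibility defect divided by ρ; it lies in the algebra and vanishes near the initial
  -- point.
  have hf : (F - algebraMap ℝ (ℝ → ℝ) cj) * A0 j - (F - algebraMap ℝ (ℝ → ℝ) ck) * A0 k ∈ A :=
    sub_mem (mul_mem (sub_mem mF (mc _)) (m0 j hj)) (mul_mem (sub_mem mF (mc _)) (m0 k hk))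
  have := eq_zero_of_mem_adjoin (hJ i).2.1 (hJ i).1
    (fun t ht => (hρd t ht).continuousAt.continuousWithinAt) (fun t _ => hρ0 t) hD hf
    (hz i (mem_univ i)) (by
      filter_upwards [h0] with t ht
      simp only [Pi.sub_apply, Pi.mul_apply, Pi.algebraMap_apply, Algebra.algebraMap_self,
        RingHom.id_apply, Pi.zero_apply, A0]
      change (F t - cj) * logPd h j i (X t) = (F t - ck) * logPd h k i (X t) at ht
      linear_combination (ρ t)⁻¹ * ht) ht
  simp only [Pi.sub_apply, Pi.mul_apply, Pi.algebraMap_apply, Algebra.algebraMap_self,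
    RingHom.id_apply] at this
  show (F t - cj) * logPd h j i (X t) = (F t - ck) * logPd h k i (X t)
  rw [ha, ha]
  linear_combination ρ t * this

end SepSystem

end Extension

end KEM

end

noncomputable section

namespace KEM

/-! ### Extension of solutions from a smaller box to a larger one -/

section ExtensionOfSolutions

variable {n : ℕ} {κ : ℝ} {h : Fin n → (Fin n → ℝ) → ℝ} {J J' : Fin n → Set ℝ} {x y z : Fin n → ℝ}
  {lam : Fin n → ℝ → ℝ}

lemma IsBox.update (hJ : IsBox J) {i : Fin n} {I : Set ℝ} (hI : IsOpen I ∧ I.OrdConnected ∧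
    I.Nonempty) : IsBox (Function.update J i I) := by
  intro k
  by_cases hk : k = i
  · subst hk; simpa using hI
  · simpa [Function.update_of_ne hk] using hJ k

lemma pi_mono (hs : ∀ i, J' i ⊆ J i) : univ.pi J' ⊆ univ.pi J :=
  fun _ hx i _ => hs i (hx i (mem_univ i))

lemma update_box_subset {i : Fin n} {I : Set ℝ} (hI : I ⊆ J i) :
    ∀ k, Function.update J i I k ⊆ J k := by
  intro k
  by_cases hk : k = i
  · subst hk; simpa using hI
  · simp [Function.update_of_ne hk]

/-- The candidate for the continuation of `lam i` along the line through `x`, computed from the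
eigenvalue `lam k`, does not depend on `x`. -/
lemma IsSol.continuation_indep (hJ : IsBox J) (H : SepSystem κ h (univ.pi J)) {i k : Fin n}
    (hki : k ≠ i) {I : Set ℝ} (hIs : I ⊆ J i)
    (hl : IsSol h (Function.update J i I) lam) {t₀ t : ℝ} (ht₀ : t₀ ∈ I) (ht : t ∈ J i)
    (hx : x ∈ univ.pi J) (hy : y ∈ univ.pi J) :
    lam k (x k) + (lam i t₀ - lam k (x k)) * Real.exp (Real.log (h k (Function.update x i t)) -
      Real.log (h k (Function.update x i t₀))) =
    lam k (y k) + (lam i t₀ - lam k (y k)) * Real.exp (Real.log (h k (Function.update y i t)) -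
      Real.log (h k (Function.update y i t₀))) := by
  have ht₀' : t₀ ∈ J i := hIs ht₀
  refine eq_of_update_eq (J := J) (f := fun x => lam k (x k) + (lam i t₀ - lam k (x k)) *
    Real.exp (Real.log (h k (Function.update x i t)) - Real.log (h k (Function.update x i t₀))))
    Finset.univ ?_ hx hy (by simp)
  intro m _ x hx s hs
  by_cases hmi : m = i
  · subst hmi
    simp [Function.update_of_ne hki, Function.update_idem]
  have hline : ∀ r ∈ J i, ∀ s ∈ J m, HasDerivAt
      (fun s => Real.log (h k (Function.update (Function.update x m s) i r)))
      (logPd h k m (Function.update (Function.update x m s) i r)) s := by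
    intro r hr s hs
    simp_rw [Function.update_comm hmi]
    exact hasDerivAt_update_line (H.diff_log k (update_mem_box (update_mem_box hx hr) hs))
  have hder : ∀ s ∈ J m, HasDerivAt (fun s => lam k (Function.update x m s k) +
      (lam i t₀ - lam k (Function.update x m s k)) * Real.exp
      (Real.log (h k (Function.update (Function.update x m s) i t)) -
        Real.log (h k (Function.update (Function.update x m s) i t₀)))) 0 s := by
    intro s hs
    have hxs := update_mem_box hx hs
    have hE := ((hline t ht s hs).sub (hline t₀ ht₀' s hs)).exp
    by_cases hmk : m = k
    · subst hmk
      have hm' : Function.update (Function.update x m s) i t₀ ∈ univ.pi (Function.update J i I) := by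
        intro l _
        by_cases hl : l = i
        · subst hl; simpa using ht₀
        · simpa [Function.update_of_ne hl] using hxs l (mem_univ l)
      have hlk := hl _ hm' i m (Ne.symm hmi)
      simp only [Function.update_self, Function.update_of_ne hmi] at hlk
      simp only [Function.update_self]
      convert! hlk.add ((hlk.const_sub (lam i t₀)).mul hE) using 1
      -- When xₖ itself moves, λₖ varies too. The derivative vanishes because aₖₖ − aᵢₖ and aᵢₖ|hₖ|
      -- take the same values at the ends t and t₀ of the xᵢ-line.
      have e1 := H.logPd_sub_update hJ hxs (Ne.symm hmi) ht ht₀'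
      have e2 := H.logPd_mul_exp_update hJ hxs (Ne.symm hmi) ht ht₀'
      have e3 : ∀ a b : ℝ, Real.exp (a - b) * Real.exp b = Real.exp a := by
        intro a b; rw [← Real.exp_add]; congr 1; ring
      have e4 := e3 (Real.log (h m (Function.update (Function.update x m s) i t)))
        (Real.log (h m (Function.update (Function.update x m s) i t₀)))
      simp only [Pi.sub_apply]
      rw [← e4, ← mul_assoc] at e2
      have e5 := mul_right_cancel₀ (Real.exp_ne_zero _) e2
      generalize Real.exp (Real.log (h m (Function.update (Function.update x m s) i t)) -
        Real.log (h m (Function.update (Function.update x m s) i t₀))) = E at *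
      linear_combination (lam m s - lam i t₀) * E * e1 + (lam m s - lam i t₀) * e5
    -- For m ≠ k the logarithmic derivative aₖₘ is independent of xᵢ, so the contributions of the
    -- two ends cancel.
    · simp only [Function.update_of_ne (Ne.symm hmk)]
      convert! (hE.const_mul (lam i t₀ - lam k (x k))).const_add (lam k (x k)) using 1
      have e1 := H.logPd_update hJ hxs (Ne.symm hmk) hki hmi ht
      have e2 := H.logPd_update hJ hxs (Ne.symm hmk) hki hmi ht₀'
      rw [e1, e2]
      ring
  have := eq_of_hasDerivAt_zero (hJ m).1 (hJ m).2.1 hder hs (hx m (mem_univ m))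
  simpa using this

/-- Extension of a solution in one coordinate direction. -/
lemma IsSol.extend_direction (hJ : IsBox J) (H : SepSystem κ h (univ.pi J)) (hn : 1 < n)
    {i : Fin n} {I : Set ℝ} (hI : IsOpen I ∧ I.OrdConnected ∧ I.Nonempty) (hIs : I ⊆ J i)
    (hl : IsSol h (Function.update J i I) lam) :
    ∃ F : ℝ → ℝ, (∀ t ∈ I, F t = lam i t) ∧ IsSol h J (Function.update lam i F) := by
  have : Nontrivial (Fin n) := Fin.nontrivial_iff_two_le.2 hn
  obtain ⟨k, hki⟩ := exists_ne i
  have hJ' := hJ.update (i := i) hI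
  have hsub := pi_mono (update_box_subset hIs)
  have H' := H.mono hJ'.isOpen hsub
  obtain ⟨y, hy'⟩ := hJ'.nonempty
  have hy : y ∈ univ.pi J := hsub hy'
  obtain ⟨t₀, ht₀⟩ := hI.2.2
  have ht₀' := hIs ht₀
  -- The closed formula of `IsSol.eq_exp` for one auxiliary index k, evaluated on all of `J i`
  -- instead of I.
  let F : ℝ → ℝ := fun t => lam k (y k) + (lam i t₀ - lam k (y k)) *
    Real.exp (Real.log (h k (Function.update y i t)) - Real.log (h k (Function.update y i t₀)))
  have hFx : ∀ x ∈ univ.pi J, ∀ t ∈ J i, F t = lam k (x k) + (lam i t₀ - lam k (x k)) *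
      Real.exp (Real.log (h k (Function.update x i t)) -
        Real.log (h k (Function.update x i t₀))) := fun x hx t ht =>
    hl.continuation_indep hJ H hki hIs ht₀ ht hy hx
  have hbase : ∀ x ∈ univ.pi J, ∀ t ∈ I,
      Function.update x i t ∈ univ.pi (Function.update J i I) := by
    intro x hx t ht l _
    by_cases hl : l = i
    · subst hl; simpa using ht
    · simpa [Function.update_of_ne hl] using hx l (mem_univ l)
  have hFI : ∀ t ∈ I, F t = lam i t := by
    intro t ht
    have h1 := hl.eq_exp hJ' H' (hbase y hy t₀ ht₀) hki (t := t) (by simpa using ht)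
    simp only [Function.update_self, Function.update_of_ne hki, Function.update_idem] at h1
    exact h1.symm
  have hFk : ∀ x ∈ univ.pi J, ∀ t ∈ J i, HasDerivAt F
      ((F t - lam k (x k)) * logPd h k i (Function.update x i t)) t := by
    intro x hx t ht
    have h1 := (((hasDerivAt_update_line (H.diff_log k (update_mem_box hx ht))).sub_const
      (Real.log (h k (Function.update x i t₀)))).exp.const_mul
      (lam i t₀ - lam k (x k))).const_add (lam k (x k))
    have h2 : HasDerivAt F _ t := h1.congr_of_eventuallyEq (by
      filter_upwards [(hJ i).1.mem_nhds ht] with s hs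
      exact hFx x hx s hs)
    convert! h2 using 1
    rw [hFx x hx t ht]
    simp only [logPd]
    ring
  -- The equation with k holds by construction. For the other j, the two expressions for the
  -- derivative agree near t₀, where F is the old λᵢ, and hence on the whole line by unique
  -- continuation.
  have hFj : ∀ x ∈ univ.pi J, ∀ j, j ≠ i → ∀ t ∈ J i, HasDerivAt F
      ((F t - lam j (x j)) * logPd h j i (Function.update x i t)) t := by
    intro x hx j hj t ht
    have hz := update_mem_box hx ht₀'
    have hc := H.compat_of_compat_near (cj := lam j (x j)) (ck := lam k (x k)) (F := F) hJ hz hj hki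
      (by
        intro t ht
        simpa only [Function.update_idem] using hFk x hx t ht)
      (by
        rw [Function.update_self]
        filter_upwards [hI.1.mem_nhds ht₀] with s hs
        have h1 := hl _ (hbase x hx s hs) j i hj
        have h2 := hl _ (hbase x hx s hs) k i hki
        simp only [Function.update_self, Function.update_of_ne hj,
          Function.update_of_ne hki] at h1 h2
        simp only [Function.update_idem]
        rw [hFI s hs]
        exact h1.unique h2) ht
    simp only [Function.update_idem] at hc
    rw [hc]
    exact hFk x hx t ht
  refine ⟨F, hFI, ?_⟩
  intro x hx a b hab
  have hxi := hx i (mem_univ i)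
  by_cases hb : b = i
  · subst hb
    have := hFj x hx a hab (x b) hxi
    simpa [Function.update_of_ne hab] using this
  have hold := hl _ (hbase x hx t₀ ht₀) a b hab
  rw [Function.update_of_ne hb] at hold
  rw [Function.update_of_ne hb]
  by_cases ha : a = i
  · subst ha
    simp only [Function.update_self] at hold ⊢
    convert! hold using 1
    -- For λ_b with b ≠ a, where a is the extended direction, the right-hand side must not change
    -- along xₐ: F' = (F − λ_b)a_{ba} cancels ∂ₐa_{ab} = −a_{ab}a_{ba}.
    have hconst : ∀ t ∈ J a, HasDerivAt (fun t => (lam b (x b) - F t) *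
        logPd h a b (Function.update x a t)) 0 t := by
      intro t ht
      have hm := update_mem_box hx ht
      convert! ((hFj x hx b hb t ht).const_sub (lam b (x b))).mul
        (hasDerivAt_update_line (H.diff_logPd a b hm)) using 1
      rw [H.pd_self a b hab _ hm]
      ring
    have := eq_of_hasDerivAt_zero (hJ a).1 (hJ a).2.1 hconst hxi ht₀'
    simpa [hFI t₀ ht₀] using this
  · rw [Function.update_of_ne ha] at hold ⊢
    rwa [H.logPd_update hJ hx hab ha hb ht₀'] at hold

/-- Every solution on a box extends to a larger box. -/
theorem IsSol.extend (hJ : IsBox J) (H : SepSystem κ h (univ.pi J)) (hn : 1 < n) (hJ' : IsBox J')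
    (hs : ∀ i, J' i ⊆ J i) (hl : IsSol h J' lam) :
    ∃ mu, IsSol h J mu ∧ ∀ i, ∀ t ∈ J' i, mu i t = lam i t := by
  classical
  suffices hsuff : ∀ s : Finset (Fin n), ∃ mu, IsSol h (fun k => if k ∈ s then J k else J' k) mu ∧
      ∀ i, ∀ t ∈ J' i, mu i t = lam i t by
    simpa using hsuff Finset.univ
  intro s
  induction s using Finset.induction_on with
  | empty => exact ⟨lam, by simpa using hl, fun _ _ _ => rfl⟩
  | insert a s ha ih =>
    obtain ⟨mu, hmu, heq⟩ := ih
    let B : Fin n → Set ℝ := fun k => if k ∈ insert a s then J k else J' k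
    have hB : IsBox B := by
      intro k
      simp only [B]
      split_ifs
      · exact hJ k
      · exact hJ' k
    have hBs : ∀ k, B k ⊆ J k := by
      intro k
      simp only [B]
      split_ifs
      · exact subset_rfl
      · exact hs k
    have hBa : B a = J a := by simp [B]
    have hupd : (fun k => if k ∈ s then J k else J' k) = Function.update B a (J' a) := by
      ext1 k
      by_cases hk : k = a
      · subst hk; simp [ha]
      · simp [B, hk]
    rw [hupd] at hmu
    obtain ⟨F, hF, hsol⟩ := hmu.extend_direction hB (H.mono hB.isOpen (pi_mono hBs)) hn (hJ' a)
      (by rw [hBa]; exact hs a)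
    refine ⟨Function.update mu a F, hsol, fun k t ht => ?_⟩
    by_cases hk : k = a
    · subst hk; rw [Function.update_self, hF t ht, heq k t ht]
    · rw [Function.update_of_ne hk, heq k t ht]

/-- On every box there is a nontrivial solution. -/
theorem SepSystem.exists_sol (hJ : IsBox J) (H : SepSystem κ h (univ.pi J)) (hn : 1 < n) :
    ∃ lam, IsSol h J lam ∧ ∀ x ∈ univ.pi J, ∃ i j, lam i (x i) ≠ lam j (x j) := by
  obtain ⟨J', hJ', hs, mu, hmu, x, hx, i, j, hij⟩ := H.exists_sol_local hJ.nonempty hn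
  have hs' : ∀ i, J' i ⊆ J i := by
    intro i t ht
    have := hs (update_mem_box hx ht) i (mem_univ i)
    simpa using this
  obtain ⟨lam, hlam, heq⟩ := hmu.extend hJ H hn hJ' hs'
  refine ⟨lam, hlam, fun y hy => ⟨i, j, fun he => hij ?_⟩⟩
  have := hlam.eq_of_eq hJ H hy he (hs hx)
  rwa [heq i _ (hx i (mem_univ i)), heq j _ (hx j (mem_univ j))] at this

end ExtensionOfSolutions

/-! ### The metric in terms of the eigenvalues -/

section Form

variable {n : ℕ} {κ : ℝ} {J : Fin n → Set ℝ} {g : (Fin n → ℝ) → Matrix (Fin n) (Fin n) ℝ}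

lemma hasConcircularForm_of_subsingleton (hn : ¬ 1 < n)
    (hg : ∀ i j, ContDiffOn ℝ ∞ (fun x => g x i j) (univ.pi J)) : HasConcircularForm g J := by
  refine ⟨∅, fun _ => 0, fun _ _ => 0, fun _ _ => 0, fun i j x => g x i j, by simp, ?_, ?_, ?_⟩
  · intro i j _ _ _
    refine ⟨hg i j, fun x _ y _ hxy => ?_⟩
    have : x = y := by ext k; exact hxy k (by simp) rfl
    rw [this]
  · intro x _
    simp
  · exact fun h => absurd h hn

/-- For a nontrivial solution, S consists of the indices with nonconstant eigenvalue, and the blocks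
are the level sets of the constant ones. Solving the eigenvalue equations for ∂ₖ log|hᵢ| shows that
hᵢ carries precisely the factors λᵢ − λ_b with b in S. -/
theorem SepSystem.hasConcircularForm (hJ : IsBox J)
    (H : SepSystem κ (fun i x => g x i i) (univ.pi J)) (hn : 1 < n)
    (hdiag : ∀ x ∈ univ.pi J, ∀ i j, i ≠ j → g x i j = 0) : HasConcircularForm g J := by
  classical
  obtain ⟨lam, hlam, hnt⟩ := H.exists_sol hJ hn
  obtain ⟨y, hy⟩ := hJ.nonempty
  set h : Fin n → (Fin n → ℝ) → ℝ := fun i x => g x i i with hh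
  let S : Finset (Fin n) := Finset.univ.filter fun a => ∃ s ∈ J a, ∃ t ∈ J a, lam a s ≠ lam a t
  have hS : ∀ a, a ∈ S ↔ ∃ s ∈ J a, ∃ t ∈ J a, lam a s ≠ lam a t := by simp [S]
  have hconst : ∀ i, i ∉ S → ∀ t ∈ J i, lam i t = lam i (y i) := by
    intro i hi t ht
    by_contra hne
    exact hi ((hS i).2 ⟨t, ht, y i, hy i (mem_univ i), hne⟩)
  have hne : ∀ a ∈ S, ∀ b, b ≠ a → ∀ x ∈ univ.pi J, lam a (x a) - lam b (x b) ≠ 0 := by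
    intro a ha b hb x hx he
    obtain ⟨s, hs, t, ht, hst⟩ := (hS a).1 ha
    have h1 := (hlam.const_of_eq hJ H hx hb.symm (sub_eq_zero.1 he)).1
    exact hst (by rw [h1 s hs, h1 t ht])
  have hsm : ∀ a, ContDiffOn ℝ ∞ (fun x : Fin n → ℝ => lam a (x a)) (univ.pi J) := fun a =>
    (hlam.contDiffOn hJ H hn a).comp (contDiff_apply ℝ ℝ a).contDiffOn fun x hx => hx a (mem_univ a)
  have hd : ∀ a, ∀ x ∈ univ.pi J, DifferentiableAt ℝ (fun x : Fin n → ℝ => lam a (x a)) x :=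
    fun a x hx => differentiableAt_of_contDiffOn (hsm a) H.isOpen hx
  have hpd : ∀ a k, ∀ x ∈ univ.pi J, pd k (fun x : Fin n → ℝ => lam a (x a)) x =
      if k = a then deriv (lam a) (x a) else 0 := by
    intro a k x hx
    have h1 := hasDerivAt_line (hd a x hx) k
    split_ifs with hka
    · subst hka
      simp only [Function.update_self] at h1
      exact h1.deriv.symm
    · simp only [Function.update_of_ne (Ne.symm hka)] at h1
      exact h1.unique (hasDerivAt_const _ _)
  have hder : ∀ i k, i ≠ k → ∀ x ∈ univ.pi J, deriv (lam k) (x k) =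
      (lam k (x k) - lam i (x i)) * logPd h i k x := fun i k hik x hx => (hlam x hx i k hik).deriv
  -- the quotient of `hᵢ` by the product of the differences of eigenvalues
  let Q : Fin n → (Fin n → ℝ) → ℝ := fun i x => ∏ b ∈ S.erase i, (lam i (x i) - lam b (x b))
  have hQ0 : ∀ i, ∀ x ∈ univ.pi J, Q i x ≠ 0 := by
    intro i x hx
    refine Finset.prod_ne_zero_iff.2 fun b hb => ?_
    have hb' := Finset.mem_erase.1 hb
    have := hne b hb'.2 i (Ne.symm hb'.1) x hx
    intro h0; apply this; linarith
  have hQs : ∀ i, ContDiffOn ℝ ∞ (Q i) (univ.pi J) := fun i =>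
    contDiffOn_prod fun b _ => (hsm i).sub (hsm b)
  let f : Fin n → (Fin n → ℝ) → ℝ := fun i x => h i x * (Q i x)⁻¹
  have hfs : ∀ i, ContDiffOn ℝ ∞ (f i) (univ.pi J) := fun i =>
    (H.smooth i).mul ((hQs i).inv fun x hx => hQ0 i x hx)
  have hfQ : ∀ i, ∀ x ∈ univ.pi J, h i x = Q i x * f i x := by
    intro i x hx
    have := hQ0 i x hx
    simp only [f]; field_simp
  have hfpd : ∀ i k, k ≠ i → (k ∈ S ∨ lam k (y k) ≠ lam i (y i)) → ∀ x ∈ univ.pi J,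
      pd k (f i) x = 0 := by
    intro i k hki hk x hx
    have hQd : DifferentiableAt ℝ (Q i) x := differentiableAt_of_contDiffOn (hQs i) H.isOpen hx
    have hfd : DifferentiableAt ℝ (f i) x := differentiableAt_of_contDiffOn (hfs i) H.isOpen hx
    have h1 := pd_congr_on H.isOpen hx (hfQ i) k
    rw [pd_mul hQd hfd, show pd k (h i) x = logPd h i k x * h i x from H.pd_eq_logPd_mul hx i k,
      hfQ i x hx] at h1
    -- It suffices that Qᵢ and hᵢ have the same logarithmic derivative in xₖ.
    suffices hQk : pd k (Q i) x = logPd h i k x * Q i x by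
      rw [hQk] at h1
      have : Q i x * pd k (f i) x = 0 := by linear_combination -h1
      exact (mul_eq_zero.1 this).resolve_left (hQ0 i x hx)
    by_cases hkS : k ∈ S
    · have hmem : k ∈ S.erase i := Finset.mem_erase.2 ⟨hki, hkS⟩
      have hsplit : Q i = fun x => (lam i (x i) - lam k (x k)) *
          ∏ b ∈ (S.erase i).erase k, (lam i (x i) - lam b (x b)) := by
        ext x; exact (Finset.mul_prod_erase _ _ hmem).symm
      have hrest : pd k (fun x => ∏ b ∈ (S.erase i).erase k, (lam i (x i) - lam b (x b))) x = 0 := by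
        have h2 := hasDerivAt_line (f := fun x => ∏ b ∈ (S.erase i).erase k,
          (lam i (x i) - lam b (x b))) (x := x) (differentiableAt_of_contDiffOn
            (contDiffOn_prod fun b _ => (hsm i).sub (hsm b)) H.isOpen hx) k
        refine h2.unique ?_
        have h3 : (fun s => ∏ b ∈ (S.erase i).erase k, (lam i (Function.update x k s i) -
            lam b (Function.update x k s b))) = fun _ => ∏ b ∈ (S.erase i).erase k,
            (lam i (x i) - lam b (x b)) := by
          ext s
          refine Finset.prod_congr rfl fun b hb => ?_
          rw [Function.update_of_ne (Ne.symm hki), Function.update_of_ne (Finset.mem_erase.1 hb).1]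
        rw [h3]
        exact hasDerivAt_const _ _
      rw [hsplit, pd_mul ((hd i x hx).fun_sub (hd k x hx)) (differentiableAt_of_contDiffOn
            (contDiffOn_prod fun b _ => (hsm i).sub (hsm b)) H.isOpen hx), hrest,
        pd_sub (hd i x hx) (hd k x hx), hpd i k x hx, hpd k k x hx, if_neg hki, if_pos rfl,
        hder i k (Ne.symm hki) x hx]
      ring
    · have hlk := hk.resolve_left hkS
      have hk0 : deriv (lam k) (x k) = 0 := by
        have : lam k =ᶠ[nhds (x k)] fun _ => lam k (y k) := by
          filter_upwards [(hJ k).1.mem_nhds (hx k (mem_univ k))] with t ht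
          exact hconst k hkS t ht
        rw [this.deriv_eq]; simp
      have hlog : logPd h i k x = 0 := by
        have h2 := hder i k (Ne.symm hki) x hx
        rw [hk0] at h2
        refine (mul_eq_zero.1 h2.symm).resolve_left fun h3 => ?_
        exact hlk (hlam.eq_of_eq hJ H hx (sub_eq_zero.1 h3) hy)
      rw [hlog, zero_mul]
      refine (hasDerivAt_line hQd k).unique ?_
      have h3 : (fun s => Q i (Function.update x k s)) = fun _ => Q i x := by
        ext s
        refine Finset.prod_congr rfl fun b hb => ?_
        have hbk : b ≠ k := by rintro rfl; exact hkS (Finset.mem_erase.1 hb).2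
        rw [Function.update_of_ne (Ne.symm hki), Function.update_of_ne hbk]
      rw [h3]
      exact hasDerivAt_const _ _
  refine ⟨S, fun i => lam i (y i), fun a t => f a (Function.update y a t), lam,
    fun i j x => if i = j then f i x else 0, ?_, ?_, ?_, ?_⟩
  · intro a ha
    exact ⟨(hfs a).comp (contDiff_update y a).contDiffOn fun t ht => update_mem_box hy ht,
      hlam.contDiffOn hJ H hn a, (hS a).1 ha⟩
  · intro i j hi hj he
    by_cases hij : i = j
    · subst hij
      simp only [if_true]
      refine ⟨hfs i, fun x hx z hz hxz => ?_⟩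
      refine eq_of_pd_eq_zero hJ (fun x hx => differentiableAt_of_contDiffOn (hfs i) H.isOpen hx)
        (Finset.univ.filter fun k => k ≠ i ∧ (k ∈ S ∨ lam k (y k) ≠ lam i (y i))) ?_ hx hz ?_
      · intro k hk x hx
        simp only [Finset.mem_filter, Finset.mem_univ, true_and] at hk
        exact hfpd i k hk.1 hk.2 x hx
      · intro k hk
        simp only [Finset.mem_filter, Finset.mem_univ, true_and, not_and_or, not_not, not_or] at hk
        rcases hk with rfl | hk
        · exact hxz k hi rfl
        · exact hxz k hk.1 hk.2
    · simp only [if_neg hij]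
      exact ⟨contDiffOn_const, by simp⟩
  · intro x hx
    refine ⟨fun a ha => ?_, fun i j hi hj he => ?_, fun i j hij _ => hdiag x hx i j hij⟩
    · have h1 : f a (Function.update y a (x a)) = f a x := by
        refine eq_of_pd_eq_zero hJ (fun x hx => differentiableAt_of_contDiffOn (hfs a) H.isOpen hx)
          (Finset.univ.erase a) ?_ (update_mem_box hy (hx a (mem_univ a))) hx ?_
        · intro k hk x hx
          have hka : k ≠ a := (Finset.mem_erase.1 hk).1
          refine hfpd a k hka (Or.inr fun he => ?_) x hx
          exact hne a ha k hka y hy (by rw [he, sub_self])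
        · intro k hk
          have : k = a := by simpa using hk
          subst this; simp
      show h a x = f a (Function.update y a (x a)) * Q a x
      rw [h1, hfQ a x hx, mul_comm]
    · by_cases hij : i = j
      · subst hij
        simp only [if_true]
        show h i x = _
        rw [hfQ i x hx]
        congr 1
        simp only [Q]
        rw [Finset.erase_eq_of_notMem hi, hconst i hi _ (hx i (mem_univ i))]
      · simp only [if_neg hij, mul_zero]
        exact hdiag x hx i j hij
  · intro _
    obtain ⟨i, j, hij⟩ := hnt y hy
    exact Or.inr ⟨i, j, hij⟩

end Form

end KEM

end

noncomputable section

namespace KEM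

/-! ### Orthogonal metrics -/

section Orthogonal

variable {n : ℕ} {κ : ℝ} {g T : (Fin n → ℝ) → Matrix (Fin n) (Fin n) ℝ} {Ω : Set (Fin n → ℝ)}
  {x : Fin n → ℝ}

/-- `g` is a smooth nondegenerate diagonal metric on the open set `Ω`. -/
structure OrthMetric (g : (Fin n → ℝ) → Matrix (Fin n) (Fin n) ℝ) (Ω : Set (Fin n → ℝ)) : Prop where
  isOpen : IsOpen Ω
  smooth : ∀ i, ContDiffOn ℝ ∞ (fun x => g x i i) Ω
  ne_zero : ∀ i, ∀ x ∈ Ω, g x i i ≠ 0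
  off_diag : ∀ x ∈ Ω, ∀ i j, i ≠ j → g x i j = 0

/-- The diagonal components of a metric. -/
def diagOf (g : (Fin n → ℝ) → Matrix (Fin n) (Fin n) ℝ) (i : Fin n) (x : Fin n → ℝ) : ℝ := g x i i

namespace OrthMetric

variable (hg : OrthMetric g Ω)
include hg

lemma inv_eq (hx : x ∈ Ω) : (g x)⁻¹ = Matrix.diagonal fun i => (g x i i)⁻¹ := by
  have h1 : g x = Matrix.diagonal fun i => g x i i := by
    ext i j
    by_cases hij : i = j
    · subst hij; simp
    · rw [Matrix.diagonal_apply_ne _ hij, hg.off_diag x hx i j hij]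
  refine Matrix.inv_eq_right_inv ?_
  rw [h1, Matrix.diagonal_mul_diagonal, ← Matrix.diagonal_one]
  congr 1
  ext i
  simp [hg.ne_zero i x hx]

lemma diff (hx : x ∈ Ω) (i : Fin n) : DifferentiableAt ℝ (fun x => g x i i) x :=
  differentiableAt_of_contDiffOn (hg.smooth i) hg.isOpen hx

lemma pd_diag (hx : x ∈ Ω) (i j : Fin n) :
    pd j (fun y => g y i i) x = logPd (diagOf g) i j x * g x i i := by
  have h0 := hg.ne_zero i x hx
  simp only [logPd, diagOf]
  rw [pd_log (hg.diff hx i) h0]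
  field_simp

lemma pd_off_diag (hx : x ∈ Ω) {i j : Fin n} (hij : i ≠ j) (k : Fin n) :
    pd k (fun y => g y i j) x = 0 :=
  pd_eq_zero_of_eqOn hg.isOpen hx (fun y hy => hg.off_diag y hy i j hij) k

lemma christoffel_eq (hx : x ∈ Ω) (k i j : Fin n) :
    christoffel g k i j x = (1 / 2) * ((g x k k)⁻¹ * (pd i (fun y => g y j k) x +
      pd j (fun y => g y i k) x - pd k (fun y => g y i j) x)) := by
  rw [christoffel, hg.inv_eq hx, Finset.sum_eq_single k]
  · simp
  · intro l _ hl
    simp [Matrix.diagonal_apply_ne _ (Ne.symm hl)]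
  · simp

lemma christoffel_left (hx : x ∈ Ω) (i j : Fin n) :
    christoffel g i i j x = (1 / 2) * logPd (diagOf g) i j x := by
  have h0 := hg.ne_zero i x hx
  rw [hg.christoffel_eq hx]
  by_cases hij : i = j
  · subst hij
    rw [hg.pd_diag hx]; field_simp; ring
  · rw [hg.pd_off_diag hx (Ne.symm hij), hg.pd_off_diag hx hij, hg.pd_diag hx]; field_simp; ring

lemma christoffel_symm (k i j : Fin n) (hx : x ∈ Ω) :
    christoffel g k i j x = christoffel g k j i x := by
  rw [hg.christoffel_eq hx, hg.christoffel_eq hx]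
  have : pd k (fun y => g y i j) x = pd k (fun y => g y j i) x := by
    by_cases hij : i = j
    · rw [hij]
    · rw [hg.pd_off_diag hx hij, hg.pd_off_diag hx (Ne.symm hij)]
  rw [this]; ring

lemma christoffel_right (hx : x ∈ Ω) (i j : Fin n) :
    christoffel g i j i x = (1 / 2) * logPd (diagOf g) i j x := by
  rw [hg.christoffel_symm i j i hx, hg.christoffel_left hx]

lemma christoffel_diag (hx : x ∈ Ω) {i k : Fin n} (hik : i ≠ k) :
    christoffel g k i i x = -(1 / 2) * ((g x k k)⁻¹ * g x i i * logPd (diagOf g) i k x) := by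
  rw [hg.christoffel_eq hx, hg.pd_off_diag hx hik, hg.pd_diag hx]; ring

lemma christoffel_distinct (hx : x ∈ Ω) {i j k : Fin n} (hij : i ≠ j) (hik : i ≠ k) (hjk : j ≠ k) :
    christoffel g k i j x = 0 := by
  rw [hg.christoffel_eq hx, hg.pd_off_diag hx hik, hg.pd_off_diag hx hij, hg.pd_off_diag hx hjk]
  ring

lemma contDiffOn_logPd (i j : Fin n) : ContDiffOn ℝ ∞ (logPd (diagOf g) i j) Ω :=
  contDiffOn_pd ((hg.smooth i).log fun x hx => hg.ne_zero i x hx) hg.isOpen j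

lemma diff_logPd (hx : x ∈ Ω) (i j : Fin n) : DifferentiableAt ℝ (logPd (diagOf g) i j) x :=
  differentiableAt_of_contDiffOn (hg.contDiffOn_logPd i j) hg.isOpen hx

lemma riemann_distinct (hx : x ∈ Ω) {i j k : Fin n} (hij : i ≠ j) (hik : i ≠ k) (hjk : j ≠ k) :
    riemann g i k i j x = -(1 / 2) * pd j (logPd (diagOf g) i k) x +
      (1 / 4) * (logPd (diagOf g) i j x * logPd (diagOf g) j k x +
        logPd (diagOf g) i k x * logPd (diagOf g) k j x -
        logPd (diagOf g) i j x * logPd (diagOf g) i k x) := by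
  have h1 : pd i (christoffel g i j k) x = 0 :=
    pd_eq_zero_of_eqOn hg.isOpen hx
      (fun y hy => hg.christoffel_distinct hy hjk (Ne.symm hij) (Ne.symm hik)) i
  have h2 : pd j (christoffel g i i k) x = (1 / 2) * pd j (logPd (diagOf g) i k) x := by
    rw [pd_congr_on hg.isOpen hx (fun y hy => hg.christoffel_left hy i k),
      pd_const_mul _ (hg.diff_logPd hx i k)]
  have h3 : ∀ m, christoffel g i i m x * christoffel g m j k x -
      christoffel g i j m x * christoffel g m i k x =
      (if m = i then -(1 / 4) * (logPd (diagOf g) i j x * logPd (diagOf g) i k x) else 0) +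
      (if m = j then (1 / 4) * (logPd (diagOf g) i j x * logPd (diagOf g) j k x) else 0) +
      (if m = k then (1 / 4) * (logPd (diagOf g) i k x * logPd (diagOf g) k j x) else 0) := by
    intro m
    by_cases hmi : m = i
    · subst hmi
      rw [if_pos rfl, if_neg hij, if_neg hik, hg.christoffel_right hx m j, hg.christoffel_left hx m k,
        hg.christoffel_distinct hx hjk (Ne.symm hij) (Ne.symm hik)]
      ring
    by_cases hmj : m = j
    · subst hmj
      rw [if_neg hmi, if_pos rfl, if_neg hjk, hg.christoffel_left hx, hg.christoffel_left hx,
        hg.christoffel_distinct hx hik hij (Ne.symm hjk)]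
      ring
    rw [hg.christoffel_left hx, hg.christoffel_distinct hx (Ne.symm hmj) (Ne.symm hij) hmi]
    by_cases hmk : m = k
    · subst hmk
      rw [if_neg hmi, if_neg hmj, if_pos rfl, hg.christoffel_right hx]
      ring
    · rw [if_neg hmi, if_neg hmj, if_neg hmk,
        hg.christoffel_distinct hx hjk (Ne.symm hmj) (Ne.symm hmk)]
      ring
  rw [riemann, h1, h2, Finset.sum_congr rfl fun m _ => h3 m]
  simp only [Finset.sum_add_distrib, Finset.sum_ite_eq', Finset.mem_univ, if_true]
  ring

/-- The factor −4/gⱼⱼ makes this component symmetric in i and j, in the form of the field `gauss` of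
`SepSystem`. -/
lemma riemann_pair (hx : x ∈ Ω) {i j : Fin n} (hij : i ≠ j) :
    riemann g i j i j x * (-4 * (g x j j)⁻¹) =
      (g x j j)⁻¹ * (2 * pd j (logPd (diagOf g) i j) x + logPd (diagOf g) i j x ^ 2
        - logPd (diagOf g) i j x * logPd (diagOf g) j j x)
      + (g x i i)⁻¹ * (2 * pd i (logPd (diagOf g) j i) x + logPd (diagOf g) j i x ^ 2
        - logPd (diagOf g) j i x * logPd (diagOf g) i i x)
      + ∑ k ∈ {k | k ≠ i ∧ k ≠ j},
          (g x k k)⁻¹ * (logPd (diagOf g) i k x * logPd (diagOf g) j k x) := by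
  have n1 := hg.ne_zero i x hx
  have n2 := hg.ne_zero j x hx
  have h1 : pd i (christoffel g i j j) x = -(1 / 2) * ((g x i i)⁻¹ * g x j j *
      (pd i (logPd (diagOf g) j i) x + logPd (diagOf g) j i x ^ 2
        - logPd (diagOf g) i i x * logPd (diagOf g) j i x)) := by
    have dinv : DifferentiableAt ℝ (fun y => (g y i i)⁻¹) x := (hg.diff hx i).fun_inv n1
    rw [pd_congr_on hg.isOpen hx (fun y hy => hg.christoffel_diag hy (Ne.symm hij)),
      pd_const_mul _ ((dinv.fun_mul (hg.diff hx j)).fun_mul (hg.diff_logPd hx j i)),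
      pd_mul (dinv.fun_mul (hg.diff hx j)) (hg.diff_logPd hx j i), pd_mul dinv (hg.diff hx j),
      pd_inv (hg.diff hx i) n1, hg.pd_diag hx, hg.pd_diag hx]
    field_simp
    ring
  have h2 : pd j (christoffel g i i j) x = (1 / 2) * pd j (logPd (diagOf g) i j) x := by
    rw [pd_congr_on hg.isOpen hx (fun y hy => hg.christoffel_left hy i j),
      pd_const_mul _ (hg.diff_logPd hx i j)]
  have h3 : ∀ m, christoffel g i i m x * christoffel g m j j x -
      christoffel g i j m x * christoffel g m i j x =
      (if m = i then -(1 / 4) * ((g x i i)⁻¹ * g x j j * (logPd (diagOf g) i i x *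
        logPd (diagOf g) j i x) + logPd (diagOf g) i j x ^ 2) else 0) +
      (if m = j then (1 / 4) * (logPd (diagOf g) i j x * logPd (diagOf g) j j x +
        (g x i i)⁻¹ * g x j j * logPd (diagOf g) j i x ^ 2) else 0) +
      (if m ≠ i ∧ m ≠ j then -(1 / 4) * g x j j * ((g x m m)⁻¹ * (logPd (diagOf g) i m x *
        logPd (diagOf g) j m x)) else 0) := by
    intro m
    by_cases hmi : m = i
    · subst hmi
      rw [if_pos rfl, if_neg hij, if_neg (by tauto), hg.christoffel_right hx m j,
        hg.christoffel_left hx m j, hg.christoffel_left hx m m,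
        hg.christoffel_diag hx (Ne.symm hij)]
      ring
    by_cases hmj : m = j
    · subst hmj
      rw [if_neg hmi, if_pos rfl, if_neg (by tauto), hg.christoffel_left hx,
        hg.christoffel_left hx, hg.christoffel_diag hx hmi, hg.christoffel_right hx]
      ring
    · rw [if_neg hmi, if_neg hmj, if_pos ⟨hmi, hmj⟩, hg.christoffel_left hx,
        hg.christoffel_diag hx (Ne.symm hmj),
        hg.christoffel_distinct hx (Ne.symm hmj) (Ne.symm hij) hmi]
      ring
  rw [riemann, h1, h2, Finset.sum_congr rfl fun m _ => h3 m]
  simp only [Finset.sum_add_distrib, Finset.sum_ite_eq', Finset.mem_univ, if_true]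
  rw [← Finset.sum_filter, ← Finset.mul_sum]
  field_simp
  ring

/-! #### Diagonal tensors -/

variable {m : Fin n → (Fin n → ℝ) → ℝ}

lemma covDeriv_same (hT : ∀ x ∈ Ω, ∀ i j, T x i j = if i = j then m i x * g x i i else 0)
    (hx : x ∈ Ω) (hm : ∀ i, DifferentiableAt ℝ (m i) x) (k i : Fin n) :
    covDeriv g T k i i x = pd k (m i) x * g x i i := by
  rw [covDeriv, pd_congr_on hg.isOpen hx (fun y hy => hT y hy i i)]
  simp only [if_true]
  rw [pd_mul (hm i) (hg.diff hx i), hg.pd_diag hx, Finset.sum_eq_single i, Finset.sum_eq_single i]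
  · rw [hT x hx, if_pos rfl, hg.christoffel_right hx]; ring
  · intro l _ hl; rw [hT x hx, if_neg (Ne.symm hl), mul_zero]
  · simp
  · intro l _ hl; rw [hT x hx, if_neg hl, mul_zero]
  · simp

lemma covDeriv_ne (hT : ∀ x ∈ Ω, ∀ i j, T x i j = if i = j then m i x * g x i i else 0)
    (hx : x ∈ Ω) (k : Fin n) {i j : Fin n} (hij : i ≠ j) :
    covDeriv g T k i j x = -(christoffel g j k i x * (m j x * g x j j))
      - christoffel g i k j x * (m i x * g x i i) := by
  rw [covDeriv, pd_eq_zero_of_eqOn hg.isOpen hx (fun y hy => by rw [hT y hy i j, if_neg hij]),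
    Finset.sum_eq_single j, Finset.sum_eq_single i]
  · rw [hT x hx, if_pos rfl, hT x hx, if_pos rfl]; ring
  · intro l _ hl; rw [hT x hx, if_neg (Ne.symm hl), mul_zero]
  · simp
  · intro l _ hl; rw [hT x hx, if_neg hl, mul_zero]
  · simp

lemma covDeriv_left (hT : ∀ x ∈ Ω, ∀ i j, T x i j = if i = j then m i x * g x i i else 0)
    (hx : x ∈ Ω) {i j : Fin n} (hij : i ≠ j) :
    covDeriv g T i i j x = (1 / 2) * (logPd (diagOf g) i j x * g x i i * (m j x - m i x)) := by
  have := hg.ne_zero j x hx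
  rw [hg.covDeriv_ne hT hx i hij, hg.christoffel_diag hx hij, hg.christoffel_left hx]
  field_simp

lemma covDeriv_right (hT : ∀ x ∈ Ω, ∀ i j, T x i j = if i = j then m i x * g x i i else 0)
    (hx : x ∈ Ω) {i j : Fin n} (hij : i ≠ j) :
    covDeriv g T j i j x = (1 / 2) * (logPd (diagOf g) j i x * g x j j * (m i x - m j x)) := by
  have := hg.ne_zero i x hx
  rw [hg.covDeriv_ne hT hx j hij, hg.christoffel_diag hx (Ne.symm hij), hg.christoffel_left hx]
  field_simp
  ring

lemma covDeriv_distinct (hT : ∀ x ∈ Ω, ∀ i j, T x i j = if i = j then m i x * g x i i else 0)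
    (hx : x ∈ Ω) {i j k : Fin n} (hij : i ≠ j) (hik : i ≠ k) (hjk : j ≠ k) :
    covDeriv g T k i j x = 0 := by
  rw [hg.covDeriv_ne hT hx k hij, hg.christoffel_distinct hx (Ne.symm hik) (Ne.symm hjk) hij,
    hg.christoffel_distinct hx (Ne.symm hjk) (Ne.symm hik) (Ne.symm hij)]
  ring

/-- The equations of a concircular tensor which is diagonal in orthogonal coordinates. -/
lemma concircular_of_diag (hT : ∀ x ∈ Ω, ∀ i j, T x i j = if i = j then m i x * g x i i else 0)
    (hx : x ∈ Ω) (hm : ∀ i, DifferentiableAt ℝ (m i) x)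
    (h0 : ∀ i k, i ≠ k → pd k (m i) x = 0)
    (h1 : ∀ i j, i ≠ j → pd j (m j) x = (m j x - m i x) * logPd (diagOf g) i j x) (i j k : Fin n) :
    covDeriv g T k i j x = (1 / 2) * (pd i (m i) x * g x j k + pd j (m j) x * g x i k) := by
  by_cases hij : i = j
  · subst hij
    rw [hg.covDeriv_same hT hx hm]
    by_cases hik : i = k
    · subst hik; ring
    · rw [h0 i k hik, hg.off_diag x hx i k hik]; ring
  by_cases hik : i = k
  · subst hik
    rw [hg.covDeriv_left hT hx hij, hg.off_diag x hx j i (Ne.symm hij), h1 i j hij]; ring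
  by_cases hjk : j = k
  · subst hjk
    rw [hg.covDeriv_right hT hx hij, hg.off_diag x hx i j hij, h1 j i (Ne.symm hij)]; ring
  rw [hg.covDeriv_distinct hT hx hij hik hjk, hg.off_diag x hx i k hik, hg.off_diag x hx j k hjk]
  ring

/-- The components with equal tensor indices give ∂ₖmᵢ = 0 for k ≠ i and αⱼ = ∂ⱼmⱼ; the component
∇ᵢTᵢⱼ then expresses αⱼ through the difference of eigenvalues. -/
lemma diag_of_concircular
    (hT : ∀ x ∈ Ω, ∀ i j, T x i j = if i = j then m i x * g x i i else 0)
    (hx : x ∈ Ω) (hm : ∀ i, DifferentiableAt ℝ (m i) x) {α : Fin n → ℝ}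
    (hα : ∀ i j k, covDeriv g T k i j x = (1 / 2) * (α i * g x j k + α j * g x i k)) :
    (∀ i k, i ≠ k → pd k (m i) x = 0) ∧
    ∀ i j, i ≠ j → pd j (m j) x = (m j x - m i x) * logPd (diagOf g) i j x := by
  have e1 : ∀ i k, pd k (m i) x * g x i i = α i * g x i k := by
    intro i k
    rw [← hg.covDeriv_same hT hx hm, hα]; ring
  constructor
  · intro i k hik
    have := e1 i k
    rw [hg.off_diag x hx i k hik, mul_zero] at this
    exact (mul_eq_zero.1 this).resolve_right (hg.ne_zero i x hx)
  · intro i j hij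
    have h2 := mul_right_cancel₀ (hg.ne_zero j x hx) (e1 j j)
    have h3 := hα i j i
    rw [hg.covDeriv_left hT hx hij, hg.off_diag x hx j i (Ne.symm hij)] at h3
    rw [h2]
    apply mul_right_cancel₀ (hg.ne_zero i x hx)
    linear_combination -2 * h3

/-! #### The Levi-Civita separability conditions -/

/-- For a diagonal tensor the Killing equation reads ∂_b mₐ = (mₐ − m_b)a_{ab}, including the case a
= b. Equality of the mixed second derivatives of mₖ is the claim multiplied by mⱼ − mᵢ, which is
nonzero as the eigenvalues are distinct. -/
lemma levi_civita_of_killing (hmI : ∀ x ∈ Ω, Function.Injective fun i => m i x)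
    (hms : ∀ i, ContDiffOn ℝ ∞ (m i) Ω)
    (hT : ∀ x ∈ Ω, ∀ i j, T x i j = if i = j then m i x * g x i i else 0)
    (hK : ∀ x ∈ Ω, ∀ i j k, covDeriv g T i j k x + covDeriv g T j k i x + covDeriv g T k i j x = 0)
    {i j : Fin n} (hij : i ≠ j) (k : Fin n) (hx : x ∈ Ω) :
    pd j (logPd (diagOf g) k i) x = logPd (diagOf g) k i x * logPd (diagOf g) k j x
      - logPd (diagOf g) j i x * logPd (diagOf g) k j x
      - logPd (diagOf g) i j x * logPd (diagOf g) k i x := by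
  have hmd : ∀ i, ∀ x ∈ Ω, DifferentiableAt ℝ (m i) x := fun i x hx =>
    differentiableAt_of_contDiffOn (hms i) hg.isOpen hx
  have D : ∀ a b, ∀ x ∈ Ω, pd b (m a) x = (m a x - m b x) * logPd (diagOf g) a b x := by
    intro a b x hx
    apply mul_right_cancel₀ (hg.ne_zero a x hx)
    by_cases hab : a = b
    · subst hab
      have := hK x hx a a a
      rw [hg.covDeriv_same hT hx fun i => hmd i x hx] at this
      linear_combination (1 / 3) * this
    · have := hK x hx b a a
      rw [hg.covDeriv_same hT hx fun i => hmd i x hx, hg.covDeriv_left hT hx hab,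
        hg.covDeriv_right hT hx (Ne.symm hab)] at this
      linear_combination this
  have hc := pd_comm (hms k) hg.isOpen hx j i
  rw [pd_congr_on hg.isOpen hx (D k i), pd_congr_on hg.isOpen hx (D k j),
    pd_mul ((hmd k x hx).fun_sub (hmd i x hx)) (hg.diff_logPd hx k i),
    pd_mul ((hmd k x hx).fun_sub (hmd j x hx)) (hg.diff_logPd hx k j),
    pd_sub (hmd k x hx) (hmd i x hx), pd_sub (hmd k x hx) (hmd j x hx), D k j x hx, D k i x hx,
    D i j x hx, D j i x hx,
    show pd i (logPd (diagOf g) k j) x = pd j (logPd (diagOf g) k i) x from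
      pd_comm ((hg.smooth k).log fun x hx => hg.ne_zero k x hx) hg.isOpen hx i j] at hc
  have hne : m j x - m i x ≠ 0 := fun h0 => hij ((hmI x hx) (sub_eq_zero.1 h0)).symm
  apply mul_left_cancel₀ hne
  linear_combination hc

/-- The equations for separable coordinates on a space of constant curvature. -/
lemma sepSystem
    (hlc : ∀ x ∈ Ω, ∀ i j, i ≠ j → ∀ k, pd j (logPd (diagOf g) k i) x =
      logPd (diagOf g) k i x * logPd (diagOf g) k j x
      - logPd (diagOf g) j i x * logPd (diagOf g) k j x
      - logPd (diagOf g) i j x * logPd (diagOf g) k i x)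
    (hcurv : ∀ x ∈ Ω, ∀ l k i j, riemann g l k i j x =
      κ * (g x j k * (1 : Matrix (Fin n) (Fin n) ℝ) l i
        - g x i k * (1 : Matrix (Fin n) (Fin n) ℝ) l j)) :
    SepSystem κ (diagOf g) Ω := by
  have hR : ∀ i j k, i ≠ j → i ≠ k → j ≠ k → ∀ x ∈ Ω,
      2 * pd j (logPd (diagOf g) i k) x = logPd (diagOf g) i j x * logPd (diagOf g) j k x +
        logPd (diagOf g) i k x * logPd (diagOf g) k j x -
        logPd (diagOf g) i j x * logPd (diagOf g) i k x := by
    intro i j k hij hik hjk x hx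
    have := hcurv x hx i k i j
    rw [hg.riemann_distinct hx hij hik hjk, hg.off_diag x hx j k hjk,
      hg.off_diag x hx i k hik] at this
    linear_combination -4 * this
  -- The Levi-Civita condition and the curvature equation contain the same quadratic expression with
  -- opposite signs; adding them leaves three times the mixed derivative. The quadratic relation is
  -- then the Levi-Civita condition with this derivative dropped.
  have h0 : ∀ i j k, i ≠ j → i ≠ k → j ≠ k → ∀ x ∈ Ω, pd k (logPd (diagOf g) i j) x = 0 := by
    intro i j k hij hik hjk x hx
    have h1 := hR i k j hik hij (Ne.symm hjk) x hx
    have h2 := hlc x hx j k hjk i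
    linear_combination (1 / 3) * h1 + (1 / 3) * h2
  refine ⟨hg.isOpen, hg.smooth, hg.ne_zero, h0, ?_, ?_, ?_⟩
  · intro i j k hij hik hjk x hx
    have h1 := h0 k i j (Ne.symm hik) (Ne.symm hjk) hij x hx
    have h2 := hlc x hx i j hij k
    linear_combination h1 - h2
  · intro i j hij x hx
    have h2 := hlc x hx j i (Ne.symm hij) i
    linear_combination h2
  · intro i j hij x hx
    have h1 := hg.riemann_pair hx hij
    rw [hcurv x hx i j i j, hg.off_diag x hx i j hij] at h1
    have n2 := hg.ne_zero j x hx
    simp only [diagOf] at h1 ⊢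
    rw [← h1]
    simp
    field_simp

end OrthMetric

end Orthogonal

end KEM

end

noncomputable section

namespace KEM

/-! ### Separability of the Hamilton–Jacobi equation -/

section HamiltonJacobi

variable {n : ℕ}

lemma contDiffOn_deriv_fst {W : ℝ → (Fin n → ℝ) → ℝ} {I : Set ℝ} {C : Set (Fin n → ℝ)}
    (hI : IsOpen I) (hC : IsOpen C)
    (hW : ContDiffOn ℝ ∞ (fun q : ℝ × (Fin n → ℝ) => W q.1 q.2) (I ×ˢ C)) :
    ContDiffOn ℝ ∞ (fun q : ℝ × (Fin n → ℝ) => deriv (fun t => W t q.2) q.1) (I ×ˢ C) := by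
  have ho : IsOpen (I ×ˢ C) := hI.prod hC
  have h1 : ContDiffOn ℝ ∞ (fun q : ℝ × (Fin n → ℝ) =>
      fderiv ℝ (fun q : ℝ × (Fin n → ℝ) => W q.1 q.2) q (1, 0)) (I ×ˢ C) :=
    (hW.fderiv_of_isOpen ho (by simp)).clm_apply contDiffOn_const
  refine h1.congr fun q hq => ?_
  have h2 : DifferentiableAt ℝ (fun q : ℝ × (Fin n → ℝ) => W q.1 q.2) q :=
    (hW.contDiffAt (ho.mem_nhds hq)).differentiableAt (by simp)
  have h3 : HasDerivAt (fun t : ℝ => (t, q.2)) ((1 : ℝ), (0 : Fin n → ℝ)) q.1 :=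
    (hasDerivAt_id q.1).prodMk (hasDerivAt_const _ _)
  exact (h2.hasFDerivAt.comp_hasDerivAt q.1 h3).deriv

/-- If a sum `∑ᵢ Gᵢ(x) sᵢ(xᵢ)` is constant, the `sᵢ` satisfy linear relations in terms of the
derivatives of the `Gᵢ`. -/
lemma sum_coeff_eq_zero {V : Set (Fin n → ℝ)} (hV : IsOpen V) {G : Fin n → (Fin n → ℝ) → ℝ}
    (hG : ∀ i, ContDiffOn ℝ ∞ (G i) V) (hG0 : ∀ i, ∀ x ∈ V, G i x ≠ 0) {s : Fin n → ℝ → ℝ}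
    (hs : ∀ i, ContDiffOn ℝ ∞ (s i) ((fun x : Fin n → ℝ => x i) '' V)) {E : ℝ}
    (hsum : ∀ x ∈ V, ∑ i, G i x * s i (x i) = E) {j k : Fin n} (hjk : j ≠ k) {x : Fin n → ℝ}
    (hx : x ∈ V) :
    ∑ i, (pd k (pd j (G i)) x - pd k (G j) x / G j x * pd j (G i) x -
      pd j (G k) x / G k x * pd k (G i) x) * s i (x i) = 0 := by
  have hI : ∀ i, IsOpen ((fun x : Fin n → ℝ => x i) '' V) := fun i => isOpenMap_eval i V hV
  have hs' : ∀ i, ContDiffOn ℝ ∞ (deriv (s i)) ((fun x : Fin n → ℝ => x i) '' V) := fun i =>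
    (hs i).deriv_of_isOpen (hI i) (by simp)
  have lift : ∀ {f : ℝ → ℝ} {i : Fin n}, ContDiffOn ℝ ∞ f ((fun x : Fin n → ℝ => x i) '' V) →
      ContDiffOn ℝ ∞ (fun x : Fin n → ℝ => f (x i)) V := fun hf =>
    hf.comp (contDiff_apply ℝ ℝ _).contDiffOn fun x hx => ⟨x, hx, rfl⟩
  have hd : ∀ {f : (Fin n → ℝ) → ℝ}, ContDiffOn ℝ ∞ f V → ∀ x ∈ V, DifferentiableAt ℝ f x :=
    fun hf x hx => differentiableAt_of_contDiffOn hf hV hx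
  have hpd : ∀ {f : ℝ → ℝ} {i : Fin n}, ContDiffOn ℝ ∞ f ((fun x : Fin n → ℝ => x i) '' V) →
      ∀ k, ∀ x ∈ V, pd k (fun x : Fin n → ℝ => f (x i)) x = if k = i then deriv f (x i) else 0 := by
    intro f i hf k x hx
    have h1 := hasDerivAt_line (hd (lift hf) x hx) k
    split_ifs with hki
    · subst hki
      simp only [Function.update_self] at h1
      exact h1.deriv.symm
    · simp only [Function.update_of_ne (Ne.symm hki)] at h1
      exact h1.unique (hasDerivAt_const _ _)
  have first : ∀ l, ∀ x ∈ V, ∑ i, pd l (G i) x * s i (x i) + G l x * deriv (s l) (x l) = 0 := by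
    intro l x hx
    have h1 := pd_congr_on hV hx hsum l
    rw [pd_const, pd_sum (fun i _ => (hd (hG i) x hx).fun_mul (hd (lift (hs i)) x hx))] at h1
    rw [← h1, Finset.sum_congr rfl fun i _ => pd_mul (hd (hG i) x hx) (hd (lift (hs i)) x hx) l,
      Finset.sum_add_distrib]
    congr 1
    simp [hpd (hs _) l x hx]
  have hGp : ∀ i l, ContDiffOn ℝ ∞ (pd l (G i)) V := fun i l => contDiffOn_pd (hG i) hV l
  have second : ∑ i, pd k (pd j (G i)) x * s i (x i) + pd j (G k) x * deriv (s k) (x k)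
      + pd k (G j) x * deriv (s j) (x j) = 0 := by
    have h1 := pd_congr_on hV hx (first j) k
    rw [pd_const, pd_add, pd_sum (fun i _ => (hd (hGp i j) x hx).fun_mul (hd (lift (hs i)) x hx)),
      pd_mul (hd (hG j) x hx) (hd (lift (hs' j)) x hx), hpd (hs' j) k x hx, if_neg (Ne.symm hjk),
      Finset.sum_congr rfl fun i _ => pd_mul (hd (hGp i j) x hx) (hd (lift (hs i)) x hx) k,
      Finset.sum_add_distrib] at h1
    · have h2 : ∑ i, pd j (G i) x * pd k (fun x : Fin n → ℝ => s i (x i)) x =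
          pd j (G k) x * deriv (s k) (x k) := by
        simp [hpd (hs _) k x hx]
      rw [h2] at h1
      linear_combination h1
    · exact DifferentiableAt.fun_sum fun i _ => (hd (hGp i j) x hx).fun_mul (hd (lift (hs i)) x hx)
    · exact (hd (hG j) x hx).fun_mul (hd (lift (hs' j)) x hx)
  -- Since Gⱼ and Gₖ do not vanish, the first-order relations determine sⱼ' and sₖ'. Substituting
  -- them in the second-order relation leaves only undifferentiated sᵢ.
  have e1 := first j x hx
  have e2 := first k x hx
  have n1 := hG0 j x hx
  have n2 := hG0 k x hx
  have h3 : ∑ i, (pd k (pd j (G i)) x - pd k (G j) x / G j x * pd j (G i) x -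
      pd j (G k) x / G k x * pd k (G i) x) * s i (x i) = ∑ i, pd k (pd j (G i)) x * s i (x i)
      - pd k (G j) x / G j x * ∑ i, pd j (G i) x * s i (x i)
      - pd j (G k) x / G k x * ∑ i, pd k (G i) x * s i (x i) := by
    rw [Finset.mul_sum, Finset.mul_sum, ← Finset.sum_sub_distrib, ← Finset.sum_sub_distrib]
    exact Finset.sum_congr rfl fun i _ => by ring
  rw [h3]
  have d1 : deriv (s j) (x j) = -(∑ i, pd j (G i) x * s i (x i)) / G j x := by
    field_simp; linear_combination e1
  have d2 : deriv (s k) (x k) = -(∑ i, pd k (G i) x * s i (x i)) / G k x := by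
    field_simp; linear_combination e2
  rw [d1, d2] at second
  linear_combination second

/-- The Levi-Civita separability conditions. -/
lemma OrthMetric.levi_civita_of_separable {g : (Fin n → ℝ) → Matrix (Fin n) (Fin n) ℝ}
    {V C : Set (Fin n → ℝ)} (hg : OrthMetric g V) {W : Fin n → ℝ → (Fin n → ℝ) → ℝ}
    {E : (Fin n → ℝ) → ℝ} (hC : IsOpen C) (hCn : C.Nonempty)
    (hW : ∀ i, ContDiffOn ℝ ∞ (fun q : ℝ × (Fin n → ℝ) => W i q.1 q.2)
      (((fun x : Fin n → ℝ => x i) '' V) ×ˢ C))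
    (hHJ : ∀ x ∈ V, ∀ c ∈ C, (1 / 2) * ∑ i, ∑ j, (g x)⁻¹ i j *
      deriv (fun t => W i t c) (x i) * deriv (fun t => W j t c) (x j) = E c)
    (hdet : ∀ x ∈ V, ∀ c ∈ C,
      (Matrix.of fun i j => pd j (fun c' => deriv (fun t => W i t c') (x i)) c).det ≠ 0)
    {i j : Fin n} (hij : i ≠ j) (k : Fin n) {x : Fin n → ℝ} (hx : x ∈ V) :
    pd j (logPd (diagOf g) k i) x = logPd (diagOf g) k i x * logPd (diagOf g) k j x
      - logPd (diagOf g) j i x * logPd (diagOf g) k j x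
      - logPd (diagOf g) i j x * logPd (diagOf g) k i x := by
  have hV := hg.isOpen
  have hI : ∀ i, IsOpen ((fun x : Fin n → ℝ => x i) '' V) := fun i => isOpenMap_eval i V hV
  let P : Fin n → ℝ → (Fin n → ℝ) → ℝ := fun i t c => deriv (fun t => W i t c) t
  have hP : ∀ i, ContDiffOn ℝ ∞ (fun q : ℝ × (Fin n → ℝ) => P i q.1 q.2)
      (((fun x : Fin n → ℝ => x i) '' V) ×ˢ C) := fun i => contDiffOn_deriv_fst (hI i) hC (hW i)
  let G : Fin n → (Fin n → ℝ) → ℝ := fun i x => (g x i i)⁻¹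
  have hGs : ∀ i, ContDiffOn ℝ ∞ (G i) V := fun i => (hg.smooth i).inv fun x hx => hg.ne_zero i x hx
  have hG0 : ∀ i, ∀ x ∈ V, G i x ≠ 0 := fun i x hx => inv_ne_zero (hg.ne_zero i x hx)
  -- The coefficients of the resulting linear relation among the squares of the momenta; they do not
  -- depend on the parameters c.
  let co : Fin n → ℝ := fun l => pd j (pd i (G l)) x - pd j (G i) x / G i x * pd i (G l) x -
    pd i (G j) x / G j x * pd j (G l) x
  have hsum : ∀ c ∈ C, ∑ l, co l * P l (x l) c ^ 2 = 0 := by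
    intro c hc
    refine sum_coeff_eq_zero hV hGs hG0 (s := fun l t => P l t c ^ 2) (E := 2 * E c) ?_ ?_ hij hx
    · intro l
      have : ContDiffOn ℝ ∞ (fun t => P l t c) ((fun x : Fin n → ℝ => x l) '' V) :=
        (hP l).comp (contDiff_id.prodMk contDiff_const).contDiffOn fun t ht => ⟨ht, hc⟩
      exact this.pow 2
    · intro z hz
      rw [← hHJ z hz c hc, hg.inv_eq hz]
      have : ∀ l, ∑ m, (Matrix.diagonal fun i => (g z i i)⁻¹) l m *
          deriv (fun t => W l t c) (z l) * deriv (fun t => W m t c) (z m) =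
          G l z * P l (z l) c ^ 2 := by
        intro l
        rw [Finset.sum_eq_single l]
        · simp [G, P]; ring
        · intro m _ hm; simp [Matrix.diagonal_apply_ne _ (Ne.symm hm)]
        · simp
      simp_rw [this]
      ring
  have hPd : ∀ l, ∀ c ∈ C, DifferentiableAt ℝ (fun c => P l (x l) c) c := by
    intro l c hc
    have : ContDiffOn ℝ ∞ (fun c => P l (x l) c) C :=
      (hP l).comp (contDiff_const.prodMk contDiff_id).contDiffOn fun c hc => ⟨⟨x, hx, rfl⟩, hc⟩
    exact differentiableAt_of_contDiffOn this hC hc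
  -- Differentiating ∑ co l · Pₗ² = 0 in the parameters multiplies the row vector (2 co l · Pₗ) by
  -- the matrix ∂Pₗ/∂cₘ, which is invertible.
  have hcoP : ∀ c ∈ C, ∀ l, co l * P l (x l) c = 0 := by
    intro c hc
    have hv : (fun l => 2 * (co l * P l (x l) c)) = 0 := by
      refine Matrix.eq_zero_of_vecMul_eq_zero (hdet x hx c hc) ?_
      ext m
      have h1 := pd_congr_on hC hc hsum m
      rw [pd_const, pd_sum (fun l _ => ((hPd l c hc).fun_pow 2).const_mul (co l))] at h1
      rw [Pi.zero_apply, ← h1]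
      simp only [Matrix.vecMul, dotProduct, Matrix.of_apply]
      refine Finset.sum_congr rfl fun l _ => ?_
      rw [pd_const_mul _ ((hPd l c hc).fun_pow 2)]
      have h2 : pd m (fun c => P l (x l) c ^ 2) c = 2 * P l (x l) c * pd m (fun c => P l (x l) c) c := by
        simp_rw [pow_two]
        rw [pd_mul (hPd l c hc) (hPd l c hc)]; ring
      rw [h2]; ring
    intro l
    have := congrFun hv l
    simp only [Pi.zero_apply] at this
    linarith
  -- Otherwise Pₖ would vanish for all parameters, and the matrix ∂Pₗ/∂cₘ would have a zero row.
  have hco : co k = 0 := by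
    by_contra hne
    obtain ⟨c, hc⟩ := hCn
    refine hdet x hx c hc (Matrix.det_eq_zero_of_row_eq_zero k fun m => ?_)
    exact pd_eq_zero_of_eqOn hC hc
      (fun c' hc' => (mul_eq_zero.1 (hcoP c' hc' k)).resolve_left hne) m
  have hpdG : ∀ a b, ∀ z ∈ V, pd b (G a) z = (-1) * (logPd (diagOf g) a b z * G a z) := by
    intro a b z hz
    have n0 := hg.ne_zero a z hz
    rw [pd_inv (hg.diff hz a) n0, hg.pd_diag hz]
    simp only [G]; field_simp
  have hdG : DifferentiableAt ℝ (G k) x := differentiableAt_of_contDiffOn (hGs k) hV hx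
  simp only [co] at hco
  rw [pd_congr_on hV hx (hpdG k i), pd_const_mul _ ((hg.diff_logPd hx k i).fun_mul hdG),
    pd_mul (hg.diff_logPd hx k i) hdG, hpdG k j x hx, hpdG k i x hx, hpdG i j x hx,
    hpdG j i x hx] at hco
  have n1 := hG0 i x hx
  have n2 := hG0 j x hx
  apply mul_right_cancel₀ (hG0 k x hx)
  field_simp at hco
  linear_combination -hco

end HamiltonJacobi

end KEM

end

noncomputable section

namespace KEM

/-! ### Change of coordinates for the covariant derivative -/

section ChangeOfCoordinates

variable {n : ℕ}

/-- The bilinear form with matrix `A`. -/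
def bil (A : Matrix (Fin n) (Fin n) ℝ) (u v : Fin n → ℝ) : ℝ := ∑ a, ∑ b, u a * v b * A a b

variable {A : Matrix (Fin n) (Fin n) ℝ} {u v w : Fin n → ℝ}

lemma bil_add_left : bil A (u + v) w = bil A u w + bil A v w := by
  simp only [bil, ← Finset.sum_add_distrib]
  exact Finset.sum_congr rfl fun a _ => Finset.sum_congr rfl fun b _ => by simp; ring

lemma bil_add_right : bil A w (u + v) = bil A w u + bil A w v := by
  simp only [bil, ← Finset.sum_add_distrib]
  exact Finset.sum_congr rfl fun a _ => Finset.sum_congr rfl fun b _ => by simp; ring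

lemma bil_sub_left : bil A (u - v) w = bil A u w - bil A v w := by
  simp only [bil, ← Finset.sum_sub_distrib]
  exact Finset.sum_congr rfl fun a _ => Finset.sum_congr rfl fun b _ => by simp; ring

lemma bil_comm (hA : ∀ a b, A a b = A b a) : bil A u v = bil A v u := by
  unfold bil
  rw [Finset.sum_comm]
  exact Finset.sum_congr rfl fun a _ => Finset.sum_congr rfl fun b _ => by rw [hA b a]; ring

lemma bil_sum_left {ι : Type*} (s : Finset ι) (c : ι → ℝ) (U : ι → Fin n → ℝ) :
    bil A (∑ l ∈ s, c l • U l) v = ∑ l ∈ s, c l * bil A (U l) v := by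
  classical
  induction s using Finset.induction_on with
  | empty => simp [bil]
  | insert a s ha ih =>
    rw [Finset.sum_insert ha, Finset.sum_insert ha, bil_add_left, ih]
    congr 1
    simp only [bil, Finset.mul_sum]
    exact Finset.sum_congr rfl fun a _ => Finset.sum_congr rfl fun b _ => by simp; ring

lemma bil_sum_right {ι : Type*} (s : Finset ι) (c : ι → ℝ) (U : ι → Fin n → ℝ) :
    bil A v (∑ l ∈ s, c l • U l) = ∑ l ∈ s, c l * bil A v (U l) := by
  classical
  induction s using Finset.induction_on with
  | empty => simp [bil]
  | insert a s ha ih =>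
    rw [Finset.sum_insert ha, Finset.sum_insert ha, bil_add_right, ih]
    congr 1
    simp only [bil, Finset.mul_sum]
    exact Finset.sum_congr rfl fun a _ => Finset.sum_congr rfl fun b _ => by simp; ring

lemma eq_zero_of_bil_eq_zero (hA : A.det ≠ 0) {J : Fin n → Fin n → ℝ}
    (hJ : (Matrix.of fun a i => J i a).det ≠ 0) (h : ∀ m, bil A u (J m) = 0) : u = 0 := by
  have h1 : Matrix.vecMul (Matrix.vecMul u A) (Matrix.of fun a i => J i a) = 0 := by
    ext m
    rw [Pi.zero_apply, ← h m]
    simp only [Matrix.vecMul, dotProduct, Matrix.of_apply, bil, Finset.sum_mul]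
    rw [Finset.sum_comm]
    exact Finset.sum_congr rfl fun a _ => Finset.sum_congr rfl fun b _ => by ring
  exact Matrix.eq_zero_of_vecMul_eq_zero hA (Matrix.eq_zero_of_vecMul_eq_zero hJ h1)

/-- The derivative of a matrix-valued function in the direction `w`. -/
def dirDeriv (T : (Fin n → ℝ) → Matrix (Fin n) (Fin n) ℝ) (y w : Fin n → ℝ) :
    Matrix (Fin n) (Fin n) ℝ :=
  Matrix.of fun a b => ∑ c, w c * pd c (fun z => T z a b) y

/-- The Christoffel symbols as a vector-valued bilinear map. -/
def gam (g : (Fin n → ℝ) → Matrix (Fin n) (Fin n) ℝ) (y u v : Fin n → ℝ) : Fin n → ℝ :=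
  ∑ c, ∑ d, (u c * v d) • fun l => christoffel g l c d y

/-- Lowering the upper index cancels the inverse metric, so the later transformation law can be
checked without differentiating or transforming inverse matrices. -/
lemma bil_christoffel {g : (Fin n → ℝ) → Matrix (Fin n) (Fin n) ℝ} {y : Fin n → ℝ}
    (hdet : (g y).det ≠ 0) (hs : ∀ a b, g y a b = g y b a) (c d : Fin n) :
    bil (g y) (fun l => christoffel g l c d y) w = (1 / 2) * ∑ m, w m *
      (pd c (fun z => g z d m) y + pd d (fun z => g z c m) y - pd m (fun z => g z c d) y) := by
  have h1 : ∀ m, ∑ l, christoffel g l c d y * g y l m = (1 / 2) *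
      (pd c (fun z => g z d m) y + pd d (fun z => g z c m) y - pd m (fun z => g z c d) y) := by
    intro m
    set S : Fin n → ℝ := fun m =>
      pd c (fun z => g z d m) y + pd d (fun z => g z c m) y - pd m (fun z => g z c d) y with hS
    have h2 : (g y).mulVec ((g y)⁻¹.mulVec S) = S := by
      rw [Matrix.mulVec_mulVec, Matrix.mul_nonsing_inv _ (isUnit_iff_ne_zero.2 hdet),
        Matrix.one_mulVec]
    have h3 := congrFun h2 m
    show _ = (1 / 2) * S m
    rw [← h3]
    simp only [Matrix.mulVec, dotProduct, christoffel]
    rw [Finset.mul_sum]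
    refine Finset.sum_congr rfl fun l _ => ?_
    rw [hs l m]; ring
  unfold bil
  rw [Finset.sum_comm, Finset.mul_sum]
  refine Finset.sum_congr rfl fun m _ => ?_
  rw [show (1 / 2 : ℝ) * (w m * (pd c (fun z => g z d m) y + pd d (fun z => g z c m) y
    - pd m (fun z => g z c d) y)) = w m * ((1 / 2) * (pd c (fun z => g z d m) y
    + pd d (fun z => g z c m) y - pd m (fun z => g z c d) y)) by ring, ← h1 m, Finset.mul_sum]
  exact Finset.sum_congr rfl fun a _ => by ring

lemma bil_gam {g : (Fin n → ℝ) → Matrix (Fin n) (Fin n) ℝ} {y : Fin n → ℝ}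
    (hdet : (g y).det ≠ 0) (hs : ∀ a b, g y a b = g y b a) :
    bil (g y) (gam g y u v) w = (1 / 2) * (bil (dirDeriv g y u) v w + bil (dirDeriv g y v) u w
      - bil (dirDeriv g y w) u v) := by
  have h1 : bil (g y) (gam g y u v) w = ∑ c, ∑ d, ∑ m, (1 / 2) * (u c * v d * w m *
      (pd c (fun z => g z d m) y + pd d (fun z => g z c m) y - pd m (fun z => g z c d) y)) := by
    rw [gam]
    have : ∀ c, ∑ d, (u c * v d) • (fun l => christoffel g l c d y) =
        u c • ∑ d, v d • fun l => christoffel g l c d y := by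
      intro c; rw [Finset.smul_sum]
      exact Finset.sum_congr rfl fun d _ => by rw [mul_smul]
    rw [Finset.sum_congr rfl fun c _ => this c, bil_sum_left]
    refine Finset.sum_congr rfl fun c _ => ?_
    rw [bil_sum_left, Finset.mul_sum]
    refine Finset.sum_congr rfl fun d _ => ?_
    rw [bil_christoffel hdet hs, Finset.mul_sum, Finset.mul_sum, Finset.mul_sum]
    exact Finset.sum_congr rfl fun m _ => by ring
  have h2 : bil (dirDeriv g y u) v w = ∑ c, ∑ d, ∑ m, u c * v d * w m *
      pd c (fun z => g z d m) y := by
    simp only [bil, dirDeriv, Matrix.of_apply, Finset.mul_sum]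
    rw [Finset.sum_congr rfl fun d _ => Finset.sum_comm, Finset.sum_comm]
    exact Finset.sum_congr rfl fun c _ => Finset.sum_congr rfl fun d _ =>
      Finset.sum_congr rfl fun m _ => by ring
  have h3 : bil (dirDeriv g y v) u w = ∑ c, ∑ d, ∑ m, u c * v d * w m *
      pd d (fun z => g z c m) y := by
    simp only [bil, dirDeriv, Matrix.of_apply, Finset.mul_sum]
    refine Finset.sum_congr rfl fun c _ => ?_
    rw [Finset.sum_comm]
    exact Finset.sum_congr rfl fun d _ => Finset.sum_congr rfl fun m _ => by ring
  have h4 : bil (dirDeriv g y w) u v = ∑ c, ∑ d, ∑ m, u c * v d * w m *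
      pd m (fun z => g z c d) y := by
    simp only [bil, dirDeriv, Matrix.of_apply, Finset.mul_sum]
    exact Finset.sum_congr rfl fun c _ => Finset.sum_congr rfl fun d _ =>
      Finset.sum_congr rfl fun m _ => by ring
  rw [h1, h2, h3, h4]
  simp only [← Finset.sum_add_distrib, ← Finset.sum_sub_distrib, Finset.mul_sum]
  exact Finset.sum_congr rfl fun c _ => Finset.sum_congr rfl fun d _ =>
      Finset.sum_congr rfl fun m _ => by ring

lemma pd_comp {f : (Fin n → ℝ) → ℝ} {τ : (Fin n → ℝ) → Fin n → ℝ} {x : Fin n → ℝ}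
    (hf : DifferentiableAt ℝ f (τ x)) (hτ : ∀ a, DifferentiableAt ℝ (fun y => τ y a) x)
    (k : Fin n) :
    pd k (fun y => f (τ y)) x = ∑ c, pd k (fun y => τ y c) x * pd c f (τ x) := by
  have hτ' : DifferentiableAt ℝ τ x := differentiableAt_pi.2 hτ
  have h1 : fderiv ℝ (fun y => f (τ y)) x = (fderiv ℝ f (τ x)).comp (fderiv ℝ τ x) :=
    fderiv_comp x hf hτ'
  have h2 : ∀ c, pd k (fun y => τ y c) x = fderiv ℝ τ x (Pi.single k 1) c := by
    intro c
    simp only [pd]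
    rw [fderiv_apply hτ' c]
    rfl
  simp only [pd, h1, ContinuousLinearMap.comp_apply]
  have h3 : fderiv ℝ τ x (Pi.single k 1) = ∑ c, pd k (fun y => τ y c) x • Pi.single c (1 : ℝ) := by
    ext a
    simp [h2, Pi.single_apply]
  conv_lhs => rw [h3]
  simp [pd]

/-- The transformation law of the covariant derivative of a 2-tensor. -/
lemma covDeriv_change {g T g' T' : (Fin n → ℝ) → Matrix (Fin n) (Fin n) ℝ}
    {τ : (Fin n → ℝ) → Fin n → ℝ} {Ω Ω' : Set (Fin n → ℝ)} {x : Fin n → ℝ} (hΩ : IsOpen Ω)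
    (hΩ' : IsOpen Ω') (hx : x ∈ Ω) (hmap : ∀ y ∈ Ω, τ y ∈ Ω')
    (hτ : ∀ a, ContDiffOn ℝ ∞ (fun y => τ y a) Ω)
    (hg' : ∀ a b, ContDiffOn ℝ ∞ (fun y => g' y a b) Ω')
    (hT' : ∀ a b, ContDiffOn ℝ ∞ (fun y => T' y a b) Ω')
    (hsym : ∀ y ∈ Ω', ∀ a b, g' y a b = g' y b a) (hdet : (g' (τ x)).det ≠ 0)
    (hJ : (Matrix.of fun a i => pd i (fun y => τ y a) x).det ≠ 0)
    (hgg : ∀ y ∈ Ω, ∀ i j, g y i j = bil (g' (τ y)) (fun a => pd i (fun z => τ z a) y)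
      (fun a => pd j (fun z => τ z a) y))
    (hTT : ∀ y ∈ Ω, ∀ i j, T y i j = bil (T' (τ y)) (fun a => pd i (fun z => τ z a) y)
      (fun a => pd j (fun z => τ z a) y)) (k i j : Fin n) :
    covDeriv g T k i j x = ∑ c, pd k (fun y => τ y c) x *
      bil (Matrix.of fun a b => covDeriv g' T' c a b (τ x)) (fun a => pd i (fun z => τ z a) x)
      (fun a => pd j (fun z => τ z a) x) := by
  set J : Fin n → Fin n → ℝ := fun i a => pd i (fun z => τ z a) x with hJd
  set Hs : Fin n → Fin n → Fin n → ℝ := fun k i a => pd k (pd i fun z => τ z a) x with hHd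
  have hHs : ∀ k i, Hs k i = Hs i k := fun k i => funext fun a => pd_comm (hτ a) hΩ hx k i
  have hτd : ∀ a, DifferentiableAt ℝ (fun y => τ y a) x := fun a =>
    differentiableAt_of_contDiffOn (hτ a) hΩ hx
  have hJdiff : ∀ i a, DifferentiableAt ℝ (pd i fun z => τ z a) x := fun i a =>
    differentiableAt_of_contDiffOn (contDiffOn_pd (hτ a) hΩ i) hΩ hx
  -- The product and chain rule for a pulled-back tensor, used for both g and T. The terms with the
  -- second derivatives Hs are those compensated by the Christoffel symbols.
  have L1 : ∀ {S S' : (Fin n → ℝ) → Matrix (Fin n) (Fin n) ℝ},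
      (∀ a b, ContDiffOn ℝ ∞ (fun y => S' y a b) Ω') →
      (∀ y ∈ Ω, ∀ i j, S y i j = bil (S' (τ y)) (fun a => pd i (fun z => τ z a) y)
        (fun a => pd j (fun z => τ z a) y)) → ∀ k i j, pd k (fun y => S y i j) x =
      bil (dirDeriv S' (τ x) (J k)) (J i) (J j) + bil (S' (τ x)) (Hs k i) (J j)
        + bil (S' (τ x)) (J i) (Hs k j) := by
    intro S S' hS' hSS k i j
    rw [pd_congr_on hΩ hx fun y hy => hSS y hy i j]
    have hd : ∀ a b, DifferentiableAt ℝ (fun y => S' y a b) (τ x) := fun a b =>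
      differentiableAt_of_contDiffOn (hS' a b) hΩ' (hmap x hx)
    have hdc : ∀ a b, DifferentiableAt ℝ (fun y => S' (τ y) a b) x := fun a b =>
      (hd a b).comp x (differentiableAt_pi.2 hτd)
    simp only [bil]
    rw [pd_sum fun a _ => DifferentiableAt.fun_sum fun b _ =>
        ((hJdiff i a).fun_mul (hJdiff j b)).fun_mul (hdc a b), ← Finset.sum_add_distrib,
      ← Finset.sum_add_distrib]
    refine Finset.sum_congr rfl fun a _ => ?_
    rw [pd_sum fun b _ => ((hJdiff i a).fun_mul (hJdiff j b)).fun_mul (hdc a b),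
      ← Finset.sum_add_distrib, ← Finset.sum_add_distrib]
    refine Finset.sum_congr rfl fun b _ => ?_
    rw [pd_mul ((hJdiff i a).fun_mul (hJdiff j b)) (hdc a b), pd_mul (hJdiff i a) (hJdiff j b),
      pd_comp (f := fun y => S' y a b) (hd a b) hτd]
    simp only [dirDeriv, Matrix.of_apply, hJd, hHd]
    ring
  have hgx : ∀ i j, g x i j = bil (g' (τ x)) (J i) (J j) := fun i j => hgg x hx i j
  have hTx : ∀ i j, T x i j = bil (T' (τ x)) (J i) (J j) := fun i j => hTT x hx i j
  have hsx : ∀ a b, g' (τ x) a b = g' (τ x) b a := hsym (τ x) (hmap x hx)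
  have hgdet : (g x).det ≠ 0 := by
    have : g x = (Matrix.of fun a i => pd i (fun y => τ y a) x).transpose * g' (τ x) *
        Matrix.of fun a i => pd i (fun y => τ y a) x := by
      ext i j
      rw [hgx]
      simp only [Matrix.mul_apply, Matrix.transpose_apply, Matrix.of_apply, bil, Finset.sum_mul]
      rw [Finset.sum_comm]
      exact Finset.sum_congr rfl fun a _ => Finset.sum_congr rfl fun b _ => by
        simp only [hJd]; ring
    rw [this, Matrix.det_mul, Matrix.det_mul, Matrix.det_transpose]
    exact mul_ne_zero (mul_ne_zero hJ hdet) hJ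
  have hgs : ∀ a b, g x a b = g x b a := fun a b => by rw [hgx, hgx, bil_comm hsx]
  -- the Christoffel symbols
  have hΓ : ∀ k i, ∑ l, christoffel g l k i x • J l = gam g' (τ x) (J k) (J i) + Hs k i := by
    intro k i
    rw [← sub_eq_zero]
    refine eq_zero_of_bil_eq_zero hdet hJ fun m => ?_
    have e1 : bil (g' (τ x)) (∑ l, christoffel g l k i x • J l) (J m) =
        (1 / 2) * (pd k (fun z => g z i m) x + pd i (fun z => g z k m) x
          - pd m (fun z => g z k i) x) := by
      rw [bil_sum_left]
      have := bil_christoffel (w := Pi.single m 1) hgdet hgs k i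
      simp only [bil, Pi.single_apply, mul_ite, mul_one, mul_zero, ite_mul, zero_mul, one_mul,
        Finset.sum_ite_eq', Finset.mem_univ, if_true] at this
      rw [← this]
      exact Finset.sum_congr rfl fun l _ => by rw [hgx]
    show bil (g' (τ x)) _ (J m) = 0
    rw [bil_sub_left, bil_add_left, e1, bil_gam hdet hsx, L1 hg' hgg, L1 hg' hgg, L1 hg' hgg,
      hHs i k, hHs m i, hHs m k, bil_comm hsx (u := J i) (v := Hs k m),
      bil_comm hsx (u := J k) (v := Hs i m)]
    ring
  have hT1 : ∑ l, christoffel g l k i x * T x l j =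
      bil (T' (τ x)) (gam g' (τ x) (J k) (J i)) (J j) + bil (T' (τ x)) (Hs k i) (J j) := by
    rw [← bil_add_left, ← hΓ, bil_sum_left]
    exact Finset.sum_congr rfl fun l _ => by rw [hTx]
  have hT2 : ∑ l, christoffel g l k j x * T x i l =
      bil (T' (τ x)) (J i) (gam g' (τ x) (J k) (J j)) + bil (T' (τ x)) (J i) (Hs k j) := by
    rw [← bil_add_right, ← hΓ, bil_sum_right]
    exact Finset.sum_congr rfl fun l _ => by rw [hTx]
  rw [covDeriv, L1 hT' hTT, hT1, hT2]
  have r1 : bil (T' (τ x)) (gam g' (τ x) (J k) (J i)) (J j) = ∑ c, J k c * ∑ a, ∑ b,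
      J i a * J j b * ∑ l, christoffel g' l c a (τ x) * T' (τ x) l b := by
    rw [gam]
    have : ∀ c, ∑ d, (J k c * J i d) • (fun l => christoffel g' l c d (τ x)) =
        J k c • ∑ d, J i d • fun l => christoffel g' l c d (τ x) := by
      intro c; rw [Finset.smul_sum]
      exact Finset.sum_congr rfl fun d _ => by rw [mul_smul]
    rw [Finset.sum_congr rfl fun c _ => this c, bil_sum_left]
    refine Finset.sum_congr rfl fun c _ => ?_
    congr 1
    rw [bil_sum_left]
    refine Finset.sum_congr rfl fun a _ => ?_
    simp only [bil, Finset.mul_sum]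
    rw [Finset.sum_comm]
    exact Finset.sum_congr rfl fun b _ => Finset.sum_congr rfl fun l _ => by ring
  have r2 : bil (T' (τ x)) (J i) (gam g' (τ x) (J k) (J j)) = ∑ c, J k c * ∑ a, ∑ b,
      J i a * J j b * ∑ l, christoffel g' l c b (τ x) * T' (τ x) a l := by
    rw [gam]
    have : ∀ c, ∑ d, (J k c * J j d) • (fun l => christoffel g' l c d (τ x)) =
        J k c • ∑ d, J j d • fun l => christoffel g' l c d (τ x) := by
      intro c; rw [Finset.smul_sum]
      exact Finset.sum_congr rfl fun d _ => by rw [mul_smul]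
    rw [Finset.sum_congr rfl fun c _ => this c, bil_sum_right]
    refine Finset.sum_congr rfl fun c _ => ?_
    congr 1
    rw [bil_sum_right, Finset.sum_comm]
    refine Finset.sum_congr rfl fun b _ => ?_
    simp only [bil, Finset.mul_sum]
    exact Finset.sum_congr rfl fun a _ => Finset.sum_congr rfl fun l _ => by ring
  have r3 : bil (dirDeriv T' (τ x) (J k)) (J i) (J j) = ∑ c, J k c * ∑ a, ∑ b,
      J i a * J j b * pd c (fun z => T' z a b) (τ x) := by
    simp only [bil, dirDeriv, Matrix.of_apply, Finset.mul_sum]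
    rw [Finset.sum_congr rfl fun a _ => Finset.sum_comm, Finset.sum_comm]
    exact Finset.sum_congr rfl fun c _ => Finset.sum_congr rfl fun a _ =>
      Finset.sum_congr rfl fun b _ => by ring
  have r4 : ∀ c, bil (Matrix.of fun a b => covDeriv g' T' c a b (τ x)) (J i) (J j) =
      ∑ a, ∑ b, J i a * J j b * pd c (fun z => T' z a b) (τ x)
      - ∑ a, ∑ b, J i a * J j b * ∑ l, christoffel g' l c a (τ x) * T' (τ x) l b
      - ∑ a, ∑ b, J i a * J j b * ∑ l, christoffel g' l c b (τ x) * T' (τ x) a l := by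
    intro c
    simp only [bil, covDeriv, Matrix.of_apply, ← Finset.sum_sub_distrib, ← mul_sub]
  show _ = ∑ c, J k c * bil (Matrix.of fun a b => covDeriv g' T' c a b (τ x)) (J i) (J j)
  simp_rw [r4, mul_sub, Finset.sum_sub_distrib]
  rw [r1, r2, r3]
  ring

/-- The equation of a concircular tensor is independent of the coordinates. -/
lemma concircular_change {g T g' T' : (Fin n → ℝ) → Matrix (Fin n) (Fin n) ℝ}
    {τ : (Fin n → ℝ) → Fin n → ℝ} {Ω Ω' : Set (Fin n → ℝ)} {x : Fin n → ℝ} (hΩ : IsOpen Ω)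
    (hΩ' : IsOpen Ω') (hx : x ∈ Ω) (hmap : ∀ y ∈ Ω, τ y ∈ Ω')
    (hτ : ∀ a, ContDiffOn ℝ ∞ (fun y => τ y a) Ω)
    (hg' : ∀ a b, ContDiffOn ℝ ∞ (fun y => g' y a b) Ω')
    (hT' : ∀ a b, ContDiffOn ℝ ∞ (fun y => T' y a b) Ω')
    (hsym : ∀ y ∈ Ω', ∀ a b, g' y a b = g' y b a) (hdet : (g' (τ x)).det ≠ 0)
    (hJ : (Matrix.of fun a i => pd i (fun y => τ y a) x).det ≠ 0)
    (hgg : ∀ y ∈ Ω, ∀ i j, g y i j = bil (g' (τ y)) (fun a => pd i (fun z => τ z a) y)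
      (fun a => pd j (fun z => τ z a) y))
    (hTT : ∀ y ∈ Ω, ∀ i j, T y i j = bil (T' (τ y)) (fun a => pd i (fun z => τ z a) y)
      (fun a => pd j (fun z => τ z a) y))
    (hα : ∃ α : Fin n → ℝ, ∀ i j k, covDeriv g' T' k i j (τ x) =
      (1 / 2) * (α i * g' (τ x) j k + α j * g' (τ x) i k)) :
    ∃ α : Fin n → ℝ, ∀ i j k, covDeriv g T k i j x =
      (1 / 2) * (α i * g x j k + α j * g x i k) := by
  obtain ⟨α, hα⟩ := hα
  -- The covector of the transformed equation is the pullback of α.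
  refine ⟨fun i => ∑ a, α a * pd i (fun z => τ z a) x, fun i j k => ?_⟩
  rw [covDeriv_change hΩ hΩ' hx hmap hτ hg' hT' hsym hdet hJ hgg hTT, hgg x hx, hgg x hx]
  set J : Fin n → Fin n → ℝ := fun i a => pd i (fun z => τ z a) x with hJd
  have e : ∀ c, bil (Matrix.of fun a b => covDeriv g' T' c a b (τ x)) (J i) (J j) =
      ∑ a, ∑ b, J i a * J j b * ((1 / 2) * (α a * g' (τ x) b c + α b * g' (τ x) a c)) := by
    intro c
    simp only [bil, Matrix.of_apply, hα]
  show ∑ c, J k c * bil (Matrix.of fun a b => covDeriv g' T' c a b (τ x)) (J i) (J j) =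
    1 / 2 * ((∑ a, α a * J i a) * bil (g' (τ x)) (J j) (J k) +
      (∑ a, α a * J j a) * bil (g' (τ x)) (J i) (J k))
  have e1 : (∑ a, α a * J i a) * bil (g' (τ x)) (J j) (J k) =
      ∑ c, ∑ a, ∑ b, J k c * (J i a * J j b * (α a * g' (τ x) b c)) := by
    rw [Finset.sum_mul, Finset.sum_comm]
    refine Finset.sum_congr rfl fun a _ => ?_
    simp only [bil, Finset.mul_sum]
    rw [Finset.sum_comm]
    exact Finset.sum_congr rfl fun c _ => Finset.sum_congr rfl fun b _ => by ring
  have e2 : (∑ a, α a * J j a) * bil (g' (τ x)) (J i) (J k) =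
      ∑ c, ∑ a, ∑ b, J k c * (J i a * J j b * (α b * g' (τ x) a c)) := by
    rw [mul_comm, bil, Finset.sum_mul, Finset.sum_comm]
    refine Finset.sum_congr rfl fun a _ => ?_
    rw [Finset.sum_mul]
    refine Finset.sum_congr rfl fun c _ => ?_
    rw [Finset.mul_sum]
    exact Finset.sum_congr rfl fun b _ => by ring
  rw [e1, e2, ← Finset.sum_add_distrib, Finset.mul_sum]
  refine Finset.sum_congr rfl fun c _ => ?_
  rw [e c, ← Finset.sum_add_distrib, Finset.mul_sum, Finset.mul_sum]
  refine Finset.sum_congr rfl fun a _ => ?_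
  rw [← Finset.sum_add_distrib, Finset.mul_sum, Finset.mul_sum]
  exact Finset.sum_congr rfl fun b _ => by ring

end ChangeOfCoordinates

end KEM

end

noncomputable section

namespace KEM

/-! ### Components of tensors in charts -/

section Charts

variable {n : ℕ} {M : Type*} [TopologicalSpace M] [ChartedSpace (Fin n → ℝ) M]
  {φ ψ : OpenPartialHomeomorph M (Fin n → ℝ)} {T : Tensor2 n M} {x : Fin n → ℝ} {p : M}

/-- A tensor as a field of bilinear forms on the model space. -/
def asForm (T : Tensor2 n M) (p : M) : LinearMap.BilinForm ℝ (Fin n → ℝ) := T p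

/-- The derivative of the inverse of a chart. -/
def dsymm (φ : OpenPartialHomeomorph M (Fin n → ℝ)) (x : Fin n → ℝ) :
    (Fin n → ℝ) →L[ℝ] (Fin n → ℝ) :=
  mfderiv 𝓘(ℝ, Fin n → ℝ) 𝓘(ℝ, Fin n → ℝ) φ.symm x

/-- The derivative of a chart. -/
def dchart (φ : OpenPartialHomeomorph M (Fin n → ℝ)) (p : M) :
    (Fin n → ℝ) →L[ℝ] (Fin n → ℝ) :=
  mfderiv 𝓘(ℝ, Fin n → ℝ) 𝓘(ℝ, Fin n → ℝ) φ p

lemma IsCoord.mdifferentiable (hφ : IsCoord φ) :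
    φ.MDifferentiable 𝓘(ℝ, Fin n → ℝ) 𝓘(ℝ, Fin n → ℝ) :=
  ⟨(contMDiffOn_of_mem_maximalAtlas hφ).mdifferentiableOn (by simp),
    (contMDiffOn_symm_of_mem_maximalAtlas hφ).mdifferentiableOn (by simp)⟩

lemma IsCoord.dchart_dsymm (hφ : IsCoord φ) (hx : x ∈ φ.target) (v : Fin n → ℝ) :
    dchart φ (φ.symm x) (dsymm φ x v) = v :=
  congrArg (fun f : (Fin n → ℝ) →L[ℝ] (Fin n → ℝ) => f v) (hφ.mdifferentiable.comp_symm_deriv hx)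

lemma IsCoord.dsymm_dchart (hφ : IsCoord φ) (hp : p ∈ φ.source) (v : Fin n → ℝ) :
    dsymm φ (φ p) (dchart φ p v) = v :=
  congrArg (fun f : (Fin n → ℝ) →L[ℝ] (Fin n → ℝ) => f v) (hφ.mdifferentiable.symm_comp_deriv hp)

lemma IsCoord.dsymm_surjective (hφ : IsCoord φ) (hx : x ∈ φ.target) (v : Fin n → ℝ) :
    ∃ u, dsymm φ x u = v := by
  have := hφ.dsymm_dchart (φ.map_target hx) v
  rw [φ.right_inv hx] at this
  exact ⟨_, this⟩

lemma comp_apply (i j : Fin n) : comp T φ x i j =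
    asForm T (φ.symm x) (dsymm φ x (Pi.single i 1)) (dsymm φ x (Pi.single j 1)) := rfl

lemma asForm_dsymm (u v : Fin n → ℝ) :
    asForm T (φ.symm x) (dsymm φ x u) (dsymm φ x v) = bil (comp T φ x) u v := by
  conv_lhs => rw [pi_eq_sum_univ' u, pi_eq_sum_univ' v]
  simp only [map_sum, map_smul, LinearMap.sum_apply, LinearMap.smul_apply, smul_eq_mul, bil,
    comp_apply, Finset.mul_sum]
  rw [Finset.sum_comm]
  refine Finset.sum_congr rfl fun a _ => Finset.sum_congr rfl fun b _ => ?_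
  rw [mul_assoc, mul_left_comm]

/-- The transition map between two charts. -/
def transition (φ ψ : OpenPartialHomeomorph M (Fin n → ℝ)) (x : Fin n → ℝ) : Fin n → ℝ :=
  ψ (φ.symm x)

lemma isOpen_overlap {M : Type*} [TopologicalSpace M] (φ ψ : OpenPartialHomeomorph M (Fin n → ℝ)) :
    IsOpen (φ.target ∩ φ.symm ⁻¹' ψ.source) :=
  φ.symm.isOpen_inter_preimage ψ.open_source

lemma IsCoord.contDiffOn_transition (hφ : IsCoord φ) (hψ : IsCoord ψ) :
    ContDiffOn ℝ ∞ (transition φ ψ) (φ.target ∩ φ.symm ⁻¹' ψ.source) :=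
  contMDiffOn_iff_contDiffOn.1 ((contMDiffOn_of_mem_maximalAtlas hψ).comp'
    (contMDiffOn_symm_of_mem_maximalAtlas hφ))

lemma dsymm_transition (hφ : IsCoord φ) (hψ : IsCoord ψ)
    (hx : x ∈ φ.target ∩ φ.symm ⁻¹' ψ.source) (v : Fin n → ℝ) :
    dsymm φ x v = dsymm ψ (transition φ ψ x) (fderiv ℝ (transition φ ψ) x v) := by
  have ho := isOpen_overlap φ ψ
  have hd : DifferentiableAt ℝ (transition φ ψ) x :=
    ((hφ.contDiffOn_transition hψ).contDiffAt (ho.mem_nhds hx)).differentiableAt (by simp)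
  have h1 : mfderiv 𝓘(ℝ, Fin n → ℝ) 𝓘(ℝ, Fin n → ℝ) (ψ.symm ∘ transition φ ψ) x =
      (mfderiv 𝓘(ℝ, Fin n → ℝ) 𝓘(ℝ, Fin n → ℝ) ψ.symm (transition φ ψ x)).comp
        (mfderiv 𝓘(ℝ, Fin n → ℝ) 𝓘(ℝ, Fin n → ℝ) (transition φ ψ) x) :=
    mfderiv_comp x (hψ.mdifferentiable.mdifferentiableAt_symm (ψ.map_source hx.2))
      hd.mdifferentiableAt
  have h2 : φ.symm =ᶠ[nhds x] ψ.symm ∘ transition φ ψ := by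
    filter_upwards [ho.mem_nhds hx] with y hy
    exact (ψ.left_inv hy.2).symm
  have h3 : dsymm φ x = (dsymm ψ (transition φ ψ x)).comp (fderiv ℝ (transition φ ψ) x) := by
    rw [← mfderiv_eq_fderiv]
    exact h2.mfderiv_eq.trans h1
  rw [h3]
  rfl

lemma fderiv_transition (hφ : IsCoord φ) (hψ : IsCoord ψ)
    (hx : x ∈ φ.target ∩ φ.symm ⁻¹' ψ.source) (i : Fin n) :
    fderiv ℝ (transition φ ψ) x (Pi.single i 1) =
      fun a => pd i (fun y => transition φ ψ y a) x := by
  have hd : DifferentiableAt ℝ (transition φ ψ) x :=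
    ((hφ.contDiffOn_transition hψ).contDiffAt ((isOpen_overlap φ ψ).mem_nhds hx)).differentiableAt
      (by simp)
  ext a
  rw [pd, fderiv_apply hd a]
  rfl

lemma comp_change (hφ : IsCoord φ) (hψ : IsCoord ψ)
    (hx : x ∈ φ.target ∩ φ.symm ⁻¹' ψ.source) (i j : Fin n) :
    comp T φ x i j = bil (comp T ψ (transition φ ψ x))
      (fun a => pd i (fun z => transition φ ψ z a) x)
      (fun a => pd j (fun z => transition φ ψ z a) x) := by
  rw [comp_apply, dsymm_transition hφ hψ hx, dsymm_transition hφ hψ hx, ← asForm_dsymm,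
    fderiv_transition hφ hψ hx, fderiv_transition hφ hψ hx, transition, ψ.left_inv hx.2]

lemma det_transition (hφ : IsCoord φ) (hψ : IsCoord ψ)
    (hx : x ∈ φ.target ∩ φ.symm ⁻¹' ψ.source) :
    (Matrix.of fun a i => pd i (fun z => transition φ ψ z a) x).det ≠ 0 := by
  intro h0
  obtain ⟨v, hv, hv0⟩ := Matrix.exists_mulVec_eq_zero_iff.2 h0
  refine hv ?_
  have h1 : fderiv ℝ (transition φ ψ) x v = 0 := by
    rw [← hv0]
    conv_lhs => rw [pi_eq_sum_univ' v]
    simp only [map_sum, map_smul, fderiv_transition hφ hψ hx]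
    ext a
    simp only [Finset.sum_apply, Pi.smul_apply, smul_eq_mul, Matrix.mulVec, dotProduct,
      Matrix.of_apply]
    exact Finset.sum_congr rfl fun i _ => mul_comm _ _
  rw [← hφ.dchart_dsymm hx.1 v, dsymm_transition hφ hψ hx, h1, map_zero, map_zero]

lemma det_comp_ne_zero (hφ : IsCoord φ) {g : Tensor2 n M} (hx : x ∈ φ.target)
    (hg : (g (φ.symm x)).Nondegenerate) : (comp g φ x).det ≠ 0 := by
  intro h0
  obtain ⟨v, hv, hv0⟩ := Matrix.exists_vecMul_eq_zero_iff.2 h0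
  refine hv ?_
  have h1 : dsymm φ x v = 0 := by
    refine hg.1 (dsymm φ x v) fun w => ?_
    obtain ⟨u, hu⟩ := hφ.dsymm_surjective hx w
    have h2 : asForm g (φ.symm x) (dsymm φ x v) (dsymm φ x u) = 0 := by
      rw [asForm_dsymm, bil, Finset.sum_comm]
      refine Finset.sum_eq_zero fun b _ => ?_
      have := congrFun hv0 b
      simp only [Matrix.vecMul, dotProduct, Pi.zero_apply] at this
      rw [← mul_zero (u b), ← this, Finset.mul_sum]
      exact Finset.sum_congr rfl fun a _ => by ring
    rw [← hu]
    exact h2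
  rw [← hφ.dchart_dsymm hx v, h1, map_zero]

/-- The tensor with components `A` in the chart `φ`. -/
def tensorOf (φ : OpenPartialHomeomorph M (Fin n → ℝ))
    (A : (Fin n → ℝ) → Matrix (Fin n) (Fin n) ℝ) : Tensor2 n M := fun p =>
  ((Matrix.toBilin' (A (φ p))).compl₁₂ (dchart φ p).toLinearMap (dchart φ p).toLinearMap :
    LinearMap.BilinForm ℝ (Fin n → ℝ))

lemma comp_tensorOf (hφ : IsCoord φ) (hx : x ∈ φ.target)
    (A : (Fin n → ℝ) → Matrix (Fin n) (Fin n) ℝ) : comp (tensorOf φ A) φ x = A x := by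
  ext i j
  have h1 : comp (tensorOf φ A) φ x i j = Matrix.toBilin' (A (φ (φ.symm x)))
      (dchart φ (φ.symm x) (dsymm φ x (Pi.single i 1)))
      (dchart φ (φ.symm x) (dsymm φ x (Pi.single j 1))) := rfl
  rw [h1, hφ.dchart_dsymm hx, hφ.dchart_dsymm hx, φ.right_inv hx, Matrix.toBilin'_single]

lemma asForm_eq_of_comp_eq (hφ : IsCoord φ) {T' : Tensor2 n M} (hp : p ∈ φ.source)
    (h : comp T φ (φ p) = comp T' φ (φ p)) : T p = T' p := by
  have h1 : asForm T p = asForm T' p := by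
    refine LinearMap.ext fun v => LinearMap.ext fun w => ?_
    have := asForm_dsymm (T := T) (φ := φ) (x := φ p) (dchart φ p v) (dchart φ p w)
    rw [h, ← asForm_dsymm, φ.left_inv hp, hφ.dsymm_dchart hp, hφ.dsymm_dchart hp] at this
    exact this
  exact h1

end Charts

end KEM

end

noncomputable section

namespace KEM

/-! ### Locality and chart independence; the coordinate form -/

section Locality

variable {n : ℕ} {M : Type*} [TopologicalSpace M] [ChartedSpace (Fin n → ℝ) M]
  {φ ψ : OpenPartialHomeomorph M (Fin n → ℝ)} {g T T' L : Tensor2 n M} {x : Fin n → ℝ} {p : M}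

lemma comp_congr (h : T (φ.symm x) = T' (φ.symm x)) : comp T φ x = comp T' φ x := by
  ext i j
  rw [comp_apply, comp_apply, asForm, asForm, h]

lemma covDeriv_congr {G A A' : (Fin n → ℝ) → Matrix (Fin n) (Fin n) ℝ} {Ω : Set (Fin n → ℝ)}
    (hΩ : IsOpen Ω) (hx : x ∈ Ω) (h : ∀ y ∈ Ω, A y = A' y) (k i j : Fin n) :
    covDeriv G A k i j x = covDeriv G A' k i j x := by
  rw [covDeriv, covDeriv, h x hx, pd_congr_on hΩ hx fun y hy => by rw [h y hy]]

lemma IsSmoothSymmOn.mono {U V : Set M} (hT : IsSmoothSymmOn T U) (h : V ⊆ U) :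
    IsSmoothSymmOn T V :=
  ⟨fun p hp => hT.1 p (h hp), fun φ hφ i j =>
    (hT.2 φ hφ i j).mono fun _ hx => ⟨hx.1, h hx.2⟩⟩

lemma IsConcircularOn.mono {U V : Set M} (hL : IsConcircularOn g L U) (h : V ⊆ U) :
    IsConcircularOn g L V :=
  ⟨hL.1.mono h, fun φ hφ x hx hxV => hL.2 φ hφ x hx (h hxV)⟩

/-- Smoothness and the concircular equation depend only on germs, so a tensor may be compared with a
different concircular tensor near each point. -/
lemma isConcircularOn_of_locally {U : Set M} (h : ∀ p ∈ U, ∃ (W : Set M) (L' : Tensor2 n M),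
    IsOpen W ∧ p ∈ W ∧ IsConcircularOn g L' W ∧ ∀ q ∈ W, L q = L' q) :
    IsConcircularOn g L U := by
  refine ⟨⟨fun p hp v w => ?_, fun φ hφ i j x hx => ?_⟩, fun φ hφ x hx hxU => ?_⟩
  · obtain ⟨W, L', _, hpW, hL', he⟩ := h p hp
    rw [he p hpW]
    exact hL'.1.1 p hpW v w
  · obtain ⟨W, L', hW, hpW, hL', he⟩ := h _ hx.2
    have ho := φ.symm.isOpen_inter_preimage hW
    refine ContDiffAt.contDiffWithinAt ?_
    refine ((hL'.1.2 φ hφ i j).contDiffAt (ho.mem_nhds ⟨hx.1, hpW⟩)).congr_of_eventuallyEq ?_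
    filter_upwards [ho.mem_nhds ⟨hx.1, hpW⟩] with y hy
    rw [comp_congr (he _ hy.2)]
  · obtain ⟨W, L', hW, hpW, hL', he⟩ := h _ hxU
    obtain ⟨α, hα⟩ := hL'.2 φ hφ x hx hpW
    refine ⟨α, fun i j k => ?_⟩
    rw [← hα i j k]
    exact covDeriv_congr (φ.symm.isOpen_inter_preimage hW) ⟨hx, hpW⟩
      (fun y hy => comp_congr (he _ hy.2)) k i j

lemma IsPseudoRiemannian.contDiffOn (hg : IsPseudoRiemannian g) (hφ : IsCoord φ) (i j : Fin n) :
    ContDiffOn ℝ ∞ (fun x => comp g φ x i j) φ.target := by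
  simpa using hg.1.2 φ hφ i j

lemma IsPseudoRiemannian.comp_symm (hg : IsPseudoRiemannian g) (i j : Fin n) :
    comp g φ x i j = comp g φ x j i := hg.1.1 _ (mem_univ _) _ _

/-- A tensor is concircular if it is so in the coordinates of one chart. -/
lemma isConcircularOn_of_chart (hg : IsPseudoRiemannian g) (hφ : IsCoord φ)
    {Ω : Set (Fin n → ℝ)} (hΩ : IsOpen Ω) (hs : Ω ⊆ φ.target)
    (hsm : ∀ i j, ContDiffOn ℝ ∞ (fun x => comp L φ x i j) Ω)
    (hsym : ∀ x ∈ Ω, ∀ i j, comp L φ x i j = comp L φ x j i)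
    (hα : ∀ x ∈ Ω, ∃ α : Fin n → ℝ, ∀ i j k, covDeriv (comp g φ) (comp L φ) k i j x =
      (1 / 2) * (α i * comp g φ x j k + α j * comp g φ x i k)) :
    IsConcircularOn g L (φ.source ∩ φ ⁻¹' Ω) := by
  have hO : ∀ ψ : OpenPartialHomeomorph M (Fin n → ℝ),
      IsOpen (ψ.target ∩ ψ.symm ⁻¹' (φ.source ∩ φ ⁻¹' Ω)) := fun ψ =>
    ψ.symm.isOpen_inter_preimage (φ.isOpen_inter_preimage hΩ)
  have hsub : ∀ ψ : OpenPartialHomeomorph M (Fin n → ℝ), ψ.target ∩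
      ψ.symm ⁻¹' (φ.source ∩ φ ⁻¹' Ω) ⊆ ψ.target ∩ ψ.symm ⁻¹' φ.source := fun ψ x hx =>
    ⟨hx.1, hx.2.1⟩
  have hτ : ∀ ψ : OpenPartialHomeomorph M (Fin n → ℝ), IsCoord ψ → ∀ a,
      ContDiffOn ℝ ∞ (fun y => transition ψ φ y a)
        (ψ.target ∩ ψ.symm ⁻¹' (φ.source ∩ φ ⁻¹' Ω)) := fun ψ hψ a =>
    (contDiffOn_pi.1 (hψ.contDiffOn_transition hφ) a).mono (hsub ψ)
  refine ⟨⟨fun p hp v w => ?_, fun ψ hψ i j => ?_⟩, fun ψ hψ x hx hxU => ?_⟩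
  · have h1 : ∀ v w, asForm L p v w = bil (comp L φ (φ p)) (dchart φ p v) (dchart φ p w) := by
      intro v w
      have := asForm_dsymm (T := L) (φ := φ) (x := φ p) (dchart φ p v) (dchart φ p w)
      rwa [φ.left_inv hp.1, hφ.dsymm_dchart hp.1, hφ.dsymm_dchart hp.1] at this
    have h2 := (h1 v w).trans ((bil_comm (hsym _ hp.2)).trans (h1 w v).symm)
    exact h2
  · refine ContDiffOn.congr (f := fun x => bil (comp L φ (transition ψ φ x))
      (fun a => pd i (fun z => transition ψ φ z a) x)
      (fun a => pd j (fun z => transition ψ φ z a) x)) ?_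
      fun x hx => comp_change hψ hφ (hsub ψ hx) i j
    unfold bil
    refine ContDiffOn.sum fun a _ => ContDiffOn.sum fun b _ => ?_
    refine ((contDiffOn_pd (hτ ψ hψ a) (hO ψ) i).mul (contDiffOn_pd (hτ ψ hψ b) (hO ψ) j)).mul ?_
    exact (hsm a b).comp ((hψ.contDiffOn_transition hφ).mono (hsub ψ)) fun x hx => hx.2.2
  · have hx' : x ∈ ψ.target ∩ ψ.symm ⁻¹' (φ.source ∩ φ ⁻¹' Ω) := ⟨hx, hxU⟩
    have hy : transition ψ φ x ∈ Ω := hxU.2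
    exact concircular_change (τ := transition ψ φ) (g' := comp g φ) (T' := comp L φ) (hO ψ) hΩ hx'
      (fun y hy => hy.2.2) (hτ ψ hψ) (fun a b => (hg.contDiffOn hφ a b).mono hs) hsm
      (fun y _ a b => hg.comp_symm a b) (det_comp_ne_zero hφ (hs hy) (hg.2 _))
      (det_transition hψ hφ (hsub ψ hx')) (fun y hy i j => comp_change hψ hφ (hsub ψ hy) i j)
      (fun y hy i j => comp_change hψ hφ (hsub ψ hy) i j) (hα _ hy)

lemma IsOrthogonal.orthMetric (hg : IsPseudoRiemannian g) (hφ : IsCoord φ)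
    (ho : IsOrthogonal g φ) : OrthMetric (comp g φ) φ.target where
  isOpen := φ.open_target
  smooth i := hg.contDiffOn hφ i i
  ne_zero i x hx h0 := by
    refine det_comp_ne_zero hφ hx (hg.2 _) (Matrix.det_eq_zero_of_row_eq_zero i fun j => ?_)
    by_cases hij : i = j
    · rw [← hij, h0]
    · exact ho x hx i j hij
  off_diag x hx i j hij := ho x hx i j hij

/-- Separable orthogonal coordinates on a space of constant curvature. -/
lemma IsSeparable.sepSystem (hg : IsPseudoRiemannian g) {κ : ℝ} (hκ : HasConstantCurvature g κ)
    (hφ : IsCoord φ) (ho : IsOrthogonal g φ) (hs : IsSeparable g φ) :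
    SepSystem κ (diagOf (comp g φ)) φ.target := by
  have H := ho.orthMetric hg hφ
  refine H.sepSystem (fun x hx i j hij k => ?_) (hκ φ hφ)
  obtain ⟨V, C, W, E, hV, hxV, hVs, hC, hCn, hW, hHJ⟩ := hs x hx
  have HV : OrthMetric (comp g φ) V :=
    ⟨hV, fun i => (H.smooth i).mono hVs, fun i x hx => H.ne_zero i x (hVs hx),
      fun x hx => H.off_diag x (hVs hx)⟩
  exact HV.levi_civita_of_separable hC hCn hW (fun x hx c hc => (hHJ x hx c hc).1)
    (fun x hx c hc => (hHJ x hx c hc).2) hij k hxV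

/-- The coordinate form of the separation theorem. -/
theorem IsSeparable.hasConcircularForm (hg : IsPseudoRiemannian g) {κ : ℝ}
    (hκ : HasConstantCurvature g κ) (hφ : IsCoord φ) (ho : IsOrthogonal g φ)
    (hs : IsSeparable g φ) {J : Fin n → Set ℝ} (hJ : IsBox J) (hJs : univ.pi J ⊆ φ.target) :
    HasConcircularForm (comp g φ) J := by
  by_cases hn : 1 < n
  · exact SepSystem.hasConcircularForm hJ ((hs.sepSystem hg hκ hφ ho).mono hJ.isOpen hJs) hn
      fun x hx => ho x (hJs hx)
  · exact hasConcircularForm_of_subsingleton hn fun i j => (hg.contDiffOn hφ i j).mono hJs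

end Locality

end KEM

end

noncomputable section

namespace KEM

/-! ### Charts that diagonalize a characteristic Killing tensor -/

section Adapted

variable {n : ℕ} {M : Type*} [TopologicalSpace M] [ChartedSpace (Fin n → ℝ) M]
  {φ : OpenPartialHomeomorph M (Fin n → ℝ)} {g K L L' T : Tensor2 n M} {x : Fin n → ℝ} {p : M}
  {κ : ℝ}

/-- The eigenspace as a subspace of the model space. -/
def eigModel (g T : Tensor2 n M) (p : M) (μ : ℝ) : Submodule ℝ (Fin n → ℝ) :=
  LinearMap.ker (asForm T p - μ • asForm g p)

lemma dsymm_mem_eigSpace (hφ : IsCoord φ) (hx : x ∈ φ.target) {u : Fin n → ℝ} {μ : ℝ} :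
    dsymm φ x u ∈ eigModel g T (φ.symm x) μ ↔
      ∀ j, ∑ i, u i * (comp T φ x i j - μ * comp g φ x i j) = 0 := by
  have h0 : dsymm φ x u ∈ eigModel g T (φ.symm x) μ ↔ ∀ w, asForm T (φ.symm x) (dsymm φ x u) w -
        μ * asForm g (φ.symm x) (dsymm φ x u) w = 0 := by
    rw [eigModel, LinearMap.mem_ker]
    exact LinearMap.ext_iff
  have h1 : ∀ v, asForm T (φ.symm x) (dsymm φ x u) (dsymm φ x v) -
        μ * asForm g (φ.symm x) (dsymm φ x u) (dsymm φ x v) =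
      ∑ j, v j * ∑ i, u i * (comp T φ x i j - μ * comp g φ x i j) := by
    intro v
    rw [asForm_dsymm, asForm_dsymm]
    simp only [bil, Finset.mul_sum, ← Finset.sum_sub_distrib]
    rw [Finset.sum_comm]
    exact Finset.sum_congr rfl fun j _ => Finset.sum_congr rfl fun i _ => by ring
  rw [h0]
  constructor
  · intro h j
    have := h1 (Pi.single j 1)
    rw [h] at this
    simpa [Pi.single_apply] using this.symm
  · intro h w
    obtain ⟨v, rfl⟩ := hφ.dsymm_surjective hx w
    rw [h1]
    exact Finset.sum_eq_zero fun j _ => by rw [h j, mul_zero]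

/-- `φ` is a chart in which `g` and `K` are diagonal, the eigenvalues of `K` are distinct and `g`
satisfies the separability and curvature equations. -/
structure AdaptedChart (κ : ℝ) (g K : Tensor2 n M) (φ : OpenPartialHomeomorph M (Fin n → ℝ)) :
    Prop where
  coord : IsCoord φ
  orth : OrthMetric (comp g φ) φ.target
  sep : SepSystem κ (diagOf (comp g φ)) φ.target
  eig : ∀ x ∈ φ.target, ∃ m : Fin n → ℝ, Function.Injective m ∧
    ∀ i j, comp K φ x i j = if i = j then m i * comp g φ x i i else 0

/-- Each of the n distinct eigenvalues νₖ must occur among the μᵢ. Choosing an index for each k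
gives an injective, hence bijective, self-map of `Fin n`. -/
lemma injective_of_eigenvalues {G A : Matrix (Fin n) (Fin n) ℝ} (hG : G.det ≠ 0)
    {μ ν : Fin n → ℝ} (hA : ∀ i j, A i j = μ i * G i j) (hν : Function.Injective ν)
    (h : ∀ k, ∃ u : Fin n → ℝ, u ≠ 0 ∧ ∀ j, ∑ i, u i * (A i j - ν k * G i j) = 0) :
    Function.Injective μ := by
  have h1 : ∀ k, ∃ i, μ i = ν k := by
    intro k
    obtain ⟨u, hu, hu'⟩ := h k
    have h2 : Matrix.vecMul (fun i => u i * (μ i - ν k)) G = 0 := by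
      ext j
      rw [Pi.zero_apply, ← hu' j]
      simp only [Matrix.vecMul, dotProduct, hA]
      exact Finset.sum_congr rfl fun i _ => by ring
    have h3 := Matrix.eq_zero_of_vecMul_eq_zero hG h2
    obtain ⟨i, hi⟩ := Function.ne_iff.1 hu
    refine ⟨i, ?_⟩
    have := (mul_eq_zero.1 (congrFun h3 i)).resolve_left hi
    linarith
  choose s hs using h1
  have hsI : Function.Injective s := fun a b hab => hν (by rw [← hs a, ← hs b, hab])
  have hsS := Finite.surjective_of_injective hsI
  intro i j hij
  obtain ⟨a, rfl⟩ := hsS i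
  obtain ⟨b, rfl⟩ := hsS j
  rw [hs, hs] at hij
  rw [hν hij]

lemma IsCharacteristicKilling.exists_adaptedChart (hg : IsPseudoRiemannian g)
    (hκ : HasConstantCurvature g κ) (hK : IsCharacteristicKilling g K) (p : M) :
    ∃ φ, AdaptedChart κ g K φ ∧ p ∈ φ.source := by
  obtain ⟨hKil, hdist, hdiag⟩ := hK
  obtain ⟨φ, hφ, hp, hcoord⟩ := hdiag p
  have hKs : ∀ x i j, comp K φ x i j = comp K φ x j i := fun x i j => hKil.1.1 _ (mem_univ _) _ _
  have hμ : ∀ x ∈ φ.target, ∃ μ : Fin n → ℝ, Function.Injective μ ∧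
      ∀ i j, comp K φ x i j = μ i * comp g φ x i j := by
    intro x hx
    choose μ hμ using hcoord x hx
    have hA : ∀ i j, comp K φ x i j = μ i * comp g φ x i j := by
      intro i j
      have := (dsymm_mem_eigSpace hφ hx).1 (hμ i) j
      simp only [Pi.single_apply, ite_mul, one_mul, zero_mul, Finset.sum_ite_eq',
        Finset.mem_univ, if_true] at this
      linarith
    obtain ⟨ν, hν, hne⟩ := hdist (φ.symm x)
    refine ⟨μ, injective_of_eigenvalues (det_comp_ne_zero hφ hx (hg.2 _)) hA hν fun k => ?_, hA⟩
    obtain ⟨v, hv, hv0⟩ := Submodule.exists_mem_ne_zero_of_ne_bot (hne k)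
    obtain ⟨u, hu⟩ := hφ.dsymm_surjective hx v
    refine ⟨u, fun h => hv0 ?_, ?_⟩
    · rw [← hu, h, map_zero]; rfl
    · rw [← dsymm_mem_eigSpace hφ hx, hu]
      exact hv
  have ho : IsOrthogonal g φ := by
    intro x hx i j hij
    obtain ⟨μ, hμI, hμ⟩ := hμ x hx
    have h1 := hμ i j
    rw [hKs, hμ j i, hg.comp_symm j i] at h1
    have h2 : (μ j - μ i) * comp g φ x i j = 0 := by linarith
    exact (mul_eq_zero.1 h2).resolve_left (sub_ne_zero.2 fun h => hij (hμI h.symm))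
  have H := ho.orthMetric hg hφ
  have hT : ∀ x ∈ φ.target, ∀ i j, comp K φ x i j =
      if i = j then comp K φ x i i / comp g φ x i i * comp g φ x i i else 0 := by
    intro x hx i j
    obtain ⟨μ, hμI, hμ⟩ := hμ x hx
    split_ifs with hij
    · rw [div_mul_cancel₀ _ (H.ne_zero i x hx), hij]
    · rw [hμ, ho x hx i j hij, mul_zero]
  have hI : ∀ x ∈ φ.target, Function.Injective fun i => comp K φ x i i / comp g φ x i i := by
    intro x hx
    obtain ⟨μ, hμI, hμ⟩ := hμ x hx
    have : (fun i => comp K φ x i i / comp g φ x i i) = μ := by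
      ext i; rw [hμ, mul_div_cancel_right₀ _ (H.ne_zero i x hx)]
    rwa [this]
  refine ⟨φ, ⟨hφ, H, ?_, fun x hx => ⟨_, hI x hx, hT x hx⟩⟩, hp⟩
  refine H.sepSystem (fun x hx i j hij k => ?_) (hκ φ hφ)
  refine H.levi_civita_of_killing (T := comp K φ)
    (m := fun i x => comp K φ x i i / comp g φ x i i) hI (fun i => ?_) hT (hKil.2 φ hφ) hij k hx
  have : ContDiffOn ℝ ∞ (fun x => comp K φ x i i) φ.target := by simpa using hKil.1.2 φ hφ i i
  exact this.div (H.smooth i) (H.ne_zero i)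

namespace AdaptedChart

variable (H : AdaptedChart κ g K φ)
include H

lemma dsymm_mem_eigSpace_iff (hx : x ∈ φ.target) {l u : Fin n → ℝ} {μ : ℝ}
    (hl : ∀ i j, comp T φ x i j = if i = j then l i * comp g φ x i i else 0) :
    dsymm φ x u ∈ eigModel g T (φ.symm x) μ ↔
      ∀ j, u j = 0 ∨ l j = μ := by
  rw [dsymm_mem_eigSpace H.coord hx]
  refine forall_congr' fun j => ?_
  rw [Finset.sum_eq_single j (fun i _ hij => by
    rw [hl, if_neg hij, H.orth.off_diag x hx i j hij]; ring) (by simp), hl, if_pos rfl, ← sub_mul,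
    ← mul_assoc, mul_eq_zero_iff_right (H.orth.ne_zero j x hx), mul_eq_zero, sub_eq_zero]

/-- The eigenspaces of K are the coordinate lines, because its eigenvalues are distinct; invariance
of all of them means that L is diagonal. -/
lemma leavesInvariant_iff (hx : x ∈ φ.target) :
    LeavesEigenspacesInvariantOn g K L {φ.symm x} ↔
      ∃ l : Fin n → ℝ, ∀ i j, comp L φ x i j = if i = j then l i * comp g φ x i i else 0 := by
  obtain ⟨m, hmI, hm⟩ := H.eig x hx
  constructor
  · intro h
    have h1 : ∀ i, ∃ l : ℝ, ∀ j, comp L φ x i j = l * comp g φ x i j := by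
      intro i
      have hi : dsymm φ x (Pi.single i 1) ∈ eigModel g K (φ.symm x) (m i) := by
        rw [H.dsymm_mem_eigSpace_iff hx hm]
        intro j
        by_cases hij : j = i
        · right; rw [hij]
        · left; simp [hij]
      obtain ⟨u, hu, hLu⟩ := h _ rfl (m i) _ hi
      obtain ⟨c, rfl⟩ := H.coord.dsymm_surjective hx u
      replace hu := (H.dsymm_mem_eigSpace_iff hx hm).1 hu
      refine ⟨c i, fun j => ?_⟩
      have h2 : asForm L (φ.symm x) (dsymm φ x (Pi.single i 1)) (dsymm φ x (Pi.single j 1)) =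
        asForm g (φ.symm x) (dsymm φ x c) (dsymm φ x (Pi.single j 1)) := hLu _
      have hc : c = c i • Pi.single i 1 := by
        ext a
        by_cases ha : a = i
        · simp [ha]
        · rw [(hu a).resolve_right fun h => ha (hmI h)]
          simp [ha]
      rw [hc, map_smul, map_smul, LinearMap.smul_apply, smul_eq_mul] at h2
      exact h2
    choose l hl using h1
    refine ⟨l, fun i j => ?_⟩
    split_ifs with hij
    · rw [hl, hij]
    · rw [hl, H.orth.off_diag x hx i j hij, mul_zero]
  · rintro ⟨l, hl⟩ _ rfl μ v hv
    obtain ⟨c, rfl⟩ := H.coord.dsymm_surjective hx v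
    replace hv := (H.dsymm_mem_eigSpace_iff hx hm).1 hv
    refine ⟨dsymm φ x fun i => l i * c i, ?_, fun w => ?_⟩
    · refine (H.dsymm_mem_eigSpace_iff hx hm).2 fun j => ?_
      rcases hv j with h | h
      · left; rw [h, mul_zero]
      · right; exact h
    · obtain ⟨d, rfl⟩ := H.coord.dsymm_surjective hx w
      have : asForm L (φ.symm x) (dsymm φ x c) (dsymm φ x d) =
          asForm g (φ.symm x) (dsymm φ x fun i => l i * c i) (dsymm φ x d) := by
        rw [asForm_dsymm, asForm_dsymm, bil, bil]
        refine Finset.sum_congr rfl fun a _ => Finset.sum_congr rfl fun b _ => ?_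
        rw [hl]
        split_ifs with hab
        · rw [hab]; ring
        · rw [H.orth.off_diag x hx a b hab]; ring
      exact this

end AdaptedChart

/-- At `p` each eigenspace of `L` is contained in an eigenspace of `L'`. -/
def FinerAt (g L L' : Tensor2 n M) (p : M) : Prop :=
  ∀ μ : ℝ, ∃ ν : ℝ, eigSpace g L p μ ≤ eigSpace g L' p ν

/-- Both tensors have eigenspaces spanned by coordinate vectors, so inclusion of eigenspaces only
compares coincidences among the eigenvalues. -/
lemma AdaptedChart.finerAt_iff (H : AdaptedChart κ g K φ) (hx : x ∈ φ.target) {l l' : Fin n → ℝ}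
    (hl : ∀ i j, comp L φ x i j = if i = j then l i * comp g φ x i i else 0)
    (hl' : ∀ i j, comp L' φ x i j = if i = j then l' i * comp g φ x i i else 0) :
    FinerAt g L L' (φ.symm x) ↔ ∀ i j, l i = l j → l' i = l' j := by
  constructor
  · intro h i j hij
    obtain ⟨ν, hν⟩ := h (l i)
    have h1 : ∀ k, l k = l i → l' k = ν := by
      intro k hk
      have h2 := hν ((H.dsymm_mem_eigSpace_iff hx hl (u := Pi.single k 1)).2 fun a => by
        by_cases ha : a = k
        · right; rw [ha, hk]
        · left; simp [ha])
      simpa using (H.dsymm_mem_eigSpace_iff hx hl').1 h2 k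
    rw [h1 i rfl, h1 j hij.symm]
  · intro h μ
    by_cases hi : ∃ i, l i = μ
    · obtain ⟨i, rfl⟩ := hi
      refine ⟨l' i, fun v hv => ?_⟩
      obtain ⟨c, rfl⟩ := H.coord.dsymm_surjective hx v
      replace hv := (H.dsymm_mem_eigSpace_iff hx hl).1 hv
      exact (H.dsymm_mem_eigSpace_iff hx hl').2 fun j => (hv j).imp_right fun hj => h j i hj
    -- Here μ is not an eigenvalue, its eigenspace is zero, and ν = 0 is an arbitrary choice.
    · push Not at hi
      refine ⟨0, fun v hv => ?_⟩
      obtain ⟨c, rfl⟩ := H.coord.dsymm_surjective hx v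
      replace hv := (H.dsymm_mem_eigSpace_iff hx hl).1 hv
      exact (H.dsymm_mem_eigSpace_iff hx hl').2 fun j => Or.inl ((hv j).resolve_right (hi j))

end Adapted

end KEM

end

noncomputable section

namespace KEM

/-! ### Concircular tensors adapted to a characteristic Killing tensor -/

section Admissible

variable {n : ℕ} {M : Type*} [TopologicalSpace M] [ChartedSpace (Fin n → ℝ) M]
  {φ : OpenPartialHomeomorph M (Fin n → ℝ)} {g K L L' : Tensor2 n M} {x : Fin n → ℝ} {p q : M}
  {κ : ℝ} {J : Fin n → Set ℝ} {lam : Fin n → ℝ → ℝ}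

/-- Near `p` the tensor `L` is concircular and leaves the eigenspaces of `K` invariant. -/
def AdmissibleAt (g K L : Tensor2 n M) (p : M) : Prop :=
  ∃ W, IsOpen W ∧ p ∈ W ∧ IsConcircularOn g L W ∧ LeavesEigenspacesInvariantOn g K L W

lemma isOpen_admissibleAt : IsOpen {p | AdmissibleAt g K L p} := by
  rw [isOpen_iff_forall_mem_open]
  rintro p ⟨W, hW, hp, hL⟩
  exact ⟨W, fun q hq => ⟨W, hW, hq, hL⟩, hW, hp⟩

lemma AdmissibleAt.congr (h : AdmissibleAt g K L p) {W : Set M} (hW : IsOpen W) (hp : p ∈ W)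
    (he : ∀ q ∈ W, L' q = L q) : AdmissibleAt g K L' p := by
  obtain ⟨W₁, hW₁, hp₁, hc, hi⟩ := h
  refine ⟨W ∩ W₁, hW.inter hW₁, ⟨hp, hp₁⟩, ?_, fun q hq => ?_⟩
  · exact isConcircularOn_of_locally fun q hq => ⟨W ∩ W₁, L, hW.inter hW₁, hq,
      hc.mono inter_subset_right, fun r hr => he r hr.1⟩
  · rw [he q hq.1]
    exact hi q hq.2

lemma isConcircularOn_of_admissibleAt {U : Set M} (h : ∀ p ∈ U, AdmissibleAt g K L p) :
    IsConcircularOn g L U :=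
  isConcircularOn_of_locally fun p hp =>
    let ⟨W, hW, hpW, hc, _⟩ := h p hp
    ⟨W, L, hW, hpW, hc, fun _ _ => rfl⟩

lemma leavesEigenspacesInvariantOn_of_admissibleAt {U : Set M}
    (h : ∀ p ∈ U, AdmissibleAt g K L p) : LeavesEigenspacesInvariantOn g K L U :=
  fun p hp => let ⟨_, _, hpW, _, hi⟩ := h p hp; hi p hpW

lemma OrthMetric.mono {G : (Fin n → ℝ) → Matrix (Fin n) (Fin n) ℝ} {Ω Ω' : Set (Fin n → ℝ)}
    (H : OrthMetric G Ω) (ho : IsOpen Ω') (hs : Ω' ⊆ Ω) : OrthMetric G Ω' :=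
  ⟨ho, fun i => (H.smooth i).mono hs, fun i x hx => H.ne_zero i x (hs hx),
    fun x hx => H.off_diag x (hs hx)⟩

lemma pd_comp_eval {f : ℝ → ℝ} {f' : ℝ} {i : Fin n} (hf : HasDerivAt f f' (x i)) (k : Fin n) :
    pd k (fun y => f (y i)) x = if k = i then f' else 0 := by
  have h1 : HasFDerivAt (fun y : Fin n → ℝ => y i)
      (ContinuousLinearMap.proj (R := ℝ) (φ := fun _ : Fin n => ℝ) i) x :=
    (ContinuousLinearMap.proj (R := ℝ) (φ := fun _ : Fin n => ℝ) i).hasFDerivAt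
  have h2 := hf.comp_hasFDerivAt x h1
  have h3 : pd k (fun y => f (y i)) x = (f' • ContinuousLinearMap.proj (R := ℝ)
      (φ := fun _ : Fin n => ℝ) i) (Pi.single k 1) :=
    congrArg (fun F : (Fin n → ℝ) →L[ℝ] ℝ => F (Pi.single k 1)) h2.fderiv
  rw [h3]
  by_cases hk : k = i
  · subst hk; simp
  · simp [hk, Ne.symm hk]

/-- `L` is diagonal on a box of the chart `φ`, with eigenvalues `lam`. -/
def IsDiagOn (g L : Tensor2 n M) (φ : OpenPartialHomeomorph M (Fin n → ℝ)) (J : Fin n → Set ℝ)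
    (lam : Fin n → ℝ → ℝ) : Prop :=
  ∀ x ∈ univ.pi J, ∀ i j, comp L φ x i j = if i = j then lam i (x i) * comp g φ x i i else 0

namespace AdaptedChart

variable (H : AdaptedChart κ g K φ)
include H

/-- Invariance makes L diagonal, and the concircular equation makes each eigenvalue a function of
its own coordinate only. Together with `admissibleAt_of_isSol` this identifies admissible tensors on
a box with solutions of the linear system. -/
lemma exists_isSol (hJ : IsBox J) (hJs : univ.pi J ⊆ φ.target)
    (hL : ∀ x ∈ univ.pi J, AdmissibleAt g K L (φ.symm x)) :
    ∃ lam, IsSol (diagOf (comp g φ)) J lam ∧ IsDiagOn g L φ J lam := by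
  have HJ := H.orth.mono hJ.isOpen hJs
  let m : Fin n → (Fin n → ℝ) → ℝ := fun i x => comp L φ x i i / comp g φ x i i
  have hsm : ∀ i, ContDiffOn ℝ ∞ (m i) (univ.pi J) := by
    intro i x hx
    obtain ⟨W, hW, hxW, hc, -⟩ := hL x hx
    have h1 := (hc.1.2 φ H.coord i i).contDiffAt
      ((φ.symm.isOpen_inter_preimage hW).mem_nhds ⟨hJs hx, hxW⟩)
    have h2 := (HJ.smooth i).contDiffAt (hJ.isOpen.mem_nhds hx)
    exact (h1.div h2 (HJ.ne_zero i x hx)).contDiffWithinAt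
  have hmd : ∀ i, ∀ x ∈ univ.pi J, DifferentiableAt ℝ (m i) x := fun i x hx =>
    differentiableAt_of_contDiffOn (hsm i) hJ.isOpen hx
  have hT : ∀ x ∈ univ.pi J, ∀ i j, comp L φ x i j =
      if i = j then m i x * comp g φ x i i else 0 := by
    intro x hx i j
    obtain ⟨W, hW, hxW, -, hi⟩ := hL x hx
    obtain ⟨l, hl⟩ := (H.leavesInvariant_iff (hJs hx)).1
      fun q hq => by rw [mem_singleton_iff.1 hq]; exact hi _ hxW
    have h1 : m i x = l i := by
      simp only [m]
      rw [hl, if_pos rfl, mul_div_cancel_right₀ _ (HJ.ne_zero i x hx)]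
    rw [hl, h1]
  have hD : ∀ x ∈ univ.pi J, (∀ i k, i ≠ k → pd k (m i) x = 0) ∧
      ∀ i j, i ≠ j → pd j (m j) x = (m j x - m i x) * logPd (diagOf (comp g φ)) i j x := by
    intro x hx
    obtain ⟨W, hW, hxW, hc, -⟩ := hL x hx
    obtain ⟨α, hα⟩ := hc.2 φ H.coord x (hJs hx) hxW
    exact HJ.diag_of_concircular hT hx (fun i => hmd i x hx) hα
  obtain ⟨x₀, hx₀⟩ := hJ.nonempty
  have hm : ∀ i, ∀ x ∈ univ.pi J, m i (Function.update x₀ i (x i)) = m i x := by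
    intro i x hx
    refine eq_of_pd_eq_zero hJ (hmd i) (Finset.univ.erase i)
      (fun k hk y hy => (hD y hy).1 i k (Finset.ne_of_mem_erase hk).symm)
      (update_mem_box hx₀ (hx i (mem_univ i))) hx fun k hk => ?_
    have : k = i := by simpa using hk
    rw [this, Function.update_self]
  refine ⟨fun i t => m i (Function.update x₀ i t), fun x hx i j hij => ?_, fun x hx i j => ?_⟩
  · simp only [hm j x hx, hm i x hx]
    rw [← (hD x hx).2 i j hij]
    refine (hasDerivAt_line (hmd j x hx) j).congr_of_eventuallyEq ?_
    filter_upwards [(hJ j).1.mem_nhds (hx j (mem_univ j))] with s hs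
    have := hm j _ (update_mem_box hx hs)
    rwa [Function.update_self] at this
  · rw [hT x hx, ← hm i x hx]

lemma admissibleAt_of_isSol (hg : IsPseudoRiemannian g) (hn : 1 < n) (hJ : IsBox J)
    (hJs : univ.pi J ⊆ φ.target) (hlam : IsSol (diagOf (comp g φ)) J lam)
    (hL : IsDiagOn g L φ J lam) (hp : p ∈ φ.source) (hpJ : φ p ∈ univ.pi J) :
    AdmissibleAt g K L p := by
  have HJ := H.orth.mono hJ.isOpen hJs
  have hsep := H.sep.mono hJ.isOpen hJs
  have hd : ∀ i, ContDiffOn ℝ ∞ (fun x : Fin n → ℝ => lam i (x i)) (univ.pi J) := fun i =>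
    (hlam.contDiffOn hJ hsep hn i).comp (contDiff_apply ℝ ℝ i).contDiffOn
      fun x hx => hx i (mem_univ i)
  refine ⟨φ.source ∩ φ ⁻¹' univ.pi J, φ.isOpen_inter_preimage hJ.isOpen, ⟨hp, hpJ⟩, ?_, ?_⟩
  · refine isConcircularOn_of_chart hg H.coord hJ.isOpen hJs (fun i j => ?_)
      (fun x hx i j => ?_) fun x hx => ?_
    · refine ContDiffOn.congr (f := fun x => if i = j then lam i (x i) * comp g φ x i i else 0)
        ?_ fun x hx => hL x hx i j
      split_ifs
      · exact (hd i).mul (HJ.smooth i)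
      · exact contDiffOn_const
    · rw [hL x hx, hL x hx]
      by_cases hij : i = j
      · rw [hij]
      · rw [if_neg hij, if_neg (Ne.symm hij)]
    · have : Nontrivial (Fin n) := Fin.nontrivial_iff_two_le.2 hn
      have hder : ∀ i, ∃ c, HasDerivAt (lam i) c (x i) := fun i =>
        let ⟨k, hk⟩ := exists_ne i
        ⟨_, hlam x hx k i hk⟩
      refine ⟨fun i => pd i (fun y => lam i (y i)) x, ?_⟩
      refine HJ.concircular_of_diag (m := fun i y => lam i (y i)) hL hx
        (fun i => differentiableAt_of_contDiffOn (hd i) hJ.isOpen hx) (fun i k hik => ?_)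
        fun i j hij => ?_
      · obtain ⟨c, hc⟩ := hder i
        rw [pd_comp_eval hc, if_neg (Ne.symm hik)]
      · rw [pd_comp_eval (hlam x hx i j hij), if_pos rfl]
  · rintro q ⟨hq, hqJ⟩
    have h1 := (H.leavesInvariant_iff (L := L) (hJs hqJ)).2 ⟨fun i => lam i (φ q i), hL _ hqJ⟩
    rw [φ.left_inv hq] at h1
    exact h1 q rfl

lemma isDiagOn_tensorOf (hJs : univ.pi J ⊆ φ.target) (lam : Fin n → ℝ → ℝ) :
    IsDiagOn g (tensorOf φ fun x => Matrix.diagonal fun i => lam i (x i) * comp g φ x i i) φ J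
      lam := by
  intro x hx i j
  rw [comp_tensorOf H.coord (hJs hx), Matrix.diagonal_apply]

lemma eq_of_isDiagOn {mu : Fin n → ℝ → ℝ} (hL : IsDiagOn g L φ J lam)
    (hL' : IsDiagOn g L' φ J mu) (h : ∀ i, ∀ t ∈ J i, lam i t = mu i t) (hp : p ∈ φ.source)
    (hpJ : φ p ∈ univ.pi J) : L p = L' p := by
  refine asForm_eq_of_comp_eq H.coord hp ?_
  ext i j
  rw [hL _ hpJ, hL' _ hpJ, h i _ (hpJ i (mem_univ i))]

/-- An admissible germ extends to the box. -/
lemma exists_extension (hg : IsPseudoRiemannian g) (hn : 1 < n) (hJ : IsBox J)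
    (hJs : univ.pi J ⊆ φ.target) (hp : p ∈ φ.source) (hpJ : φ p ∈ univ.pi J)
    (hL : AdmissibleAt g K L p) :
    ∃ L', (∀ q ∈ φ.source ∩ φ ⁻¹' univ.pi J, AdmissibleAt g K L' q) ∧
      ∃ W, IsOpen W ∧ p ∈ W ∧ ∀ q ∈ W, L' q = L q := by
  have ho : IsOpen (univ.pi J ∩ (φ.target ∩ φ.symm ⁻¹' {q | AdmissibleAt g K L q})) :=
    hJ.isOpen.inter (φ.symm.isOpen_inter_preimage isOpen_admissibleAt)
  obtain ⟨J', hJ', hpJ', hs⟩ := exists_box_subset ho (x := φ p)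
    ⟨hpJ, φ.map_source hp, by rw [mem_preimage, φ.left_inv hp]; exact hL⟩
  have hsub : ∀ i, J' i ⊆ J i := by
    intro i t ht
    have := (hs (update_mem_box hpJ' ht)).1 i (mem_univ i)
    rwa [Function.update_self] at this
  have hJs' : univ.pi J' ⊆ φ.target := fun x hx => (hs hx).2.1
  obtain ⟨lam, hlam, hdiag⟩ := H.exists_isSol hJ' hJs' fun x hx => (hs hx).2.2
  obtain ⟨mu, hmu, he⟩ := hlam.extend hJ (H.sep.mono hJ.isOpen hJs) hn hJ' hsub
  refine ⟨_, fun q hq => H.admissibleAt_of_isSol hg hn hJ hJs hmu (H.isDiagOn_tensorOf hJs mu)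
    hq.1 hq.2, φ.source ∩ φ ⁻¹' univ.pi J', φ.isOpen_inter_preimage hJ'.isOpen, ⟨hp, hpJ'⟩,
    fun q hq => ?_⟩
  exact H.eq_of_isDiagOn (H.isDiagOn_tensorOf hJs' mu) hdiag he hq.1 hq.2

/-- Admissible tensors on a box are determined by their values at a point. -/
lemma eq_of_eq_at (hn : 1 < n) (hJ : IsBox J) (hJs : univ.pi J ⊆ φ.target)
    (hL : ∀ q ∈ φ.source ∩ φ ⁻¹' univ.pi J, AdmissibleAt g K L q)
    (hL' : ∀ q ∈ φ.source ∩ φ ⁻¹' univ.pi J, AdmissibleAt g K L' q)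
    (hp : p ∈ φ.source ∩ φ ⁻¹' univ.pi J) (he : L p = L' p)
    (hq : q ∈ φ.source ∩ φ ⁻¹' univ.pi J) : L q = L' q := by
  have hmem : ∀ x ∈ univ.pi J, φ.symm x ∈ φ.source ∩ φ ⁻¹' univ.pi J := fun x hx =>
    ⟨φ.map_target (hJs hx), by rw [mem_preimage, φ.right_inv (hJs hx)]; exact hx⟩
  obtain ⟨lam, hlam, hd⟩ := H.exists_isSol hJ hJs fun x hx => hL _ (hmem x hx)
  obtain ⟨mu, hmu, hd'⟩ := H.exists_isSol hJ hJs fun x hx => hL' _ (hmem x hx)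
  have h0 : ∀ i, lam i (φ p i) - mu i (φ p i) = 0 := by
    intro i
    have h1 : comp L φ (φ p) = comp L' φ (φ p) := comp_congr (by rw [φ.left_inv hp.1, he])
    have h2 := congrFun (congrFun h1 i) i
    rw [hd _ hp.2, hd' _ hp.2, if_pos rfl, if_pos rfl] at h2
    exact sub_eq_zero.2 (mul_right_cancel₀ (H.orth.ne_zero i _ (hJs hp.2)) h2)
  refine H.eq_of_isDiagOn hd hd' (fun i t ht => ?_) hq.1 hq.2
  exact sub_eq_zero.1
    ((hlam.sub hmu).eq_zero hJ (H.sep.mono hJ.isOpen hJs) hn hp.2 h0 i ht)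

/-- Coincidences among eigenvalues persist over a box, for L and for L', so the comparison at p
carries over to q. -/
lemma finerAt_of_finerAt (hJ : IsBox J) (hJs : univ.pi J ⊆ φ.target)
    (hL : ∀ q ∈ φ.source ∩ φ ⁻¹' univ.pi J, AdmissibleAt g K L q)
    (hL' : ∀ q ∈ φ.source ∩ φ ⁻¹' univ.pi J, AdmissibleAt g K L' q)
    (hp : p ∈ φ.source ∩ φ ⁻¹' univ.pi J) (hf : FinerAt g L L' p)
    (hq : q ∈ φ.source ∩ φ ⁻¹' univ.pi J) : FinerAt g L L' q := by
  have hmem : ∀ x ∈ univ.pi J, φ.symm x ∈ φ.source ∩ φ ⁻¹' univ.pi J := fun x hx =>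
    ⟨φ.map_target (hJs hx), by rw [mem_preimage, φ.right_inv (hJs hx)]; exact hx⟩
  obtain ⟨lam, hlam, hd⟩ := H.exists_isSol hJ hJs fun x hx => hL _ (hmem x hx)
  obtain ⟨mu, hmu, hd'⟩ := H.exists_isSol hJ hJs fun x hx => hL' _ (hmem x hx)
  have hsep := H.sep.mono hJ.isOpen hJs
  rw [← φ.left_inv hp.1, H.finerAt_iff (hJs hp.2) (l := fun i => lam i (φ p i))
    (l' := fun i => mu i (φ p i)) (hd _ hp.2) (hd' _ hp.2)] at hf
  rw [← φ.left_inv hq.1, H.finerAt_iff (hJs hq.2) (l := fun i => lam i (φ q i))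
    (l' := fun i => mu i (φ q i)) (hd _ hq.2) (hd' _ hq.2)]
  intro i j hij
  exact hmu.eq_of_eq hJ hsep hp.2 (hf i j (hlam.eq_of_eq hJ hsep hq.2 hij hp.2)) hq.2

end AdaptedChart

/-- Every neighbourhood of a point contains a box of an adapted chart. -/
lemma IsCharacteristicKilling.exists_adapted_box (hg : IsPseudoRiemannian g)
    (hκ : HasConstantCurvature g κ) (hK : IsCharacteristicKilling g K) {U : Set M}
    (hU : IsOpen U) (hp : p ∈ U) :
    ∃ φ J, AdaptedChart κ g K φ ∧ IsBox J ∧ univ.pi J ⊆ φ.target ∧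
      p ∈ φ.source ∩ φ ⁻¹' univ.pi J ∧ φ.source ∩ φ ⁻¹' univ.pi J ⊆ U := by
  obtain ⟨φ, H, hpφ⟩ := hK.exists_adaptedChart hg hκ p
  obtain ⟨J, hJ, hpJ, hs⟩ := exists_box_subset (φ.symm.isOpen_inter_preimage hU) (x := φ p)
    ⟨φ.map_source hpφ, by rw [mem_preimage, φ.left_inv hpφ]; exact hp⟩
  refine ⟨φ, J, H, hJ, fun x hx => (hs hx).1, ⟨hpφ, hpJ⟩, fun q hq => ?_⟩
  have := (hs hq.2).2
  rwa [mem_preimage, φ.left_inv hq.1] at this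

/-- Comparison is transported between any two points of a box in both directions; connectedness
chains the boxes together. -/
lemma finerAt_of_isPreconnected (hg : IsPseudoRiemannian g) (hκ : HasConstantCurvature g κ)
    (hK : IsCharacteristicKilling g K) {U : Set M} (hU : IsOpen U) (hUc : IsPreconnected U)
    (hL : ∀ q ∈ U, AdmissibleAt g K L q) (hL' : ∀ q ∈ U, AdmissibleAt g K L' q) (hp : p ∈ U)
    (hf : FinerAt g L L' p) (hq : q ∈ U) : FinerAt g L L' q := by
  refine hUc.induction₂' (fun a b => FinerAt g L L' a → FinerAt g L L' b) (fun a ha => ?_)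
    (fun a b c _ _ _ hab hbc h => hbc (hab h)) hp hq hf
  obtain ⟨φ, J, H, hJ, hJs, haJ, hs⟩ := hK.exists_adapted_box hg hκ hU ha
  filter_upwards [mem_nhdsWithin_of_mem_nhds
    ((φ.isOpen_inter_preimage hJ.isOpen).mem_nhds haJ)] with b hb
  exact ⟨fun h => H.finerAt_of_finerAt hJ hJs (fun q hq => hL q (hs hq))
      (fun q hq => hL' q (hs hq)) haJ h hb,
    fun h => H.finerAt_of_finerAt hJ hJs (fun q hq => hL q (hs hq))
      (fun q hq => hL' q (hs hq)) hb h haJ⟩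

end Admissible

end KEM

end

noncomputable section

namespace KEM

/-! ### Continuation of germs over simply connected sets -/

section Continuation

open Topology Filter

/-- The space of values of germs of sections satisfying the local condition `A`. -/
structure GermSpace {X B : Type*} (A : (X → B) → X → Prop) where
  /-- the base point -/
  base : X
  /-- the value at the base point -/
  val : B
  exists_germ : ∃ s, A s base ∧ s base = val

lemma GermSpace.ext_iff {X B : Type*} {A : (X → B) → X → Prop} {e e' : GermSpace A} : e = e' ↔ e.base = e'.base ∧ e.val = e'.val := by
  cases e; cases e'; simp

variable {X B : Type*} [TopologicalSpace X]

namespace GermSpace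

variable {A : (X → B) → X → Prop}

/-- The point of the germ space defined by a section. -/
def ofSection {s : X → B} {q : X} (h : A s q) : GermSpace A := ⟨q, s q, s, h, rfl⟩

/-- A set of germ values is open if it contains, with every value, the values at the nearby points
of all sections through it. -/
instance : TopologicalSpace (GermSpace A) where
  IsOpen S := ∀ e ∈ S, ∀ s, A s e.base → s e.base = e.val →
    ∀ᶠ q in 𝓝 e.base, ∀ h : A s q, ofSection h ∈ S
  isOpen_univ := by simp
  isOpen_inter S T hS hT e he s hs hv := by
    filter_upwards [hS e he.1 s hs hv, hT e he.2 s hs hv] with q h1 h2 h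
    exact ⟨h1 h, h2 h⟩
  isOpen_sUnion 𝓢 h𝓢 e he s hs hv := by
    obtain ⟨S, hS, heS⟩ := he
    filter_upwards [h𝓢 S hS e heS s hs hv] with q h1 h
    exact ⟨S, hS, h1 h⟩

lemma isOpen_iff {S : Set (GermSpace A)} : IsOpen S ↔ ∀ e ∈ S, ∀ s, A s e.base →
    s e.base = e.val → ∀ᶠ q in 𝓝 e.base, ∀ h : A s q, ofSection h ∈ S := Iff.rfl

end GermSpace

/-- Every point has a neighbourhood over which germs extend uniquely. -/
structure HasUniqueExtension (A : (X → B) → X → Prop) : Prop where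
  eventually : ∀ s q, A s q → ∀ᶠ r in 𝓝 q, A s r
  exists_nhds : ∀ p, ∃ D, IsOpen D ∧ p ∈ D ∧
    (∀ s, ∀ q ∈ D, A s q → ∃ s', (∀ r ∈ D, A s' r) ∧ s' =ᶠ[𝓝 q] s) ∧
    ∀ s s', (∀ r ∈ D, A s r) → (∀ r ∈ D, A s' r) → ∀ q ∈ D, s q = s' q → ∀ r ∈ D, s r = s' r

namespace HasUniqueExtension

variable {A : (X → B) → X → Prop} (hA : HasUniqueExtension A)
include hA

/-- A germ is determined by its value at the point, so the germ space can be built from values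
alone. -/
lemma eventuallyEq {s s' : X → B} {q : X} (hs : A s q) (hs' : A s' q) (h : s q = s' q) :
    s =ᶠ[𝓝 q] s' := by
  obtain ⟨D, hD, hq, hext, huniq⟩ := hA.exists_nhds q
  obtain ⟨t, ht, hts⟩ := hext s q hq hs
  obtain ⟨t', ht', hts'⟩ := hext s' q hq hs'
  have h1 := huniq t t' ht ht' q hq (by rw [hts.eq_of_nhds, hts'.eq_of_nhds, h])
  filter_upwards [hts, hts', hD.mem_nhds hq] with r hr hr' hrD
  rw [← hr, ← hr', h1 r hrD]

lemma isOpen_graph {s : X → B} {W : Set X} (hW : IsOpen W) (hs : ∀ q ∈ W, A s q) :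
    IsOpen {e : GermSpace A | e.base ∈ W ∧ e.val = s e.base} := by
  rw [GermSpace.isOpen_iff]
  rintro e ⟨heW, hev⟩ t ht htv
  filter_upwards [hA.eventuallyEq ht (hs _ heW) (by rw [htv, hev]), hW.mem_nhds heW]
    with q hq hqW h
  exact ⟨hqW, hq⟩

/-- Over a neighbourhood D with unique extension, the germ space is the disjoint union of the graphs
of the sections on D, indexed by their values at the centre. The global section s₀ makes every fibre
nonempty. -/
lemma isCoveringMap (hne : ∃ s, ∀ q, A s q) : IsCoveringMap (GermSpace.base : GermSpace A → X) := by
  obtain ⟨s₀, hs₀⟩ := hne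
  choose D hD hpD hext huniq using hA.exists_nhds
  let F : X → Type _ := fun p => {b : B // ∃ s, A s p ∧ s p = b}
  let τ : ∀ p, TopologicalSpace (F p) := fun p => ⊥
  have hτ : ∀ p, DiscreteTopology (F p) := fun p => ⟨rfl⟩
  have hsec : ∀ p, ∀ b : F p, ∃ s, (∀ q ∈ D p, A s q) ∧ s p = b.1 := by
    rintro p ⟨b, s, hs, rfl⟩
    obtain ⟨s', hs', he⟩ := hext p s p (hpD p) hs
    exact ⟨s', hs', he.eq_of_nhds⟩
  choose sec hsecA hsecv using hsec
  have hNE : Nonempty (X → GermSpace A) := ⟨fun q => GermSpace.ofSection (hs₀ q)⟩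
  have hNF : ∀ p, Nonempty (F p) := fun p => ⟨⟨s₀ p, s₀, hs₀ p, rfl⟩⟩
  refine IsCoveringMap.mk GermSpace.base F (fun p =>
    (hD p).trivializationDiscrete (fun b : F p => {e : GermSpace A | e.base ∈ D p ∧
      e.val = sec p b e.base}) (D p) ?_ ?_ ?_ ?_ ?_) hpD
  · intro b W hW
    constructor
    · intro ho
      have := hA.isOpen_graph ho fun q hq => hsecA p b q (hW hq)
      convert this using 1
      ext e
      exact ⟨fun h => ⟨h.1, h.2.2⟩, fun h => ⟨h.1, hW h.1, h.2⟩⟩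
    · intro ho
      rw [isOpen_iff_mem_nhds]
      intro q hq
      have h1 := GermSpace.isOpen_iff.1 ho (GermSpace.ofSection (hsecA p b q (hW hq)))
        ⟨hq, hW hq, rfl⟩ (sec p b) (hsecA p b q (hW hq)) rfl
      have h2 : ∀ᶠ r in 𝓝 q, r ∈ D p := (hD p).mem_nhds (hW hq)
      filter_upwards [h1, h2] with r hr hrD
      exact (hr (hsecA p b r hrD)).1
  · rintro b e ⟨-, he⟩ e' ⟨-, he'⟩ hb
    exact GermSpace.ext_iff.2 ⟨hb, by rw [he, he', hb]⟩
  · intro b q hq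
    exact ⟨GermSpace.ofSection (hsecA p b q hq), ⟨hq, rfl⟩, rfl⟩
  · intro b b' hbb
    rw [Function.onFun, Set.disjoint_left]
    rintro e ⟨heD, he⟩ ⟨-, he'⟩
    refine hbb (Subtype.ext ?_)
    rw [← hsecv, ← hsecv]
    exact huniq p _ _ (hsecA p b) (hsecA p b') e.base heD (he.symm.trans he') p (hpD p)
  · intro e he
    obtain ⟨s, hs, hv⟩ := e.exists_germ
    obtain ⟨t, ht, hts⟩ := hext p s e.base he hs
    let b : F p := ⟨t p, t, ht p (hpD p), rfl⟩
    refine mem_iUnion.2 ⟨b, he, ?_⟩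
    rw [← hv, ← hts.eq_of_nhds]
    exact huniq p _ _ ht (hsecA p b) p (hpD p) (hsecv p b).symm e.base he

/-- A germ extends to every simply connected open set. -/
theorem exists_continuation [LocallyPathConnectedSpace X]
    (hcongr : ∀ s s' q, A s q → s' =ᶠ[𝓝 q] s → A s' q)
    (hne : ∃ s, ∀ q, A s q) {U : Set X} (hU : IsOpen U) [SimplyConnectedSpace U] {p : X}
    (hp : p ∈ U) {s : X → B} (hs : A s p) : ∃ s', (∀ q ∈ U, A s' q) ∧ s' p = s p := by
  classical
  have : LocallyPathConnectedSpace U := hU.locallyPathConnectedSpace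
  -- The inclusion of the simply connected set U lifts to the covering, starting from the given
  -- germ; the lift is the continuation.
  obtain ⟨F, ⟨hF0, hF⟩, -⟩ := (hA.isCoveringMap hne).existsUnique_continuousMap_lifts
    (⟨Subtype.val, continuous_subtype_val⟩ : C(U, X)) ⟨p, hp⟩ (GermSpace.ofSection hs) rfl
  have hb : ∀ q : U, (F q).base = q := fun q => congrFun hF q
  let s' : X → B := fun q => if h : q ∈ U then (F ⟨q, h⟩).val else s q
  have hs' : ∀ q (h : q ∈ U), s' q = (F ⟨q, h⟩).val := fun q h => dif_pos h
  refine ⟨s', fun q hq => ?_, by rw [hs' p hp, hF0]; rfl⟩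
  obtain ⟨t, ht, htv⟩ := (F ⟨q, hq⟩).exists_germ
  rw [hb] at ht htv
  -- The graph of t is open in the germ space, so by continuity the lift stays in it near q, and s'
  -- agrees there with the section t.
  refine hcongr t s' q ht ?_
  obtain ⟨W, hWA, hW, hqW⟩ := eventually_nhds_iff.1 (hA.eventually t q ht)
  have ho := (hA.isOpen_graph hW hWA).preimage F.continuous
  have h1 : ∀ᶠ r : U in 𝓝 ⟨q, hq⟩, F r ∈ {e : GermSpace A | e.base ∈ W ∧ e.val = t e.base} :=
    ho.mem_nhds ⟨by rw [hb]; exact hqW, by rw [hb]; exact htv.symm⟩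
  rw [hU.isOpenEmbedding_subtypeVal.nhds_eq_comap, eventually_comap] at h1
  filter_upwards [h1, hU.mem_nhds hq] with r hr hrU
  rw [hs' r hrU, (hr ⟨r, hrU⟩ rfl).2, hb]

end HasUniqueExtension

end Continuation

end KEM

end

noncomputable section

namespace KEM

/-! ### The tensor form of the separation theorem -/

/-- A space of vectors contains one whose coordinates coincide only if they coincide for all vectors
of the space. -/
lemma exists_generic {n : ℕ} (V : Submodule ℝ (Fin n → ℝ)) :
    ∃ l ∈ V, ∀ i j, l i = l j → ∀ l' ∈ V, l' i = l' j := by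
  by_contra! hcon
  let ι := {ij : Fin n × Fin n // ∃ l ∈ V, l ij.1 ≠ l ij.2}
  let P : ι → Subspace ℝ V := fun ij => LinearMap.ker
    ((LinearMap.proj (R := ℝ) (φ := fun _ : Fin n => ℝ) ij.1.1 -
      LinearMap.proj (R := ℝ) (φ := fun _ : Fin n => ℝ) ij.1.2).comp V.subtype)
  have hmem : ∀ (ij : ι) (v : V), v ∈ P ij ↔ v.1 ij.1.1 = v.1 ij.1.2 := by
    intro ij v
    simp [P, sub_eq_zero]
  have hcov : ⋃ ij, (P ij : Set V) = univ := by
    refine eq_univ_of_forall fun v => ?_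
    obtain ⟨i, j, hij, l', hl', hne⟩ := hcon v.1 v.2
    exact mem_iUnion.2 ⟨⟨(i, j), l', hl', hne⟩, (hmem _ v).2 hij⟩
  -- A real vector space is not a finite union of proper subspaces, and each coincidence violated
  -- somewhere in V cuts out a proper one.
  obtain ⟨ij, htop⟩ := Subspace.exists_eq_top_of_iUnion_eq_univ hcov
  obtain ⟨l, hl, hne⟩ := ij.2
  exact hne ((hmem ij ⟨l, hl⟩).1 (htop ▸ Submodule.mem_top))

/-- The values at `x` of the solutions on a box. -/
def solValues {n : ℕ} (h : Fin n → (Fin n → ℝ) → ℝ) (J : Fin n → Set ℝ) (x : Fin n → ℝ) :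
    Submodule ℝ (Fin n → ℝ) where
  carrier := {l | ∃ lam, IsSol h J lam ∧ ∀ i, l i = lam i (x i)}
  add_mem' := by
    rintro l l' ⟨lam, hlam, hl⟩ ⟨mu, hmu, hl'⟩
    exact ⟨_, hlam.add hmu, fun i => by rw [Pi.add_apply, hl, hl']⟩
  zero_mem' := ⟨_, IsSol.const 0, fun _ => rfl⟩
  smul_mem' := by
    rintro c l ⟨lam, hlam, hl⟩
    exact ⟨_, hlam.smul c, fun i => by rw [Pi.smul_apply, hl, smul_eq_mul]⟩

/-! ### The finest concircular tensor -/

section Global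

variable {n : ℕ} {M : Type*} [TopologicalSpace M] [ChartedSpace (Fin n → ℝ) M]
  {g K L : Tensor2 n M} {p : M} {κ : ℝ}

lemma eigSpace_eq_top {c : ℝ} (h : L p = c • g p) : eigSpace g L p c = ⊤ :=
  LinearMap.ker_eq_top.2 (sub_eq_zero.2 h)

/-- The metric corresponds to the constant solution 1; it supplies the global section required for
the covering, and the reference tensor in the proof of nontriviality. -/
lemma admissibleAt_metric (hg : IsPseudoRiemannian g) (hκ : HasConstantCurvature g κ)
    (hK : IsCharacteristicKilling g K) (hn : 1 < n) (p : M) : AdmissibleAt g K g p := by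
  obtain ⟨φ, J, H, hJ, hJs, hp, -⟩ := hK.exists_adapted_box hg hκ isOpen_univ (mem_univ p)
  refine H.admissibleAt_of_isSol hg hn hJ hJs (IsSol.const 1) (fun x hx i j => ?_) hp.1 hp.2
  split_ifs with hij
  · rw [one_mul, hij]
  · exact H.orth.off_diag x (hJs hx) i j hij

lemma hasUniqueExtension (hg : IsPseudoRiemannian g) (hκ : HasConstantCurvature g κ)
    (hK : IsCharacteristicKilling g K) (hn : 1 < n) :
    HasUniqueExtension fun (s : M → LinearMap.BilinForm ℝ (Fin n → ℝ)) (q : M) =>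
      AdmissibleAt g K s q where
  eventually s q h := isOpen_admissibleAt.mem_nhds h
  exists_nhds p := by
    obtain ⟨φ, J, H, hJ, hJs, hp, -⟩ := hK.exists_adapted_box hg hκ isOpen_univ (mem_univ p)
    refine ⟨_, φ.isOpen_inter_preimage hJ.isOpen, hp, fun s q hq h => ?_,
      fun s s' hs hs' q hq he r hr => H.eq_of_eq_at hn hJ hJs hs hs' hq he hr⟩
    obtain ⟨L', hL', W, hW, hqW, he⟩ := H.exists_extension hg hn hJ hJs hq.1 hq.2 h
    exact ⟨L', hL', Filter.eventually_of_mem (hW.mem_nhds hqW) he⟩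

lemma AdmissibleAt.exists_continuation (hg : IsPseudoRiemannian g)
    (hκ : HasConstantCurvature g κ) (hK : IsCharacteristicKilling g K) (hn : 1 < n) {U : Set M}
    (hU : IsOpen U) (hUs : SimplyConnectedSpace U) (hp : p ∈ U) (hL : AdmissibleAt g K L p) :
    ∃ L' : Tensor2 n M, (∀ q ∈ U, AdmissibleAt g K L' q) ∧ L' p = L p := by
  have : LocallyPathConnectedSpace M := ChartedSpace.locallyPathConnectedSpace (Fin n → ℝ) M
  refine (hasUniqueExtension hg hκ hK hn).exists_continuation (fun s s' q hs he => ?_)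
    ⟨_, admissibleAt_metric hg hκ hK hn⟩ hU hp (s := L) hL
  obtain ⟨W, hWe, hW, hqW⟩ := eventually_nhds_iff.1 he
  exact AdmissibleAt.congr hs hW hqW hWe

/-- Fineness and nontriviality need only be arranged at one point p₀: continuation defines the
tensor on U, and comparison of eigenspaces is transported along the connected set U. -/
theorem exists_finest_concircular (hg : IsPseudoRiemannian g) (hκ : HasConstantCurvature g κ)
    (hK : IsCharacteristicKilling g K) (hn : 1 < n) {U : Set M} (hU : IsOpen U)
    (hUs : SimplyConnectedSpace U) :
    ∃ L : Tensor2 n M, IsConcircularOn g L U ∧ IsNontrivialOn g L U ∧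
      LeavesEigenspacesInvariantOn g K L U ∧
      ∀ (V : Set M) (L' : Tensor2 n M), IsOpen V → V ⊆ U → IsConcircularOn g L' V →
        LeavesEigenspacesInvariantOn g K L' V → ∀ p ∈ V, FinerAt g L L' p := by
  have hUc : IsPreconnected U := isPreconnected_iff_preconnectedSpace.2 inferInstance
  obtain ⟨p₀, hp₀⟩ : U.Nonempty := nonempty_coe_sort.1 inferInstance
  obtain ⟨φ, J, H, hJ, hJs, hpJ, hsU⟩ := hK.exists_adapted_box hg hκ hU hp₀
  have hsep := H.sep.mono hJ.isOpen hJs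
  have hmem : ∀ x ∈ univ.pi J, φ.symm x ∈ U := fun x hx =>
    hsU ⟨φ.map_target (hJs hx), by rw [mem_preimage, φ.right_inv (hJs hx)]; exact hx⟩
  -- A solution whose eigenvalues at p₀ coincide only where those of every solution on the box do.
  obtain ⟨l, ⟨lam, hlam, hl⟩, hgen⟩ := exists_generic (solValues (diagOf (comp g φ)) J (φ p₀))
  have hdiag := H.isDiagOn_tensorOf hJs lam
  obtain ⟨L, hLA, hLp⟩ := (H.admissibleAt_of_isSol hg hn hJ hJs hlam hdiag hpJ.1
    hpJ.2).exists_continuation hg hκ hK hn hU hUs hp₀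
  have hLl : ∀ i j, comp L φ (φ p₀) i j =
      if i = j then l i * comp g φ (φ p₀) i i else 0 := by
    intro i j
    rw [comp_congr (T' := tensorOf φ fun x => Matrix.diagonal fun i => lam i (x i) *
      comp g φ x i i) (by rw [φ.left_inv hpJ.1, hLp]), hdiag _ hpJ.2, hl]
  have hfiner : ∀ L' : Tensor2 n M, (∀ q ∈ U, AdmissibleAt g K L' q) →
      ∀ q ∈ U, FinerAt g L L' q := by
    intro L' hL' q hq
    refine finerAt_of_isPreconnected hg hκ hK hU hUc hLA hL' hp₀ ?_ hq
    obtain ⟨mu, hmu, hd⟩ := H.exists_isSol hJ hJs fun x hx => hL' _ (hmem x hx)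
    rw [← φ.left_inv hpJ.1, H.finerAt_iff (hJs hpJ.2) hLl (l' := fun i => mu i (φ p₀ i))
      (hd _ hpJ.2)]
    exact fun i j hij => hgen i j hij _ ⟨mu, hmu, fun _ => rfl⟩
  refine ⟨L, isConcircularOn_of_admissibleAt hLA, fun _ q hq c hc => ?_,
    leavesEigenspacesInvariantOn_of_admissibleAt hLA, fun V L' hV hVU hc hi p hp => ?_⟩
  -- If L were a multiple of the metric at q, the metric would be finer than L at q, hence at p₀.
  -- Then all entries of l agree, and by genericity all solutions have a single eigenvalue at p₀,
  -- contrary to the existence of a nontrivial one.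
  · obtain ⟨mu, hmu, hne⟩ := hsep.exists_sol hJ hn
    obtain ⟨i, j, hij⟩ := hne _ hpJ.2
    refine hij ?_
    have h1 : FinerAt g g L q := by
      exact fun _ => ⟨c, le_top.trans_eq (eigSpace_eq_top hc).symm⟩
    have h2 := finerAt_of_isPreconnected hg hκ hK hU hUc
      (fun q _ => admissibleAt_metric hg hκ hK hn q) hLA hq h1 hp₀
    rw [← φ.left_inv hpJ.1, H.finerAt_iff (hJs hpJ.2) (l := fun _ => 1) (fun i j => by
      split_ifs with hij
      · rw [one_mul, hij]
      · exact H.orth.off_diag _ (hJs hpJ.2) i j hij) hLl] at h2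
    exact hgen i j (h2 i j rfl) _ ⟨mu, hmu, fun _ => rfl⟩
  -- A competitor given only on V is replaced by the continuation of its germ at p to all of U; only
  -- its value at p matters for the comparison.
  · have hA : AdmissibleAt g K L' p := ⟨V, hV, hp, hc, hi⟩
    obtain ⟨L'', hL'', he⟩ := hA.exists_continuation hg hκ hK hn hU hUs (hVU hp)
    intro μ
    obtain ⟨ν, hν⟩ := hfiner L'' hL'' p (hVU hp) μ
    refine ⟨ν, hν.trans_eq ?_⟩
    rw [eigSpace, eigSpace, he]

lemma isConcircularOn_metric_of_subsingleton (hg : IsPseudoRiemannian g) (hn : ¬ 1 < n)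
    (U : Set M) : IsConcircularOn g g U := by
  have : Subsingleton (Fin n) := Fin.subsingleton_iff_le_one.2 (not_lt.1 hn)
  refine ⟨hg.1.mono (subset_univ U), fun φ hφ x hx _ => ⟨fun _ => 0, fun i j k => ?_⟩⟩
  have ho : IsOrthogonal g φ := fun x _ i j hij => (hij (Subsingleton.elim i j)).elim
  rw [(ho.orthMetric hg hφ).concircular_of_diag (T := comp g φ) (m := fun _ _ => 1)
    (fun x _ i j => by rw [if_pos (Subsingleton.elim i j), one_mul, Subsingleton.elim j i]) hx
    (fun _ => differentiableAt_const _) (fun i k hik => (hik (Subsingleton.elim i k)).elim)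
    (fun i j hij => (hij (Subsingleton.elim i j)).elim)]
  simp [pd]

lemma exists_eq_smul_metric_of_subsingleton [IsManifold 𝓘(ℝ, Fin n → ℝ) ∞ M]
    (hg : IsPseudoRiemannian g) (hn : ¬ 1 < n) (L : Tensor2 n M) (p : M) :
    ∃ c : ℝ, L p = c • g p := by
  have : Subsingleton (Fin n) := Fin.subsingleton_iff_le_one.2 (not_lt.1 hn)
  let φ := chartAt (Fin n → ℝ) p
  have hφ : IsCoord φ := IsManifold.chart_mem_maximalAtlas p
  have hp : p ∈ φ.source := mem_chart_source _ p
  have ho : IsOrthogonal g φ := fun x _ i j hij => (hij (Subsingleton.elim i j)).elim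
  have H := ho.orthMetric hg hφ
  rcases isEmpty_or_nonempty (Fin n) with hE | ⟨⟨a⟩⟩
  · exact ⟨0, asForm_eq_of_comp_eq (T := L) (T' := fun q => (0 : ℝ) • g q) hφ hp
      (Subsingleton.elim _ _)⟩
  · refine ⟨comp L φ (φ p) a a / comp g φ (φ p) a a,
      asForm_eq_of_comp_eq (T := L) (T' := fun q => (comp L φ (φ p) a a / comp g φ (φ p) a a) • g q)
        hφ hp ?_⟩
    ext i j
    have h1 : comp (fun q => (comp L φ (φ p) a a / comp g φ (φ p) a a) • g q) φ (φ p) i j =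
      comp L φ (φ p) a a / comp g φ (φ p) a a * comp g φ (φ p) i j := rfl
    rw [h1, Subsingleton.elim i a, Subsingleton.elim j a,
      div_mul_cancel₀ _ (H.ne_zero a _ (φ.map_source hp))]

end Global

end KEM

end

theorem mainTheorem1 {n : ℕ} {M : Type*} [TopologicalSpace M] [T2Space M]
    [ChartedSpace (Fin n → ℝ) M] [IsManifold 𝓘(ℝ, Fin n → ℝ) ∞ M]
    (g : KEM.Tensor2 n M) (hg : KEM.IsPseudoRiemannian g)
    (κ : ℝ) (hκ : KEM.HasConstantCurvature g κ) :
    (∀ φ : OpenPartialHomeomorph M (Fin n → ℝ), KEM.IsCoord φ →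
      KEM.IsOrthogonal g φ → KEM.IsSeparable g φ →
      ∀ J : Fin n → Set ℝ, (∀ i, IsOpen (J i) ∧ (J i).OrdConnected ∧ (J i).Nonempty) →
        univ.pi J ⊆ φ.target → KEM.HasConcircularForm (KEM.comp g φ) J) ∧
    (∀ K : KEM.Tensor2 n M, KEM.IsCharacteristicKilling g K →
      ∀ U : Set M, IsOpen U → SimplyConnectedSpace U →
        ∃ L : KEM.Tensor2 n M,
          KEM.IsConcircularOn g L U ∧ KEM.IsNontrivialOn g L U ∧
          KEM.LeavesEigenspacesInvariantOn g K L U ∧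
          ∀ (V : Set M) (L' : KEM.Tensor2 n M), IsOpen V → V ⊆ U →
            KEM.IsConcircularOn g L' V → KEM.LeavesEigenspacesInvariantOn g K L' V →
            ∀ p ∈ V, ∀ μ : ℝ, ∃ ν : ℝ, KEM.eigSpace g L p μ ≤ KEM.eigSpace g L' p ν) := by
  refine ⟨fun φ hφ ho hs J hJ hJs => hs.hasConcircularForm hg hκ hφ ho hJ hJs,
    fun K hK U hU hUs => ?_⟩
  by_cases hn : 1 < n
  · exact KEM.exists_finest_concircular hg hκ hK hn hU hUs
  -- In dimension at most one the metric itself works: every bilinear form is a multiple of it, so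
  -- its only possible eigenspaces are trivial to compare.
  · refine ⟨g, KEM.isConcircularOn_metric_of_subsingleton hg hn U, fun h => (hn h).elim,
      fun p _ μ v hv => ⟨v, hv, fun _ => rfl⟩, fun V L' _ _ _ _ p _ μ => ?_⟩
    obtain ⟨c, hc⟩ := KEM.exists_eq_smul_metric_of_subsingleton hg hn L' p
    exact ⟨c, le_top.trans_eq (KEM.eigSpace_eq_top hc).symm⟩
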